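/- **Setting.** Fix $T>0$, $p\in[2,3)$, $q\in[2,\infty)$, $r\in[1,\infty]$, a filtered probability space $(\Omega,\mathcal F,(\mathcal F_t)_{t\in[0,T]},\mathbb P)$ (no usual conditions assumed), and write $\mathbb E_s=\mathbb E[\,\cdot\,|\mathcal F_s]$, $\delta A_{s,t}=A_t-A_s$, $\|Z\|_{q,r,s}=\|\mathbb E_s[|Z|^q]\|_{L^r}^{1/q}$. A partition of $[s,t]$ is a finite sequence $s=t_0<\dots<t_n=t$, with mesh size $|\mathcal P|=\max_i(t_{i+1}-t_i)$; $[u,v]\in\mathcal P$ denotes consecutive points. For a two-parameter function $A$ (deterministic or random) on $\{0\le s\le t\le T\}$ let $$\|A\|_{p,[s,t]}=\Big(\sup_{\mathcal P}\sum_{[u,v]\in\mathcal P}|A_{u,v}|^p\Big)^{1/p},\quad \|A\|_{p,q,[s,t]}=\Big(\sup_{\mathcal P}\sum_{[u,v]\in\mathcal P}\|A_{u,v}\|_{L^q}^p\Big)^{1/p},\quad \|A\|_{p,q,r,[s,t]}=\Big(\sup_{\mathcal P}\sum_{[u,v]\in\mathcal P}\|A_{u,v}\|_{q,r,u}^p\Big)^{1/p},$$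 the suprema being over partitions of $[s,t]$ (also with other exponents in place of $p,q$, the second one also with $q=\infty$); for a path $Y$ these are taken of $\delta Y$; over $[s,t)$ they are the limits as $u\nearrow t$ of those over $[s,u]$, and $0$ if $s=t$. $\mathbf X=(X,\mathbb X)$ is a càdlàg rough path: $X:[0,T]\to\mathbb R^d$ is càdlàg, $\mathbb X:\{s\le t\}\to\mathbb R^{d\times d}$ is càdlàg in each variable, $\|\mathbf X\|_{p,[0,T]}<\infty$ where $\|\mathbf X\|_{p,[s,t]}:=\|X\|_{p,[s,t]}+\|\mathbb X\|_{p/2,[s,t]}$, and $\mathbb X_{s,t}=\mathbb X_{s,u}+\mathbb X_{u,t}+\delta X_{s,u}\otimes\delta X_{u,t}$ for $s\le u\le t$. Here $\mathbb R^d$ and $\mathbb R^{d\times d}$ carry Euclidean norms. Let $E$ be a finite-dimensional real Banach space. $(Y,Y')$ is a stochastic controlled path relative to $X$: $Y$ and $Y'$ are adapted processes with values in $\mathcal L(\mathbb R^d;E)$ and $\mathcal L(\mathbb R^{d\times d};E)$ (operator norms), both are right-continuous in probability with $Y_0,Y_0'\in L^q$ and $\|Y\|_{p,q,r,[0,T]},\|Y'\|_{p,q,r,[0,T]}<\infty$,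 moreover $\sup_{s\in[0,T]}\|Y'_s\|_{L^{qr}}<\infty$, and $\|\mathbb E_{\boldsymbol\cdot}R^Y\|_{\frac p2,qr,[0,T]}<\infty$, where $R^Y_{s,t}=\delta Y_{s,t}-Y'_s\delta X_{s,t}$, $(Y'_sx)y:=Y'_s(x\otimes y)$ and $(\mathbb E_{\boldsymbol\cdot}R^Y)_{s,t}=\mathbb E_s[R^Y_{s,t}]$. Let $D_E$ be the infimum of all $K\ge0$ for which there is a Euclidean norm $|\cdot|_2$ on $E$ with $\|x\|\le|x|_2\le K\|x\|$ for all $x\in E$. **Statement.** There is a constant $C$ depending only on $p$, $q$ and $D_E$ (hence only on $p$ and $q$ if $E$ is Euclidean) such that the following holds. (a) There is an adapted, $L^q$-integrable process $\int_0^\cdot Y_u\,\mathrm d\mathbf X_u$, equal to $0$ a.s. at time $0$, such that for all $0\le s\le t\le T$, along partitions $\mathcal P$ of $[s,t]$, and with $\int_s^tY_u\,\mathrm d\mathbf X_u:=\int_0^tY_u\,\mathrm d\mathbf X_u-\int_0^sY_u\,\mathrm d\mathbf X_u$, $$\lim_{|\mathcal P|\to0}\Big\|\int_s^tY_u\,\mathrm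 d\mathbf X_u-\sum_{[u,v]\in\mathcal P}\big(Y_u\delta X_{u,v}+Y'_u\mathbb X_{u,v}\big)\Big\|_{q,r,s}=0 .$$ Every process with these properties satisfies (b)–(d). (b) For all $0\le s\le t\le T$, $$\Big\|\mathbb E_s\Big[\int_s^tY_u\,\mathrm d\mathbf X_u-Y_s\delta X_{s,t}-Y'_s\mathbb X_{s,t}\Big]\Big\|_{L^{qr}}\le C\Big(\|\mathbb E_{\boldsymbol\cdot}R^Y\|_{\frac p2,qr,[s,t)}\|X\|_{p,[s,t]}+\|Y'\|_{p,q,r,[s,t)}\|\mathbb X\|_{\frac p2,[s,t]}\Big)$$ and $$\Big\|\int_s^tY_u\,\mathrm d\mathbf X_u-Y_s\delta X_{s,t}-Y'_s\mathbb X_{s,t}\Big\|_{q,r,s}\le C\,B_{s,t},$$ $$B_{s,t}:=\Big(\|Y\|_{p,q,r,[s,t)}+\|Y'\|_{p,q,r,[s,t)}+\|\mathbb E_{\boldsymbol\cdot}R^Y\|_{\frac p2,qr,[s,t)}+\|X\|_{p,[s,t)}\sup_{u\in[0,T)}\|Y'_u\|_{L^{qr}}\Big)\|\mathbf X\|_{p,[s,t]}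 .$$ (c) If the filtration is complete (every $\mathbb P$-null event of $\mathcal F$ lies in $\mathcal F_0$), the process has an adapted version with càdlàg sample paths, and this version satisfies, for all $0\le s\le t\le T$, $$\Big\|\sup_{v\in[s,t]}\Big|\int_s^vY_u\,\mathrm d\mathbf X_u-\big(Y_s\delta X_{s,v}+Y'_s\mathbb X_{s,v}\big)\Big|\Big\|_{q,r,s}\le C\,B_{s,t}.$$ (d) $Z:=\int_0^\cdot Y_u\,\mathrm d\mathbf X_u$ is càdlàg as a path with values in $L^q$, and for every $t\in(0,T]$, almost surely, $$\Delta Z_t=Y_{t-}\Delta X_t+Y'_{t-}\Delta\mathbb X_t,$$ where $\Delta Z_t=Z_t-Z_{t-}$, the left limits $Z_{t-},Y_{t-},Y'_{t-}$ exist as limits in $L^q$, $\Delta X_t=X_t-\lim_{s\nearrow t}X_s$ and $\Delta\mathbb X_t=\lim_{s\nearrow t}\mathbb X_{s,t}$. -/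

import Mathlib

open MeasureTheory Filter Topology
open scoped ENNReal NNReal

noncomputable section

namespace RoughStoch

/-! ### Times, partitions and `p`-variation -/

/-- The time interval `[0,T]`. -/
abbrev TimeInterval (T : ℝ) : Type := Set.Icc (0 : ℝ) T

/-- The time `0` of `[0,T]`. -/
def initialTime (T : ℝ) [hT : Fact (0 < T)] : TimeInterval T := ⟨0, le_rfl, hT.out.le⟩

/-- The time `T` of `[0,T]`. -/
def finalTime (T : ℝ) [hT : Fact (0 < T)] : TimeInterval T := ⟨T, hT.out.le, le_rfl⟩

/-- A partition `s = t₀ < t₁ < ⋯ < tₙ = t` of `[s,t] ⊆ [0,T]`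
(with `n = 0` exactly when `s = t`). -/
structure TimePartition {T : ℝ} (s t : TimeInterval T) where
  n : ℕ
  time : Fin (n + 1) → TimeInterval T
  strictMono_time : StrictMono time
  time_zero : time 0 = s
  time_last : time (Fin.last n) = t

namespace TimePartition

variable {T : ℝ} {s t : TimeInterval T}

/-- The mesh size, i.e. the largest length of an interval of the partition. -/
def mesh (π : TimePartition s t) : ℝ :=
  ⨆ i : Fin π.n, ((π.time i.succ : ℝ) - (π.time i.castSucc : ℝ))

/-- The sum `∑_{[u,v] ∈ π} A u v`. -/
def sum {M : Type*} [AddCommMonoid M] (π : TimePartition s t)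
    (A : TimeInterval T → TimeInterval T → M) : M :=
  ∑ i : Fin π.n, A (π.time i.castSucc) (π.time i.succ)

end TimePartition

/-- The filter "`|π| → 0`" on the partitions `π` of `[s,t]`. -/
def meshToZero {T : ℝ} (s t : TimeInterval T) : Filter (TimePartition s t) :=
  comap TimePartition.mesh (𝓝 0)

/-- `(sup_π ∑_{[u,v] ∈ π} g(u,v)^p)^{1/p}`, the supremum being over all partitions `π` of `[s,t]`.
Here `g u v` is the size, in whichever norm is relevant, of a two-parameter function at `(u,v)`. -/
def pVar {T : ℝ} (p : ℝ) (g : TimeInterval T → TimeInterval T → ℝ≥0∞)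
    (s t : TimeInterval T) : ℝ≥0∞ :=
  (⨆ π : TimePartition s t, π.sum fun u v => g u v ^ p) ^ (1 / p)

/-- The variation over the half-open interval `[s,t)`. Since `u ↦ pVar p g s u` is non-decreasing,
the limit as `u ↗ t` is the supremum over `s ≤ u < t`; it is `0` if `s = t`. -/
def pVarLeft {T : ℝ} (p : ℝ) (g : TimeInterval T → TimeInterval T → ℝ≥0∞)
    (s t : TimeInterval T) : ℝ≥0∞ :=
  ⨆ (u : TimeInterval T) (_ : s ≤ u ∧ u < t), pVar p g s u

/-- Right-continuous with left limits. -/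
def IsCadlag {T : ℝ} {V : Type*} [TopologicalSpace V] (f : TimeInterval T → V) : Prop :=
  ∀ t, Tendsto f (𝓝[>] t) (𝓝 (f t)) ∧ ∃ l, Tendsto f (𝓝[<] t) (𝓝 l)

/-- A two-parameter function on `{(s,t) : s ≤ t}` which is càdlàg in each of its two variables. -/
structure IsCadlag₂ {T : ℝ} {V : Type*} [TopologicalSpace V]
    (A : TimeInterval T → TimeInterval T → V) : Prop where
  right_snd : ∀ s t, s ≤ t → Tendsto (fun v => A s v) (𝓝[>] t) (𝓝 (A s t))
  left_snd : ∀ s t, s < t → ∃ l, Tendsto (fun v => A s v) (𝓝[<] t) (𝓝 l)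
  right_fst : ∀ s t, s < t → Tendsto (fun u => A u t) (𝓝[>] s) (𝓝 (A s t))
  left_fst : ∀ s t, s ≤ t → ∃ l, Tendsto (fun u => A u t) (𝓝[<] s) (𝓝 l)

/-! ### Càdlàg rough paths -/

/-- `ℝ^d` with the Euclidean norm. -/
abbrev Vec (d : ℕ) : Type := EuclideanSpace ℝ (Fin d)

/-- `ℝ^{d × d} = ℝ^d ⊗ ℝ^d` with the Euclidean (Hilbert-Schmidt) norm. -/
abbrev Mat (d : ℕ) : Type := EuclideanSpace ℝ (Fin d × Fin d)

/-- `y ↦ x ⊗ y`, where `(x ⊗ y)_{ij} = x_i y_j`. -/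
def tensor {d : ℕ} (x : Vec d) : Vec d →L[ℝ] Mat d :=
  LinearMap.toContinuousLinearMap
    { toFun := fun y => WithLp.toLp 2 fun ij : Fin d × Fin d => x ij.1 * y ij.2
      map_add' := by
        intro y z
        ext ij
        simp [mul_add]
      map_smul' := by
        intro c y
        ext ij
        simp [mul_left_comm] }

/-- The size of the increment `δX_{u,v} = X_v - X_u`, so that `‖X‖_{p,[s,t]}` is
`pVar p (incrSize X) s t`. -/
def incrSize {T : ℝ} {d : ℕ} (X : TimeInterval T → Vec d) (u v : TimeInterval T) : ℝ≥0∞ :=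
  ‖X v - X u‖ₑ

/-- The size of a deterministic two-parameter function, so that `‖𝕏‖_{p/2,[s,t]}` is
`pVar (p / 2) (twoParamSize XX) s t`. -/
def twoParamSize {T : ℝ} {d : ℕ} (XX : TimeInterval T → TimeInterval T → Mat d)
    (u v : TimeInterval T) : ℝ≥0∞ :=
  ‖XX u v‖ₑ

/-- The seminorm `‖(X,𝕏)‖_{p,[s,t]} = ‖X‖_{p,[s,t]} + ‖𝕏‖_{p/2,[s,t]}`. -/
def roughNorm {T : ℝ} {d : ℕ} (p : ℝ) (X : TimeInterval T → Vec d)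
    (XX : TimeInterval T → TimeInterval T → Mat d) (s t : TimeInterval T) : ℝ≥0∞ :=
  pVar p (incrSize X) s t + pVar (p / 2) (twoParamSize XX) s t

/-- `(X,𝕏)` is a càdlàg rough path of finite `p`-variation. Only the values `𝕏_{s,t}` with
`s ≤ t` matter. -/
structure IsCadlagRoughPath {T : ℝ} [Fact (0 < T)] {d : ℕ} (p : ℝ) (X : TimeInterval T → Vec d)
    (XX : TimeInterval T → TimeInterval T → Mat d) : Prop where
  cadlag : IsCadlag X
  cadlag₂ : IsCadlag₂ XX
  finite_var : roughNorm p X XX (initialTime T) (finalTime T) < ∞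
  chen : ∀ s u t, s ≤ u → u ≤ t → XX s t = XX s u + XX u t + tensor (X u - X s) (X t - X u)

/-! ### Norms of random variables and processes -/

section Processes

variable {T : ℝ} {Ω : Type*} [mΩ : MeasurableSpace Ω]

/-- `‖f‖_{q,r,s} = ‖E_s[f^q]‖_{L^r}^{1/q}` for a random variable `f` with values in `[0,∞]`, where
`E_s` is the (always defined) conditional expectation of a `[0,∞]`-valued random variable. -/
def condNorm (F : Filtration (TimeInterval T) mΩ) (P : Measure Ω) (q : ℝ) (r : ℝ≥0∞)
    (s : TimeInterval T) (f : Ω → ℝ≥0∞) : ℝ≥0∞ :=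
  eLpNorm (condLExp (F s) P fun ω => f ω ^ q) r P ^ (1 / q)

variable {V : Type*} [NormedAddCommGroup V]

/-- `‖δY_{u,v}‖_{q,r,u}`, so that `‖Y‖_{p,q,r,[s,t]}` is `pVar p (condIncrSize F P q r Y) s t`. -/
def condIncrSize (F : Filtration (TimeInterval T) mΩ) (P : Measure Ω) (q : ℝ) (r : ℝ≥0∞)
    (Y : TimeInterval T → Ω → V) (u v : TimeInterval T) : ℝ≥0∞ :=
  condNorm F P q r u fun ω => ‖Y v ω - Y u ω‖ₑ

/-- The space `V^p L^{q,r}`. -/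
structure MemVpLqr [Fact (0 < T)] (F : Filtration (TimeInterval T) mΩ) (P : Measure Ω)
    (p q : ℝ) (r : ℝ≥0∞) (Y : TimeInterval T → Ω → V) : Prop where
  aestronglyMeasurable : ∀ t, AEStronglyMeasurable (Y t) P
  right_cont : ∀ s, TendstoInMeasure P Y (𝓝[>] s) (Y s)
  memLp_initial : MemLp (Y (initialTime T)) (ENNReal.ofReal q) P
  finite_var : pVar p (condIncrSize F P q r Y) (initialTime T) (finalTime T) < ∞

/-- `l` is the limit in `L^q` of `Z_s` as `s ↗ t`. -/
def IsLeftLimLq (P : Measure Ω) (q : ℝ) (Z : TimeInterval T → Ω → V) (t : TimeInterval T)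
    (l : Ω → V) : Prop :=
  MemLp l (ENNReal.ofReal q) P ∧
    Tendsto (fun s => eLpNorm (Z s - l) (ENNReal.ofReal q) P) (𝓝[<] t) (𝓝 0)

/-- `t ↦ Z_t` is a càdlàg path with values in `L^q`. -/
def IsCadlagInLq (P : Measure Ω) (q : ℝ) (Z : TimeInterval T → Ω → V) : Prop :=
  (∀ t, MemLp (Z t) (ENNReal.ofReal q) P) ∧
  (∀ t, Tendsto (fun s => eLpNorm (Z s - Z t) (ENNReal.ofReal q) P) (𝓝[>] t) (𝓝 0)) ∧
  (∀ t, ∃ l, IsLeftLimLq P q Z t l)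

/-- The filtration is complete: every null event belongs to `F_0`. -/
def IsCompleteFiltration [Fact (0 < T)] (F : Filtration (TimeInterval T) mΩ) (P : Measure Ω) :
    Prop :=
  ∀ N : Set Ω, MeasurableSet N → P N = 0 → MeasurableSet[F (initialTime T)] N

/-! ### Stochastic controlled paths and rough stochastic integrals

The integrand `Y` takes values in `L(ℝ^d; E)` and its derivative `Y'` in
`L(ℝ^d ⊗ ℝ^d; E) ≅ L(ℝ^d; L(ℝ^d; E))`, all with operator norms. -/

variable {d : ℕ} {E : Type*} [NormedAddCommGroup E] [NormedSpace ℝ E]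

/-- The remainder `R^Y_{s,t} = δY_{s,t} - Y'_s δX_{s,t}`, where `Y'_s x ∈ L(ℝ^d; E)` is
`y ↦ Y'_s (x ⊗ y)`. -/
def remainder (X : TimeInterval T → Vec d) (Y : TimeInterval T → Ω → Vec d →L[ℝ] E)
    (Y' : TimeInterval T → Ω → Mat d →L[ℝ] E) (s t : TimeInterval T) (ω : Ω) : Vec d →L[ℝ] E :=
  Y t ω - Y s ω - (Y' s ω).comp (tensor (X t - X s))

/-- `‖E_u[R^Y_{u,v}]‖_{L^{qr}}`, so that `‖E_· R^Y‖_{p/2,qr,[s,t]}` is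
`pVar (p / 2) (condRemSize F P q r X Y Y') s t`. -/
def condRemSize [CompleteSpace E] (F : Filtration (TimeInterval T) mΩ) (P : Measure Ω) (q : ℝ)
    (r : ℝ≥0∞) (X : TimeInterval T → Vec d) (Y : TimeInterval T → Ω → Vec d →L[ℝ] E)
    (Y' : TimeInterval T → Ω → Mat d →L[ℝ] E) (u v : TimeInterval T) : ℝ≥0∞ :=
  eLpNorm (P[remainder X Y Y' u v | F u]) (ENNReal.ofReal q * r) P

/-- `(Y,Y')` is a stochastic controlled path relative to `X`. -/
structure IsStochControlledPath [Fact (0 < T)] [CompleteSpace E]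
    (F : Filtration (TimeInterval T) mΩ) (P : Measure Ω)
    (p q : ℝ) (r : ℝ≥0∞) (X : TimeInterval T → Vec d) (Y : TimeInterval T → Ω → Vec d →L[ℝ] E)
    (Y' : TimeInterval T → Ω → Mat d →L[ℝ] E) : Prop where
  adapted : StronglyAdapted F Y
  adapted_deriv : StronglyAdapted F Y'
  memVpLqr : MemVpLqr F P p q r Y
  memVpLqr_deriv : MemVpLqr F P p q r Y'
  bounded_deriv : ⨆ s, eLpNorm (Y' s) (ENNReal.ofReal q * r) P < ∞
  finite_var_rem :
    pVar (p / 2) (condRemSize F P q r X Y Y') (initialTime T) (finalTime T) < ∞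

/-- The summand `Y_u δX_{u,v} + Y'_u 𝕏_{u,v}`. -/
def germ (X : TimeInterval T → Vec d) (XX : TimeInterval T → TimeInterval T → Mat d)
    (Y : TimeInterval T → Ω → Vec d →L[ℝ] E) (Y' : TimeInterval T → Ω → Mat d →L[ℝ] E)
    (u v : TimeInterval T) (ω : Ω) : E :=
  Y u ω (X v - X u) + Y' u ω (XX u v)

/-- `I` is the rough stochastic integral `∫_0^· Y dX` (so `∫_s^t Y dX = I_t - I_s`): an
`L^q`-integrable adapted process started at `0` whose increments are, for all `s ≤ t`, the limits
in `‖·‖_{q,r,s}` of the Riemann sums along partitions of `[s,t]` with vanishing mesh size. -/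
structure IsRoughStochIntegral (F : Filtration (TimeInterval T) mΩ) [Fact (0 < T)]
    (P : Measure Ω) (q : ℝ) (r : ℝ≥0∞) (X : TimeInterval T → Vec d)
    (XX : TimeInterval T → TimeInterval T → Mat d) (Y : TimeInterval T → Ω → Vec d →L[ℝ] E)
    (Y' : TimeInterval T → Ω → Mat d →L[ℝ] E) (I : TimeInterval T → Ω → E) : Prop where
  adapted : StronglyAdapted F I
  memLp : ∀ t, MemLp (I t) (ENNReal.ofReal q) P
  initial : I (initialTime T) =ᵐ[P] 0
  tendsto : ∀ s t, s ≤ t →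
    Tendsto
      (fun π : TimePartition s t =>
        condNorm F P q r s fun ω =>
          ‖I t ω - I s ω - π.sum fun u v => germ X XX Y Y' u v ω‖ₑ)
      (meshToZero s t) (𝓝 0)

/-- The quantity
`(‖Y‖_{p,q,r,[s,t)} + ‖Y'‖_{p,q,r,[s,t)} + ‖E_· R^Y‖_{p/2,qr,[s,t)}
  + ‖X‖_{p,[s,t)} sup_{u ∈ [0,T)} ‖Y'_u‖_{L^{qr}}) ‖(X,𝕏)‖_{p,[s,t]}`. -/
def integralBound [CompleteSpace E] (F : Filtration (TimeInterval T) mΩ) (P : Measure Ω)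
    (p q : ℝ) (r : ℝ≥0∞) (X : TimeInterval T → Vec d)
    (XX : TimeInterval T → TimeInterval T → Mat d) (Y : TimeInterval T → Ω → Vec d →L[ℝ] E)
    (Y' : TimeInterval T → Ω → Mat d →L[ℝ] E) (s t : TimeInterval T) : ℝ≥0∞ :=
  (pVarLeft p (condIncrSize F P q r Y) s t + pVarLeft p (condIncrSize F P q r Y') s t
    + pVarLeft (p / 2) (condRemSize F P q r X Y Y') s t
    + pVarLeft p (incrSize X) s t *
      ⨆ (u : TimeInterval T) (_ : (u : ℝ) < T), eLpNorm (Y' u) (ENNReal.ofReal q * r) P)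
  * roughNorm p X XX s t

end Processes

/-- The distortion of the norm of a finite-dimensional space from a Euclidean norm: the infimum of
all `K` such that `‖x‖ ≤ |x| ≤ K ‖x‖` for some Euclidean norm `|·|` on `E`. It is `1` if `E` is
Euclidean and nonzero. -/
def euclideanDistortion (E : Type*) [NormedAddCommGroup E] [NormedSpace ℝ E] : ℝ≥0 :=
  sInf {K : ℝ≥0 | ∃ e : E ≃L[ℝ] EuclideanSpace ℝ (Fin (Module.finrank ℝ E)),
    ∀ x, ‖x‖ ≤ ‖e x‖ ∧ ‖e x‖ ≤ K * ‖x‖}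

end RoughStoch

end

open RoughStoch

/-! The rough stochastic integral is obtained by stochastic sewing of the germ
`A_{s,t} = Y_s δX_{s,t} + Y'_s 𝕏_{s,t}`. By Chen's relation (`defect_germ`) its defect is
`A_{s,t} - A_{s,u} - A_{u,t} = -R^Y_{s,u} δX_{u,t} - δY'_{s,u} 𝕏_{u,t}`. The conditional mean of the
defect is bounded with the exponent `3/p > 1`, its size only with the exponent `2/p > 1/2`; the former
controls the drift of Riemann sums, the latter their fluctuations, through orthogonality of martingale
differences.

*Removing the exponent `r`.* The norm `‖·‖_{q,r,s}` is the supremum of the `L^q` norms under the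
measures `h • P`, where `h` is a bounded `F_s`-measurable density in the unit ball of the dual of
`L^r` (`IsWeight`, `condNorm_le_of_forall_weight`). Conditional expectations given `F_a` with `s ≤ a`
are the same under `P` and `h • P`, so that all probabilistic estimates take place in `L^q` of a finite
measure.

*Martingales.* `L^q` of a Hilbert space is two-smooth (`eLpNorm_add_sq_le`), which with Doob's
inequality gives a maximal inequality for sums of arbitrary adapted increments
(`eLpNorm_iSup_sum_le`). It is transferred to `E` by Euclidean coordinates, and here the distortion
enters the constant.

*Discrete sewing.* Along a finite sequence of times, the maximal distance of the Riemann sum to the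
germ is bounded by `eLpNorm_iSup_sewErr_le`. The proof splits the interval into `2N + 2` pieces of
control at most `1/N` of the total, or elementary ones, and applies the maximal inequality to the
pieces; the induction closes because `N^{1/2 - β}` is small for `β = 2/p > 1/2`. Since no property of
the control other than superadditivity is used, jumps are harmless at this stage.

*Jumps.* The control is built from products `‖·‖_{[s,t)} ‖·‖_{[s,t]}` of a variation over a half-open
interval and a variation of a right-continuous function. The first factor vanishes on short intervals
to the left of a point, the second one on short intervals to its right (`isSmallControl_mul`). So there
are finite sequences of times with small control between consecutive members (`exists_timeSeq`), and
a partition of small mesh size may be cut at these times at the price of small defects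
(`exists_condNorm_seqSum_sub_le`). This yields convergence as the mesh size vanishes, all estimates,
and in the maximal form also uniform convergence of stopped Riemann sums, hence càdlàg versions
(`IsSewableOn.exists_cadlag_version`). The jumps follow from the size estimate on `[s,t]` as `s ↗ t`,
as its right-hand side involves the variations over `[s,t)` and so tends to zero.
-/

namespace RoughStoch

/-! ### Martingale inequalities in `L^q` -/

section Convexity

variable {H : Type*} [NormedAddCommGroup H] [InnerProductSpace ℝ H]

/-- The graph of `n ↦ n ^ κ` lies above its tangent at `m`. -/
lemma rpow_tangent_le {κ m n : ℝ} (hκ : 1 ≤ κ) (hm : 0 ≤ m) (hn : 0 ≤ n) :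
    m ^ κ + κ * m ^ (κ - 1) * (n - m) ≤ n ^ κ := by
  rcases hm.eq_or_lt with rfl | hm
  · rw [Real.zero_rpow (by linarith)]
    rcases hκ.eq_or_lt with rfl | hκ
    · simp
    · rw [Real.zero_rpow (by linarith)]
      simpa using Real.rpow_nonneg hn κ
  · have h := one_add_mul_self_le_rpow_one_add (s := n / m - 1)
      (by have := div_nonneg hn hm.le; linarith) hκ
    have h1 : n ^ κ = m ^ κ * (1 + (n / m - 1)) ^ κ := by
      rw [add_sub_cancel, Real.div_rpow hn hm.le]
      field_simp
    have h2 : m ^ κ = m ^ (κ - 1) * m := by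
      rw [← Real.rpow_add_one hm.ne']; simp
    have h3 : 0 < m ^ κ := Real.rpow_pos_of_pos hm κ
    calc m ^ κ + κ * m ^ (κ - 1) * (n - m) = m ^ κ * (1 + κ * (n / m - 1)) := by
          rw [h2]; field_simp
      _ ≤ _ := by rw [h1]; exact mul_le_mul_of_nonneg_left h h3.le

lemma rpow_sub_two_mul_self {q a : ℝ} (hq : 2 ≤ q) (ha : 0 ≤ a) :
    a ^ (q - 2) * a = a ^ (q - 1) := by
  rw [← Real.rpow_add_one' ha (by linarith)]; congr 1; ring

lemma norm_rpow_tangent_le {q : ℝ} (hq : 2 ≤ q) (x u : H) :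
    ‖u‖ ^ q + q * ‖u‖ ^ (q - 2) * inner ℝ u (x - u) ≤ ‖x‖ ^ q := by
  have h1 : inner ℝ u (x - u) ≤ ‖u‖ * (‖x‖ - ‖u‖) := by
    rw [inner_sub_right, real_inner_self_eq_norm_mul_norm]
    have := real_inner_le_norm u x
    nlinarith
  have h2 := rpow_tangent_le (κ := q) (by linarith) (norm_nonneg u) (norm_nonneg x)
  have h3 : 0 ≤ q * ‖u‖ ^ (q - 2) := by positivity
  have h4 := mul_le_mul_of_nonneg_left h1 h3
  have h5 : q * ‖u‖ ^ (q - 2) * (‖u‖ * (‖x‖ - ‖u‖)) = q * ‖u‖ ^ (q - 1) * (‖x‖ - ‖u‖) := by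
    rw [← rpow_sub_two_mul_self hq (norm_nonneg u)]; ring
  linarith

lemma abs_rpow_sub_rpow_mul_le {s a b M : ℝ} (hs : 0 ≤ s) (ha : 0 ≤ a) (hb : 0 ≤ b)
    (haM : a ≤ M) (hbM : b ≤ M) :
    |a ^ s - b ^ s| * b ≤ (s + 1) * M ^ s * |a - b| := by
  have key : ∀ c d : ℝ, 0 ≤ d → d ≤ c → c ≤ M →
      c ^ (s + 1) - d ^ (s + 1) ≤ (s + 1) * M ^ s * (c - d) := by
    intro c d hd hdc hcM
    have h := rpow_tangent_le (κ := s + 1) (by linarith) (hd.trans hdc) hd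
    rw [add_sub_cancel_right] at h
    have h1 : c ^ s ≤ M ^ s := Real.rpow_le_rpow (hd.trans hdc) hcM hs
    have h2 := mul_le_mul_of_nonneg_right (mul_le_mul_of_nonneg_left h1 (by linarith : 0 ≤ s + 1))
      (sub_nonneg.2 hdc)
    linarith
  have e : ∀ c : ℝ, 0 ≤ c → c ^ (s + 1) = c ^ s * c := fun c hc =>
    Real.rpow_add_one' hc (by linarith)
  rcases le_total b a with hab | hab
  · have h1 : b ^ s ≤ a ^ s := Real.rpow_le_rpow hb hab hs
    rw [abs_of_nonneg (sub_nonneg.2 h1), abs_of_nonneg (sub_nonneg.2 hab)]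
    refine le_trans ?_ (key a b hb hab haM)
    rw [e a ha, e b hb]
    have := mul_le_mul_of_nonneg_left hab (Real.rpow_nonneg ha s)
    linarith
  · have h1 : a ^ s ≤ b ^ s := Real.rpow_le_rpow ha hab hs
    rw [abs_of_nonpos (sub_nonpos.2 h1), abs_of_nonpos (sub_nonpos.2 hab), neg_sub, neg_sub]
    refine le_trans ?_ (key b a ha hab hbM)
    rw [e a ha, e b hb]
    have := mul_le_mul_of_nonneg_left hab (Real.rpow_nonneg ha s)
    linarith

lemma norm_rpow_smul_sub_le {s M : ℝ} (hs : 0 ≤ s) {u v : H} (hu : ‖u‖ ≤ M) (hv : ‖v‖ ≤ M) :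
    ‖‖u‖ ^ s • u - ‖v‖ ^ s • v‖ ≤ (s + 2) * M ^ s * ‖u - v‖ := by
  have h1 : ‖u‖ ^ s • u - ‖v‖ ^ s • v = ‖u‖ ^ s • (u - v) + (‖u‖ ^ s - ‖v‖ ^ s) • v := by
    rw [smul_sub, sub_smul]; abel
  have h2 : ‖u‖ ^ s ≤ M ^ s := Real.rpow_le_rpow (norm_nonneg _) hu hs
  have h3 := abs_rpow_sub_rpow_mul_le hs (norm_nonneg u) (norm_nonneg v) hu hv
  have h4 : |‖u‖ - ‖v‖| ≤ ‖u - v‖ := abs_norm_sub_norm_le u v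
  have hM : 0 ≤ M := (norm_nonneg _).trans hu
  rw [h1]
  refine (norm_add_le _ _).trans ?_
  rw [norm_smul, norm_smul, Real.norm_eq_abs, Real.norm_eq_abs,
    abs_of_nonneg (Real.rpow_nonneg (norm_nonneg u) s)]
  have h5 := mul_le_mul_of_nonneg_right h2 (norm_nonneg (u - v))
  have h6 := mul_le_mul_of_nonneg_left h4 (by positivity : 0 ≤ (s + 1) * M ^ s)
  linarith

/-- A second-order Taylor bound for `‖·‖ ^ q`: the increment of a convex function is at most the
derivative at the end point, whose distance to the derivative at `x` is controlled. -/
lemma norm_add_rpow_le {q : ℝ} (hq : 2 ≤ q) (x y : H) :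
    ‖x + y‖ ^ q ≤ ‖x‖ ^ q + q * inner ℝ (‖x‖ ^ (q - 2) • x) y
      + q ^ 2 * ((‖x‖ + ‖y‖) ^ (q - 2) * ‖y‖ ^ 2) := by
  have h1 := norm_rpow_tangent_le hq x (x + y)
  have h2 := norm_rpow_smul_sub_le (s := q - 2) (by linarith) (norm_add_le x y)
    (le_add_of_nonneg_right (norm_nonneg y) : ‖x‖ ≤ ‖x‖ + ‖y‖)
  rw [add_sub_cancel_left, sub_add_cancel] at h2
  have h3 := real_inner_le_norm (‖x + y‖ ^ (q - 2) • (x + y) - ‖x‖ ^ (q - 2) • x) y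
  have h4 := mul_le_mul_of_nonneg_right h2 (norm_nonneg y)
  rw [sub_add_cancel_left, inner_neg_right] at h1
  rw [inner_sub_left, inner_smul_left] at h3
  simp only [conj_trivial] at h3
  have h5 : 0 ≤ q := by linarith
  nlinarith [mul_le_mul_of_nonneg_left (h3.trans h4) h5]

end Convexity

section TwoSmooth

variable {Ω : Type*} {m mΩ : MeasurableSpace Ω} {μ : Measure Ω}
  {H : Type*} [NormedAddCommGroup H] [InnerProductSpace ℝ H] [CompleteSpace H]

/-- The constant in the two-smoothness inequality in `L^q`. -/
noncomputable def smoothConst (q : ℝ) : ℝ := q ^ 2 * 2 ^ (q / 2)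

lemma smoothConst_one_le {q : ℝ} (hq : 2 ≤ q) : 1 ≤ smoothConst q := by
  unfold smoothConst
  have : (1 : ℝ) ≤ 2 ^ (q / 2) := Real.one_le_rpow (by norm_num) (by linarith)
  nlinarith

lemma rpow_add_le_of_smoothConst {q a b : ℝ} (hq : 2 ≤ q) (ha : 0 ≤ a) (hb : 0 ≤ b) :
    a ^ q + q ^ 2 * ((a + b) ^ (q - 2) * b ^ 2) ≤ (a ^ 2 + smoothConst q * b ^ 2) ^ (q / 2) := by
  set κ := smoothConst q with hκ
  have hκ1 : 1 ≤ κ := smoothConst_one_le hq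
  set w := a ^ 2 + κ * b ^ 2 with hw
  have hw0 : 0 ≤ w := by positivity
  have hs : 0 ≤ q / 2 - 1 := by linarith
  have e1 : w ^ (q / 2) = w ^ (q / 2 - 1) * w := by
    rw [← Real.rpow_add_one' hw0 (by linarith)]; congr 1; ring
  have e2 : a ^ q = (a ^ 2) ^ (q / 2 - 1) * a ^ 2 := by
    rw [← Real.rpow_add_one' (by positivity) (by linarith), ← Real.rpow_natCast a 2,
      ← Real.rpow_mul ha]
    congr 1; push_cast; ring
  have h1 : (a ^ 2) ^ (q / 2 - 1) ≤ w ^ (q / 2 - 1) :=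
    Real.rpow_le_rpow (by positivity) (by nlinarith [sq_nonneg b]) hs
  have h2 : (a + b) ^ (q - 2) ≤ 2 ^ (q / 2) * w ^ (q / 2 - 1) := by
    have e3 : (a + b) ^ (q - 2) = ((a + b) ^ 2) ^ (q / 2 - 1) := by
      rw [← Real.rpow_natCast (a + b) 2, ← Real.rpow_mul (by positivity)]
      congr 1; push_cast; ring
    rw [e3]
    calc ((a + b) ^ 2) ^ (q / 2 - 1) ≤ (2 * w) ^ (q / 2 - 1) :=
          Real.rpow_le_rpow (by positivity) (by nlinarith [sq_nonneg (a - b), sq_nonneg b]) hs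
      _ = 2 ^ (q / 2 - 1) * w ^ (q / 2 - 1) := Real.mul_rpow (by norm_num) hw0
      _ ≤ 2 ^ (q / 2) * w ^ (q / 2 - 1) := by
          gcongr
          · norm_num
          · linarith
  rw [e1, e2]
  have h3 := mul_le_mul_of_nonneg_right h1 (sq_nonneg a)
  have h4 : q ^ 2 * ((a + b) ^ (q - 2) * b ^ 2) ≤ w ^ (q / 2 - 1) * (κ * b ^ 2) := by
    calc q ^ 2 * ((a + b) ^ (q - 2) * b ^ 2)
        ≤ q ^ 2 * (2 ^ (q / 2) * w ^ (q / 2 - 1) * b ^ 2) := by gcongr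
      _ = _ := by rw [hκ, smoothConst]; ring
  calc _ ≤ w ^ (q / 2 - 1) * a ^ 2 + w ^ (q / 2 - 1) * (κ * b ^ 2) := add_le_add h3 h4
    _ = _ := by rw [hw]; ring

lemma eLpNorm_rpow_eq_integral {F : Type*} [NormedAddCommGroup F] {q : ℝ} (hq : 0 < q) {f : Ω → F}
    (hf : MemLp f (ENNReal.ofReal q) μ) :
    ∫ ω, ‖f ω‖ ^ q ∂μ = (eLpNorm f (ENNReal.ofReal q) μ).toReal ^ q := by
  have h := hf.eLpNorm_eq_integral_rpow_norm (by simpa using hq) (by simp)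
  rw [ENNReal.toReal_ofReal hq.le] at h
  rw [h, ENNReal.toReal_ofReal (by positivity), ← Real.rpow_mul (by positivity),
    inv_mul_cancel₀ hq.ne', Real.rpow_one]

/-- Hölder's inequality for the second-order term. -/
lemma lintegral_rpow_sub_two_mul_sq_le {q : ℝ} (hq : 2 ≤ q) {f g : Ω → ℝ≥0∞}
    (hf : AEMeasurable f μ) (hg : AEMeasurable g μ) :
    ∫⁻ ω, f ω ^ (q - 2) * g ω ^ 2 ∂μ ≤
      eLpNorm f (ENNReal.ofReal q) μ ^ (q - 2) * eLpNorm g (ENNReal.ofReal q) μ ^ 2 := by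
  have hq0 : 0 < q := by linarith
  have h := ENNReal.lintegral_mul_norm_pow_le (μ := μ) (hf.pow_const q) (hg.pow_const q)
    (p := (q - 2) / q) (q := 2 / q) (div_nonneg (by linarith) hq0.le) (by positivity)
    (by field_simp; ring)
  rw [eLpNorm_eq_lintegral_rpow_enorm_toReal (by simpa using hq0) (by simp),
    eLpNorm_eq_lintegral_rpow_enorm_toReal (by simpa using hq0) (by simp),
    ENNReal.toReal_ofReal hq0.le, ← ENNReal.rpow_mul, ← ENNReal.rpow_natCast, ← ENNReal.rpow_mul]
  simp only [enorm_eq_self]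
  convert h using 3 with ω
  · rw [← ENNReal.rpow_mul, ← ENNReal.rpow_mul, ← ENNReal.rpow_natCast]
    congr 2
    · field_simp
    · push_cast; field_simp
  · ring
  · push_cast; ring

/-- `L^q` is two-smooth: adding a random variable `g` with `E[g | m] = 0` to an `m`-measurable `f`
increases the squared `L^q` norm by at most a multiple of the squared `L^q` norm of `g`. -/
theorem eLpNorm_add_sq_le [IsFiniteMeasure μ] (hm : m ≤ mΩ) {q : ℝ} (hq : 2 ≤ q) {f g : Ω → H}
    (hf : StronglyMeasurable[m] f) (hfq : MemLp f (ENNReal.ofReal q) μ)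
    (hgq : MemLp g (ENNReal.ofReal q) μ) (hg0 : μ[g | m] =ᵐ[μ] 0) :
    eLpNorm (f + g) (ENNReal.ofReal q) μ ^ 2 ≤
      eLpNorm f (ENNReal.ofReal q) μ ^ 2
        + ENNReal.ofReal (smoothConst q) * eLpNorm g (ENNReal.ofReal q) μ ^ 2 := by
  have hq0 : 0 < q := by linarith
  have hq1 : (1 : ℝ≥0∞) ≤ ENNReal.ofReal q := by
    rw [← ENNReal.ofReal_one]; exact ENNReal.ofReal_le_ofReal (by linarith)
  have hgint : Integrable g μ := hgq.integrable hq1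
  have hsum : MemLp (fun ω => ‖f ω‖ + ‖g ω‖) (ENNReal.ofReal q) μ := hfq.norm.add hgq.norm
  have hSint : Integrable (fun ω => (‖f ω‖ + ‖g ω‖) ^ q) μ := by
    have := hsum.integrable_norm_rpow (by simpa using hq0) (by simp)
    rw [ENNReal.toReal_ofReal hq0.le] at this
    refine this.congr (Eventually.of_forall fun ω => ?_)
    simp only [Real.norm_eq_abs]
    rw [abs_of_nonneg (by positivity)]
  have hfint : Integrable (fun ω => ‖f ω‖ ^ q) μ := by
    have := hfq.integrable_norm_rpow (by simpa using hq0) (by simp)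
    rwa [ENNReal.toReal_ofReal hq0.le] at this
  have hfgint : Integrable (fun ω => ‖f ω + g ω‖ ^ q) μ := by
    have := (hfq.add hgq).integrable_norm_rpow (by simpa using hq0) (by simp)
    rwa [ENNReal.toReal_ofReal hq0.le] at this
  have hmeasf := hfq.1
  have hmeasg := hgq.1
  -- all terms of the Taylor bound are dominated by `(‖f‖ + ‖g‖) ^ q`, hence integrable
  have hcomp : ∀ x y : ℝ, 0 ≤ x → 0 ≤ y → (x + y) ^ (q - 2) * y ^ 2 ≤ (x + y) ^ q ∧
      x ^ (q - 2) * x * y ≤ (x + y) ^ q := by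
    intro x y hx hy
    have e : (x + y) ^ q = (x + y) ^ (q - 2) * (x + y) ^ 2 := by
      rw [pow_two, ← mul_assoc, rpow_sub_two_mul_self hq (by positivity),
        ← Real.rpow_add_one' (by positivity) (by linarith)]
      congr 1; ring
    have h0 : x ^ (q - 2) ≤ (x + y) ^ (q - 2) := Real.rpow_le_rpow hx (by linarith) (by linarith)
    have h1 : 0 ≤ x ^ (q - 2) := Real.rpow_nonneg hx _
    rw [e]
    constructor
    · exact mul_le_mul_of_nonneg_left (by nlinarith) (h1.trans h0)
    · rw [mul_assoc]
      exact mul_le_mul h0 (by nlinarith) (by positivity) (h1.trans h0)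
  have hWint : Integrable (fun ω => (‖f ω‖ + ‖g ω‖) ^ (q - 2) * ‖g ω‖ ^ 2) μ := by
    refine hSint.mono' ?_ (Eventually.of_forall fun ω => ?_)
    · exact (((hmeasf.norm.add hmeasg.norm).aemeasurable.pow_const (q - 2)).mul
        (hmeasg.norm.aemeasurable.pow_const 2)).aestronglyMeasurable
    · rw [Real.norm_of_nonneg (by positivity)]
      exact (hcomp _ _ (norm_nonneg _) (norm_nonneg _)).1
  have hf' : StronglyMeasurable[m] fun ω => ‖f ω‖ ^ (q - 2) • f ω := by
    refine StronglyMeasurable.smul ?_ hf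
    exact (hf.norm.measurable.pow_const (q - 2)).stronglyMeasurable
  have hCint : Integrable (fun ω => innerSL ℝ (‖f ω‖ ^ (q - 2) • f ω) (g ω)) μ := by
    refine hSint.mono' ?_ (Eventually.of_forall fun ω => ?_)
    · exact (hf'.mono hm).aestronglyMeasurable.inner hmeasg
    · refine le_trans ?_ (hcomp _ _ (norm_nonneg (f ω)) (norm_nonneg (g ω))).2
      rw [innerSL_apply_apply]
      refine (norm_inner_le_norm _ _).trans (le_of_eq ?_)
      rw [norm_smul, Real.norm_of_nonneg (by positivity)]
  -- the first-order term is centred, as `g` is and `f` is `m`-measurable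
  have hC0 : ∫ ω, innerSL ℝ (‖f ω‖ ^ (q - 2) • f ω) (g ω) ∂μ = 0 := by
    rw [← integral_condExp hm]
    have h := condExp_bilin_of_stronglyMeasurable_left (innerSL ℝ) hf' hCint hgint
    rw [integral_congr_ae h]
    rw [integral_congr_ae (g := fun _ => (0 : ℝ)), integral_zero]
    filter_upwards [hg0] with ω hω
    rw [hω]; simp
  set a := (eLpNorm f (ENNReal.ofReal q) μ).toReal with ha
  set b := (eLpNorm g (ENNReal.ofReal q) μ).toReal with hb
  have ha0 : 0 ≤ a := ENNReal.toReal_nonneg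
  have hb0 : 0 ≤ b := ENNReal.toReal_nonneg
  -- Hölder's inequality for the second-order term
  have hW : ∫ ω, (‖f ω‖ + ‖g ω‖) ^ (q - 2) * ‖g ω‖ ^ 2 ∂μ ≤ (a + b) ^ (q - 2) * b ^ 2 := by
    have h := lintegral_rpow_sub_two_mul_sq_le (μ := μ) hq
      (f := fun ω => ‖f ω‖ₑ + ‖g ω‖ₑ) (g := fun ω => ‖g ω‖ₑ)
      (hmeasf.enorm.add hmeasg.enorm) hmeasg.enorm
    rw [integral_eq_lintegral_of_nonneg_ae (Eventually.of_forall fun ω => by positivity) hWint.1]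
    refine ENNReal.toReal_le_of_le_ofReal (by positivity) ?_
    calc _ = ∫⁻ ω, (‖f ω‖ₑ + ‖g ω‖ₑ) ^ (q - 2) * ‖g ω‖ₑ ^ 2 ∂μ := by
          refine lintegral_congr fun ω => ?_
          rw [ENNReal.ofReal_mul (by positivity), ← ENNReal.ofReal_rpow_of_nonneg (by positivity)
            (by linarith), ENNReal.ofReal_add (norm_nonneg _) (norm_nonneg _), ofReal_norm,
            ofReal_norm, ENNReal.ofReal_pow (norm_nonneg _), ofReal_norm]
      _ ≤ _ := h
      _ ≤ (ENNReal.ofReal (a + b)) ^ (q - 2) * (ENNReal.ofReal b) ^ 2 := by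
          rw [ENNReal.ofReal_add ha0 hb0, ha, hb, ENNReal.ofReal_toReal hfq.2.ne,
            ENNReal.ofReal_toReal hgq.2.ne, eLpNorm_enorm]
          gcongr
          have := eLpNorm_add_le (μ := μ) (p := ENNReal.ofReal q) (f := fun ω => ‖f ω‖ₑ)
            (g := fun ω => ‖g ω‖ₑ) hmeasf.enorm.aestronglyMeasurable
            hmeasg.enorm.aestronglyMeasurable hq1
          simp only [eLpNorm_enorm] at this
          exact this
      _ = _ := by
          rw [ENNReal.ofReal_mul (by positivity), ENNReal.ofReal_rpow_of_nonneg (by positivity)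
            (by linarith), ENNReal.ofReal_pow hb0]
  have hfC : Integrable (fun ω => ‖f ω‖ ^ q + q * innerSL ℝ (‖f ω‖ ^ (q - 2) • f ω) (g ω)) μ :=
    hfint.add (hCint.const_mul q)
  have hmain : (eLpNorm (f + g) (ENNReal.ofReal q) μ).toReal ^ q ≤
      (a ^ 2 + smoothConst q * b ^ 2) ^ (q / 2) := by
    rw [← eLpNorm_rpow_eq_integral hq0 (hfq.add hgq)]
    calc ∫ ω, ‖(f + g) ω‖ ^ q ∂μ
        ≤ ∫ ω, (‖f ω‖ ^ q + q * innerSL ℝ (‖f ω‖ ^ (q - 2) • f ω) (g ω)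
            + q ^ 2 * ((‖f ω‖ + ‖g ω‖) ^ (q - 2) * ‖g ω‖ ^ 2)) ∂μ :=
          integral_mono hfgint (hfC.add (hWint.const_mul _))
            fun ω => norm_add_rpow_le hq (f ω) (g ω)
      _ = a ^ q + q ^ 2 * ∫ ω, (‖f ω‖ + ‖g ω‖) ^ (q - 2) * ‖g ω‖ ^ 2 ∂μ := by
          rw [integral_add hfC (hWint.const_mul _),
            integral_add hfint (hCint.const_mul q), integral_const_mul, integral_const_mul, hC0,
            eLpNorm_rpow_eq_integral hq0 hfq, mul_zero, add_zero]
      _ ≤ a ^ q + q ^ 2 * ((a + b) ^ (q - 2) * b ^ 2) := by gcongr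
      _ ≤ _ := rpow_add_le_of_smoothConst hq ha0 hb0
  have hκ1 := smoothConst_one_le hq
  have hfin : (eLpNorm (f + g) (ENNReal.ofReal q) μ).toReal ^ 2 ≤ a ^ 2 + smoothConst q * b ^ 2 := by
    set c := (eLpNorm (f + g) (ENNReal.ofReal q) μ).toReal with hc
    have hc0 : 0 ≤ c := ENNReal.toReal_nonneg
    have e : c ^ q = (c ^ 2) ^ (q / 2) := by
      rw [← Real.rpow_natCast c 2, ← Real.rpow_mul hc0]; congr 1; push_cast; ring
    rw [e] at hmain
    exact (Real.rpow_le_rpow_iff (by positivity) (by positivity) (by positivity)).1 hmain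
  rw [← ENNReal.ofReal_toReal (hfq.add hgq).2.ne, ← ENNReal.ofReal_toReal hfq.2.ne,
    ← ENNReal.ofReal_toReal hgq.2.ne, ← ENNReal.ofReal_pow ENNReal.toReal_nonneg,
    ← ENNReal.ofReal_pow ENNReal.toReal_nonneg, ← ENNReal.ofReal_pow ENNReal.toReal_nonneg,
    ← ENNReal.ofReal_mul (by linarith), ← ENNReal.ofReal_add (by positivity) (by positivity)]
  exact ENNReal.ofReal_le_ofReal hfin

end TwoSmooth

section Doob

variable {Ω : Type*} {mΩ : MeasurableSpace Ω} {μ : Measure Ω}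
  {G : Filtration ℕ mΩ} {q : ℝ}

lemma one_le_ofReal {q : ℝ} (hq : 2 ≤ q) : (1 : ℝ≥0∞) ≤ ENNReal.ofReal q := by
  rw [← ENNReal.ofReal_one]; exact ENNReal.ofReal_le_ofReal (by linarith)

lemma eLpNorm_sum_martingale_sq_le [IsFiniteMeasure μ] {H : Type*} [NormedAddCommGroup H] [InnerProductSpace ℝ H]
    [CompleteSpace H] (hq : 2 ≤ q) {M : ℕ → Ω → H} (hM : ∀ j, StronglyMeasurable[G (j + 1)] (M j))
    (hMq : ∀ j, MemLp (M j) (ENNReal.ofReal q) μ) (hM0 : ∀ j, μ[M j | G j] =ᵐ[μ] 0) (n : ℕ) :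
    eLpNorm (∑ j ∈ Finset.range n, M j) (ENNReal.ofReal q) μ ^ 2 ≤
      ENNReal.ofReal (smoothConst q) *
        ∑ j ∈ Finset.range n, eLpNorm (M j) (ENNReal.ofReal q) μ ^ 2 := by
  induction n with
  | zero => simp
  | succ n ih =>
    rw [Finset.sum_range_succ, Finset.sum_range_succ, mul_add]
    refine (eLpNorm_add_sq_le (G.le n) hq ?_ ?_ (hMq n) (hM0 n)).trans (by gcongr)
    · refine Finset.stronglyMeasurable_sum _ fun j hj => ?_
      exact (hM j).mono (G.mono (by simpa using hj))
    · exact memLp_finsetSum' _ fun j _ => hMq j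

/-- The increments of the `q`-th power of a running maximum `max n x` in terms of those of the
`(q - 1)`-th power: when the maximum increases, it is equal to `x`. -/
lemma max_rpow_sub_le {q n x : ℝ} (hq : 2 ≤ q) (hn : 0 ≤ n) (hx : 0 ≤ x) :
    (max n x) ^ q - n ^ q ≤ 2 * (((max n x) ^ (q - 1) - n ^ (q - 1)) * x) := by
  rcases le_total x n with h | h
  · rw [max_eq_left h]; simp
  · rw [max_eq_right h]
    have h1 := rpow_tangent_le (κ := q) (by linarith) hn hx
    have h2 : n ^ (q - 1) ≤ x ^ (q - 1) := Real.rpow_le_rpow hn h (by linarith)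
    have e : ∀ c : ℝ, 0 ≤ c → c ^ q = c ^ (q - 1) * c := fun c hc => by
      rw [← Real.rpow_add_one' hc (by linarith)]; congr 1; ring
    rw [e n hn, e x hx] at *
    have h3 : 0 ≤ (x ^ (q - 1) - n ^ (q - 1)) * x := mul_nonneg (sub_nonneg.2 h2) hx
    nlinarith [mul_nonneg (by linarith : (0 : ℝ) ≤ q - 2) h3]

lemma measurable_partialSups {x : ℕ → Ω → ℝ} (hx : ∀ j, StronglyMeasurable[G j] (x j)) (j : ℕ) :
    StronglyMeasurable[G j] (partialSups x j) := by
  induction j with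
  | zero => simpa using hx 0
  | succ j ih =>
    rw [partialSups_add_one]
    exact @StronglyMeasurable.sup _ _ _ _ (G (j + 1)) _ _ _ (ih.mono (G.mono j.le_succ)) (hx (j + 1))

lemma memLp_partialSups {p : ℝ≥0∞} {x : ℕ → Ω → ℝ} (hx : ∀ j, MemLp (x j) p μ) (j : ℕ) :
    MemLp (partialSups x j) p μ := by
  induction j with
  | zero => simpa using hx 0
  | succ j ih =>
    rw [partialSups_add_one]
    exact ih.sup (hx (j + 1))

lemma integrable_rpow_sub_one_mul (hq : 2 ≤ q) {f g : Ω → ℝ} (hf0 : 0 ≤ f) (hg0 : 0 ≤ g)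
    (hf : MemLp f (ENNReal.ofReal q) μ) (hg : MemLp g (ENNReal.ofReal q) μ) :
    Integrable (fun ω => f ω ^ (q - 1) * g ω) μ := by
  have h := (hf.add hg).integrable_norm_rpow (by simp; linarith) (by simp)
  rw [ENNReal.toReal_ofReal (by linarith)] at h
  refine h.mono' ?_ (Eventually.of_forall fun ω => ?_)
  · exact ((hf.1.aemeasurable.pow_const (q - 1)).mul hg.1.aemeasurable).aestronglyMeasurable
  · have h1 := hf0 ω
    have h2 := hg0 ω
    simp only [Pi.zero_apply] at h1 h2
    rw [Real.norm_of_nonneg (by positivity), Pi.add_apply, Real.norm_of_nonneg (by positivity)]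
    have e : (f ω + g ω) ^ q = (f ω + g ω) ^ (q - 1) * (f ω + g ω) := by
      rw [← Real.rpow_add_one' (by positivity) (by linarith)]; congr 1; ring
    rw [e]
    gcongr
    · linarith
    · linarith
    · linarith

lemma lintegral_rpow_sub_one_mul_le (hq : 2 ≤ q) {f g : Ω → ℝ≥0∞}
    (hf : AEMeasurable f μ) (hg : AEMeasurable g μ) :
    ∫⁻ ω, f ω ^ (q - 1) * g ω ∂μ ≤
      eLpNorm f (ENNReal.ofReal q) μ ^ (q - 1) * eLpNorm g (ENNReal.ofReal q) μ := by
  have hq0 : 0 < q := by linarith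
  have h := ENNReal.lintegral_mul_norm_pow_le (μ := μ) (hf.pow_const q) (hg.pow_const q)
    (p := (q - 1) / q) (q := 1 / q) (div_nonneg (by linarith) hq0.le) (by positivity)
    (by field_simp; ring)
  rw [eLpNorm_eq_lintegral_rpow_enorm_toReal (by simpa using hq0) (by simp),
    eLpNorm_eq_lintegral_rpow_enorm_toReal (by simpa using hq0) (by simp),
    ENNReal.toReal_ofReal hq0.le, ← ENNReal.rpow_mul]
  simp only [enorm_eq_self]
  convert h using 3 with ω
  · rw [← ENNReal.rpow_mul, ← ENNReal.rpow_mul]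
    have e1 : q * ((q - 1) / q) = q - 1 := by field_simp
    have e2 : q * (1 / q) = 1 := by field_simp
    rw [e1, e2, ENNReal.rpow_one]
  · ring

variable [IsFiniteMeasure μ]

/-- Doob's maximal inequality in `L^q`, in integrated form, for a nonnegative submartingale. -/
lemma integral_partialSups_rpow_le (hq : 2 ≤ q) {x : ℕ → Ω → ℝ} (hx0 : ∀ j, 0 ≤ x j)
    (hx : ∀ j, StronglyMeasurable[G j] (x j)) (hxq : ∀ j, MemLp (x j) (ENNReal.ofReal q) μ) {n : ℕ}
    (hsub : ∀ j ≤ n, x j ≤ᵐ[μ] μ[x n | G j]) {j : ℕ} (hj : j ≤ n) :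
    ∫ ω, partialSups x j ω ^ q ∂μ ≤ 2 * ∫ ω, partialSups x j ω ^ (q - 1) * x n ω ∂μ := by
  have hs0 : ∀ j, 0 ≤ partialSups x j := fun j => (hx0 0).trans (le_partialSups_of_le x (Nat.zero_le j))
  have hsq : ∀ j, MemLp (partialSups x j) (ENNReal.ofReal q) μ := memLp_partialSups hxq
  have hint : ∀ j, Integrable (fun ω => partialSups x j ω ^ q) μ := fun j => by
    have := (hsq j).integrable_norm_rpow (by simp; linarith) (by simp)
    rw [ENNReal.toReal_ofReal (by linarith)] at this
    refine this.congr (Eventually.of_forall fun ω => ?_)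
    simp only []
    rw [Real.norm_of_nonneg (hs0 j ω)]
  have hint' : ∀ i j, Integrable (fun ω => partialSups x i ω ^ (q - 1) * x j ω) μ := fun i j =>
    integrable_rpow_sub_one_mul hq (hs0 i) (hx0 j) (hsq i) (hxq j)
  -- testing the submartingale property against nonnegative adapted weights
  have htest : ∀ j ≤ n, ∀ φ : Ω → ℝ, 0 ≤ φ → StronglyMeasurable[G j] φ →
      Integrable (fun ω => φ ω * x j ω) μ → Integrable (fun ω => φ ω * x n ω) μ →
      ∫ ω, φ ω * x j ω ∂μ ≤ ∫ ω, φ ω * x n ω ∂μ := by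
    intro j hj φ hφ0 hφ h1 h2
    have h3 := condExp_mul_of_stronglyMeasurable_left hφ h2 ((hxq n).integrable (one_le_ofReal hq))
    rw [← integral_condExp (G.le j) (f := fun ω => φ ω * x n ω)]
    refine integral_mono_ae h1 integrable_condExp ?_
    filter_upwards [h3, hsub j hj] with ω hω hω'
    rw [show μ[fun ω => φ ω * x n ω | G j] ω = φ ω * μ[x n | G j] ω from hω]
    exact mul_le_mul_of_nonneg_left hω' (hφ0 ω)
  have hpm : ∀ j, StronglyMeasurable[G j] fun ω => partialSups x j ω ^ (q - 1) := fun j =>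
    ((measurable_partialSups hx j).measurable.pow_const _).stronglyMeasurable
  have hp0 : ∀ j ω, 0 ≤ partialSups x j ω ^ (q - 1) := fun j ω => Real.rpow_nonneg (hs0 j ω) _
  induction j with
  | zero =>
    have h := htest 0 hj _ (hp0 0) (hpm 0) (hint' 0 0) (hint' 0 n)
    have e : ∫ ω, partialSups x 0 ω ^ q ∂μ = ∫ ω, partialSups x 0 ω ^ (q - 1) * x 0 ω ∂μ := by
      refine integral_congr_ae (Eventually.of_forall fun ω => ?_)
      simp only [partialSups_zero]
      rw [← Real.rpow_add_one' (hx0 0 ω) (by linarith)]; congr 1; ring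
    have h0 : 0 ≤ ∫ ω, partialSups x 0 ω ^ (q - 1) * x n ω ∂μ :=
      integral_nonneg fun ω => mul_nonneg (hp0 0 ω) (hx0 n ω)
    rw [e]; linarith
  | succ j ih =>
    have ih := ih (by omega)
    have hsucc : ∀ ω, partialSups x (j + 1) ω = max (partialSups x j ω) (x (j + 1) ω) := fun ω => by
      rw [partialSups_add_one]; rfl
    have hmono : ∀ ω, 0 ≤ partialSups x (j + 1) ω ^ (q - 1) - partialSups x j ω ^ (q - 1) :=
      fun ω => sub_nonneg.2 (Real.rpow_le_rpow (hs0 j ω)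
        (by rw [hsucc]; exact le_max_left _ _) (by linarith))
    have hi1 : ∀ k, Integrable (fun ω => (partialSups x (j + 1) ω ^ (q - 1)
        - partialSups x j ω ^ (q - 1)) * x k ω) μ := fun k => by
      simp_rw [sub_mul]; exact (hint' (j + 1) k).sub (hint' j k)
    have h := htest (j + 1) hj _ hmono ((hpm (j + 1)).sub ((hpm j).mono (G.mono j.le_succ)))
      (hi1 _) (hi1 _)
    have h1 : ∫ ω, partialSups x (j + 1) ω ^ q ∂μ ≤ ∫ ω, (partialSups x j ω ^ q + 2 *
        ((partialSups x (j + 1) ω ^ (q - 1) - partialSups x j ω ^ (q - 1)) * x (j + 1) ω)) ∂μ := by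
      refine integral_mono (hint _) ((hint j).add ((hi1 _).const_mul 2)) fun ω => ?_
      have := max_rpow_sub_le hq (hs0 j ω) (hx0 (j + 1) ω)
      simp only [hsucc]
      linarith
    rw [integral_add (hint j) ((hi1 _).const_mul 2), integral_const_mul] at h1
    have h2 : ∫ ω, (partialSups x (j + 1) ω ^ (q - 1) - partialSups x j ω ^ (q - 1)) * x n ω ∂μ =
        ∫ ω, partialSups x (j + 1) ω ^ (q - 1) * x n ω ∂μ
          - ∫ ω, partialSups x j ω ^ (q - 1) * x n ω ∂μ := by
      simp_rw [sub_mul]; exact integral_sub (hint' _ _) (hint' _ _)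
    linarith

/-- Doob's maximal inequality in `L^q`, `q ≥ 2`. -/
theorem eLpNorm_iSup_martingale_le {E : Type*} [NormedAddCommGroup E] [NormedSpace ℝ E]
    [CompleteSpace E] (hq : 2 ≤ q) {S : ℕ → Ω → E} (hS : ∀ j, StronglyMeasurable[G j] (S j))
    (hSq : ∀ j, MemLp (S j) (ENNReal.ofReal q) μ) {n : ℕ}
    (hmart : ∀ j ≤ n, S j =ᵐ[μ] μ[S n | G j]) :
    eLpNorm (fun ω => ⨆ j ∈ Finset.range (n + 1), ‖S j ω‖ₑ) (ENNReal.ofReal q) μ ≤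
      2 * eLpNorm (S n) (ENNReal.ofReal q) μ := by
  set x : ℕ → Ω → ℝ := fun j ω => ‖S j ω‖ with hxdef
  have hx0 : ∀ j, 0 ≤ x j := fun j ω => norm_nonneg _
  have hxq : ∀ j, MemLp (x j) (ENNReal.ofReal q) μ := fun j => (hSq j).norm
  have hsub : ∀ j ≤ n, x j ≤ᵐ[μ] μ[x n | G j] := by
    intro j hj
    filter_upwards [hmart j hj, norm_condExp_le (m := G j) (μ := μ) (S n)] with ω h1 h2
    simp only [hxdef]
    rw [h1]
    exact h2
  have key := integral_partialSups_rpow_le hq hx0 (fun j => (hS j).norm) hxq hsub le_rfl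
  have hs0 : 0 ≤ partialSups x n := (hx0 0).trans (le_partialSups_of_le x (Nat.zero_le n))
  have hsq : MemLp (partialSups x n) (ENNReal.ofReal q) μ := memLp_partialSups hxq n
  set s := partialSups x n with hs
  have e1 : ∫ ω, s ω ^ q ∂μ = (eLpNorm s (ENNReal.ofReal q) μ).toReal ^ q := by
    rw [← eLpNorm_rpow_eq_integral (by linarith) hsq]
    refine integral_congr_ae (Eventually.of_forall fun ω => ?_)
    simp only []
    rw [Real.norm_of_nonneg (hs0 ω)]
  set a := (eLpNorm s (ENNReal.ofReal q) μ).toReal with ha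
  set b := (eLpNorm (S n) (ENNReal.ofReal q) μ).toReal with hb
  have ha0 : 0 ≤ a := ENNReal.toReal_nonneg
  have hb0 : 0 ≤ b := ENNReal.toReal_nonneg
  have e2 : ∫ ω, s ω ^ (q - 1) * x n ω ∂μ ≤ a ^ (q - 1) * b := by
    rw [integral_eq_lintegral_of_nonneg_ae
      (Eventually.of_forall fun ω => mul_nonneg (Real.rpow_nonneg (hs0 ω) _) (hx0 n ω))
      (integrable_rpow_sub_one_mul hq hs0 (hx0 n) hsq (hxq n)).1]
    refine ENNReal.toReal_le_of_le_ofReal (by positivity) ?_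
    have h := lintegral_rpow_sub_one_mul_le (μ := μ) hq (f := fun ω => ‖s ω‖ₑ)
      (g := fun ω => ‖S n ω‖ₑ) hsq.1.enorm (hSq n).1.enorm
    rw [eLpNorm_enorm, eLpNorm_enorm] at h
    rw [ENNReal.ofReal_mul (by positivity), ← ENNReal.ofReal_rpow_of_nonneg ha0 (by linarith), ha,
      hb, ENNReal.ofReal_toReal hsq.2.ne, ENNReal.ofReal_toReal (hSq n).2.ne]
    refine le_trans (le_of_eq (lintegral_congr fun ω => ?_)) h
    rw [ENNReal.ofReal_mul (Real.rpow_nonneg (hs0 ω) _),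
      ← ENNReal.ofReal_rpow_of_nonneg (hs0 ω) (by linarith), Real.enorm_of_nonneg (hs0 ω)]
    simp [hxdef]
  have hab : a ≤ 2 * b := by
    rcases ha0.eq_or_lt with h | h
    · rw [← h]; positivity
    · rw [e1] at key
      have e : a ^ q = a ^ (q - 1) * a := by
        rw [← Real.rpow_add_one' ha0 (by linarith)]; congr 1; ring
      have h3 : 0 < a ^ (q - 1) := Real.rpow_pos_of_pos h _
      rw [e] at key
      have : a ^ (q - 1) * a ≤ a ^ (q - 1) * (2 * b) := by linarith
      exact le_of_mul_le_mul_left this h3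
  calc eLpNorm (fun ω => ⨆ j ∈ Finset.range (n + 1), ‖S j ω‖ₑ) (ENNReal.ofReal q) μ
      ≤ eLpNorm s (ENNReal.ofReal q) μ := by
        refine eLpNorm_mono_enorm fun ω => ?_
        rw [enorm_eq_self, Real.enorm_of_nonneg (hs0 ω)]
        refine iSup₂_le fun j hj => ?_
        rw [← ofReal_norm]
        exact ENNReal.ofReal_le_ofReal
          (le_partialSups_of_le x (by simpa [Nat.lt_succ_iff] using hj) ω)
    _ = ENNReal.ofReal a := (ENNReal.ofReal_toReal hsq.2.ne).symm
    _ ≤ ENNReal.ofReal (2 * b) := ENNReal.ofReal_le_ofReal hab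
    _ = 2 * eLpNorm (S n) (ENNReal.ofReal q) μ := by
        rw [ENNReal.ofReal_mul (by norm_num), hb, ENNReal.ofReal_toReal (hSq n).2.ne]; simp

end Doob

section Aggregation

variable {Ω : Type*} {mΩ : MeasurableSpace Ω} {μ : Measure Ω} {q : ℝ}

lemma eLpNorm_eq_lintegral_ennreal (hq : 0 < q) (f : Ω → ℝ≥0∞) :
    eLpNorm f (ENNReal.ofReal q) μ = (∫⁻ ω, f ω ^ q ∂μ) ^ (1 / q) := by
  rw [eLpNorm_eq_lintegral_rpow_enorm_toReal (by simpa using hq) (by simp),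
    ENNReal.toReal_ofReal hq.le]
  simp only [enorm_eq_self]

lemma eLpNorm_rpow_ennreal (hq : 0 < q) (f : Ω → ℝ≥0∞) :
    eLpNorm f (ENNReal.ofReal q) μ ^ q = ∫⁻ ω, f ω ^ q ∂μ := by
  rw [eLpNorm_eq_lintegral_ennreal hq, ← ENNReal.rpow_mul, one_div, inv_mul_cancel₀ hq.ne',
    ENNReal.rpow_one]

lemma sum_rpow_le_rpow_sum {ι : Type*} (s : Finset ι) (f : ι → ℝ≥0∞) {p : ℝ} (hp : 1 ≤ p) :
    ∑ i ∈ s, f i ^ p ≤ (∑ i ∈ s, f i) ^ p := by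
  classical
  induction s using Finset.induction_on with
  | empty => simp
  | insert i s hi ih =>
    rw [Finset.sum_insert hi, Finset.sum_insert hi]
    exact (by gcongr : _ ≤ f i ^ p + (∑ i ∈ s, f i) ^ p).trans
      (ENNReal.add_rpow_le_rpow_add _ _ hp)

lemma sq_rpow_half (x : ℝ≥0∞) : (x ^ 2) ^ (1 / 2 : ℝ) = x := by
  rw [← ENNReal.rpow_natCast, ← ENNReal.rpow_mul]; norm_num

lemma mul_rpow_half (c S : ℝ≥0∞) : c * S ^ (1 / 2 : ℝ) = (c ^ 2 * S) ^ (1 / 2 : ℝ) := by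
  rw [ENNReal.mul_rpow_of_nonneg _ _ (by norm_num), sq_rpow_half]

/-- The `L^q` norm of a finite supremum is bounded by the `ℓ^2` norm of the `L^q` norms. -/
lemma eLpNorm_iSup_le_sqrt_sum (hq : 2 ≤ q) {f : ℕ → Ω → ℝ≥0∞} (hf : ∀ j, AEMeasurable (f j) μ)
    (n : ℕ) :
    eLpNorm (fun ω => ⨆ j ∈ Finset.range n, f j ω) (ENNReal.ofReal q) μ ≤
      (∑ j ∈ Finset.range n, eLpNorm (f j) (ENNReal.ofReal q) μ ^ 2) ^ (1 / 2 : ℝ) := by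
  have hq0 : 0 < q := by linarith
  rw [eLpNorm_eq_lintegral_ennreal hq0, one_div, ENNReal.rpow_inv_le_iff hq0]
  calc ∫⁻ ω, (⨆ j ∈ Finset.range n, f j ω) ^ q ∂μ
      ≤ ∫⁻ ω, ∑ j ∈ Finset.range n, f j ω ^ q ∂μ := by
        refine lintegral_mono fun ω => ?_
        rw [← ENNReal.le_rpow_inv_iff hq0]
        refine iSup₂_le fun j hj => ?_
        rw [ENNReal.le_rpow_inv_iff hq0]
        exact Finset.single_le_sum (f := fun j => f j ω ^ q) (fun _ _ => zero_le) hj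
    _ = ∑ j ∈ Finset.range n, (eLpNorm (f j) (ENNReal.ofReal q) μ ^ 2) ^ (q / 2) := by
        rw [lintegral_finsetSum' _ fun j _ => (hf j).pow_const q]
        refine Finset.sum_congr rfl fun j _ => ?_
        rw [← eLpNorm_rpow_ennreal hq0, ← ENNReal.rpow_natCast, ← ENNReal.rpow_mul]
        congr 1; push_cast; ring
    _ ≤ (∑ j ∈ Finset.range n, eLpNorm (f j) (ENNReal.ofReal q) μ ^ 2) ^ (q / 2) :=
        sum_rpow_le_rpow_sum _ _ (by linarith)
    _ = _ := by rw [← ENNReal.rpow_mul]; congr 1; ring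

variable [IsFiniteMeasure μ] {G : Filtration ℕ mΩ}
  {E : Type*} [NormedAddCommGroup E] [NormedSpace ℝ E] [CompleteSpace E]
  {H : Type*} [NormedAddCommGroup H] [InnerProductSpace ℝ H] [CompleteSpace H]

/-- The constant in the inequality for sums of nearly centred increments; `K` is the distortion of
the norm from a Euclidean one. -/
noncomputable def aggConst (q : ℝ) (K : ℝ≥0) : ℝ≥0 :=
  4 * K * (Real.toNNReal (smoothConst q)) ^ (1 / 2 : ℝ)

lemma condExp_sum_martingale {M : ℕ → Ω → E} (hM : ∀ j, StronglyMeasurable[G (j + 1)] (M j))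
    (hMi : ∀ j, Integrable (M j) μ) (hM0 : ∀ j, μ[M j | G j] =ᵐ[μ] 0) {i n : ℕ} (hin : i ≤ n) :
    ∑ j ∈ Finset.range i, M j =ᵐ[μ] μ[∑ j ∈ Finset.range n, M j | G i] := by
  induction n, hin using Nat.le_induction with
  | base =>
    rw [condExp_of_stronglyMeasurable (G.le i)]
    · refine Finset.stronglyMeasurable_sum _ fun j hj => ?_
      exact (hM j).mono (G.mono (by simpa using hj))
    · exact integrable_finsetSum' _ fun j _ => hMi j
  | succ n hn ih =>
    rw [Finset.sum_range_succ]
    have h1 := condExp_add (m := G i) (integrable_finsetSum' (Finset.range n) fun j _ => hMi j)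
      (hMi n)
    have h2 := condExp_condExp_of_le (μ := μ) (f := M n) (G.mono hn) (G.le n)
    have h3 := condExp_congr_ae (m := G i) (hM0 n)
    filter_upwards [ih, h1, h2, h3] with ω a1 a2 a3 a4
    rw [a2, Pi.add_apply, ← a1, ← a3, a4, condExp_zero]
    simp

/-- The maximal inequality for sums of martingale differences with values in a space with a norm
that is equivalent to a Hilbert norm. -/
lemma eLpNorm_iSup_sum_martingale_le (hq : 2 ≤ q) {K : ℝ≥0} (e : E ≃L[ℝ] H)
    (he : ∀ x, ‖x‖ ≤ ‖e x‖ ∧ ‖e x‖ ≤ K * ‖x‖) {M : ℕ → Ω → E}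
    (hM : ∀ j, StronglyMeasurable[G (j + 1)] (M j)) (hMq : ∀ j, MemLp (M j) (ENNReal.ofReal q) μ)
    (hM0 : ∀ j, μ[M j | G j] =ᵐ[μ] 0) (n : ℕ) :
    eLpNorm (fun ω => ⨆ l ∈ Finset.range (n + 1), ‖(∑ j ∈ Finset.range l, M j) ω‖ₑ)
        (ENNReal.ofReal q) μ ≤
      2 * K * ENNReal.ofReal (smoothConst q) ^ (1 / 2 : ℝ) *
        (∑ j ∈ Finset.range n, eLpNorm (M j) (ENNReal.ofReal q) μ ^ 2) ^ (1 / 2 : ℝ) := by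
  have hMi : ∀ j, Integrable (M j) μ := fun j => (hMq j).integrable (one_le_ofReal hq)
  have hdoob := eLpNorm_iSup_martingale_le (G := G) (μ := μ) hq
    (S := fun l => ∑ j ∈ Finset.range l, M j) (n := n)
    (fun l => Finset.stronglyMeasurable_sum _ fun j hj => (hM j).mono (G.mono (by simpa using hj)))
    (fun l => memLp_finsetSum' _ fun j _ => hMq j)
    (fun l hl => condExp_sum_martingale hM hMi hM0 hl)
  have heM : ∀ j, eLpNorm (e ∘ M j) (ENNReal.ofReal q) μ ≤ K * eLpNorm (M j) (ENNReal.ofReal q) μ :=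
    fun j => eLpNorm_le_nnreal_smul_eLpNorm_of_ae_le_mul
      (Eventually.of_forall fun ω => by exact_mod_cast (he (M j ω)).2) _
  have hsum := eLpNorm_sum_martingale_sq_le (G := G) (μ := μ) hq (M := fun j => e ∘ M j)
    (fun j => e.continuous.comp_stronglyMeasurable (hM j))
    (fun j => (e : E →L[ℝ] H).comp_memLp' (hMq j)) (fun j => by
      have h := (e : E →L[ℝ] H).comp_condExp_comm (m := G j) (hMi j)
      filter_upwards [h, hM0 j] with ω h1 h2
      have h3 : μ[e ∘ M j | G j] ω = e (μ[M j | G j] ω) := h1.symm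
      rw [h3, h2]; simp) n
  have h1 : eLpNorm (∑ j ∈ Finset.range n, M j) (ENNReal.ofReal q) μ ≤
      eLpNorm (∑ j ∈ Finset.range n, e ∘ M j) (ENNReal.ofReal q) μ := by
    refine eLpNorm_mono fun ω => ?_
    have : (∑ j ∈ Finset.range n, e ∘ M j) ω = e ((∑ j ∈ Finset.range n, M j) ω) := by
      simp
    rw [this]
    exact (he _).1
  have h2 : eLpNorm (∑ j ∈ Finset.range n, e ∘ M j) (ENNReal.ofReal q) μ ≤
      ENNReal.ofReal (smoothConst q) ^ (1 / 2 : ℝ) * (K *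
        (∑ j ∈ Finset.range n, eLpNorm (M j) (ENNReal.ofReal q) μ ^ 2) ^ (1 / 2 : ℝ)) := by
    have h3 : ∑ j ∈ Finset.range n, eLpNorm (e ∘ M j) (ENNReal.ofReal q) μ ^ 2 ≤
        (K : ℝ≥0∞) ^ 2 * ∑ j ∈ Finset.range n, eLpNorm (M j) (ENNReal.ofReal q) μ ^ 2 := by
      rw [Finset.mul_sum]
      refine Finset.sum_le_sum fun j _ => ?_
      rw [← mul_pow]
      have := heM j
      gcongr
    rw [← sq_rpow_half (eLpNorm (∑ j ∈ Finset.range n, e ∘ M j) (ENNReal.ofReal q) μ),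
      mul_rpow_half, ← ENNReal.mul_rpow_of_nonneg _ _ (by norm_num)]
    refine ENNReal.rpow_le_rpow (hsum.trans ?_) (by norm_num)
    gcongr
  calc _ ≤ _ := hdoob
    _ ≤ 2 * (ENNReal.ofReal (smoothConst q) ^ (1 / 2 : ℝ) * (K *
        (∑ j ∈ Finset.range n, eLpNorm (M j) (ENNReal.ofReal q) μ ^ 2) ^ (1 / 2 : ℝ))) := by
        gcongr
        exact h1.trans h2
    _ = _ := by ring

/-- The maximal inequality for sums of increments which are not necessarily centred: split each
increment into its conditional mean and a martingale difference. -/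
theorem eLpNorm_iSup_sum_le (hq : 2 ≤ q) {K : ℝ≥0} (e : E ≃L[ℝ] H)
    (he : ∀ x, ‖x‖ ≤ ‖e x‖ ∧ ‖e x‖ ≤ K * ‖x‖) {Z : ℕ → Ω → E}
    (hZ : ∀ j, StronglyMeasurable[G (j + 1)] (Z j)) (hZq : ∀ j, MemLp (Z j) (ENNReal.ofReal q) μ)
    (n : ℕ) :
    eLpNorm (fun ω => ⨆ l ∈ Finset.range (n + 1), ‖(∑ j ∈ Finset.range l, Z j) ω‖ₑ)
        (ENNReal.ofReal q) μ ≤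
      aggConst q K *
        (∑ j ∈ Finset.range n, eLpNorm (Z j) (ENNReal.ofReal q) μ ^ 2) ^ (1 / 2 : ℝ)
      + ∑ j ∈ Finset.range n, eLpNorm (μ[Z j | G j]) (ENNReal.ofReal q) μ := by
  have hq1 := one_le_ofReal hq
  set M : ℕ → Ω → E := fun j => Z j - μ[Z j | G j] with hMdef
  have hc : ∀ j, MemLp (μ[Z j | G j]) (ENNReal.ofReal q) μ := fun j => (hZq j).condExp hq1
  have hMq : ∀ j, MemLp (M j) (ENNReal.ofReal q) μ := fun j => (hZq j).sub (hc j)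
  have hM : ∀ j, StronglyMeasurable[G (j + 1)] (M j) := fun j =>
    (hZ j).sub (stronglyMeasurable_condExp.mono (G.mono j.le_succ))
  have hM0 : ∀ j, μ[M j | G j] =ᵐ[μ] 0 := fun j => by
    have h := condExp_sub (m := G j) ((hZq j).integrable hq1) (integrable_condExp (m := G j) (f := Z j))
    rw [condExp_of_stronglyMeasurable (G.le j) stronglyMeasurable_condExp integrable_condExp,
      sub_self] at h
    exact h
  have hMle : ∀ j, eLpNorm (M j) (ENNReal.ofReal q) μ ≤ 2 * eLpNorm (Z j) (ENNReal.ofReal q) μ := by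
    intro j
    refine (eLpNorm_sub_le (hZq j).1 (hc j).1 hq1).trans ?_
    rw [two_mul]
    gcongr
    exact eLpNorm_condExp_le_eLpNorm _ hq1
  have hmart := eLpNorm_iSup_sum_martingale_le hq e he hM hMq hM0 n
  have hbd : ∀ ω, ⨆ l ∈ Finset.range (n + 1), ‖(∑ j ∈ Finset.range l, Z j) ω‖ₑ ≤
      (⨆ l ∈ Finset.range (n + 1), ‖(∑ j ∈ Finset.range l, M j) ω‖ₑ)
        + ∑ j ∈ Finset.range n, ‖μ[Z j | G j] ω‖ₑ := by
    intro ω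
    refine iSup₂_le fun l hl => ?_
    have h1 : (∑ j ∈ Finset.range l, Z j) ω =
        (∑ j ∈ Finset.range l, M j) ω + ∑ j ∈ Finset.range l, μ[Z j | G j] ω := by
      simp [hMdef]
    rw [h1]
    refine (enorm_add_le _ _).trans (add_le_add ?_ ?_)
    · exact le_iSup₂ (f := fun l _ => ‖(∑ j ∈ Finset.range l, M j) ω‖ₑ) l hl
    · refine (enorm_sum_le _ _).trans (Finset.sum_le_sum_of_subset ?_)
      exact Finset.range_subset_range.2 (by simpa [Nat.lt_succ_iff] using hl)
  have hm1 : AEStronglyMeasurable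
      (fun ω => ⨆ l ∈ Finset.range (n + 1), ‖(∑ j ∈ Finset.range l, M j) ω‖ₑ) μ := by
    refine (AEMeasurable.biSup _ (Finset.range (n + 1)).countable_toSet fun l _ => ?_).aestronglyMeasurable
    exact (memLp_finsetSum' (Finset.range l) fun j _ => hMq j).1.enorm
  have hm2 : ∀ j, AEStronglyMeasurable (fun ω => ‖μ[Z j | G j] ω‖ₑ) μ := fun j =>
    (hc j).1.enorm.aestronglyMeasurable
  calc _ ≤ eLpNorm ((fun ω => ⨆ l ∈ Finset.range (n + 1), ‖(∑ j ∈ Finset.range l, M j) ω‖ₑ)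
        + ∑ j ∈ Finset.range n, fun ω => ‖μ[Z j | G j] ω‖ₑ) (ENNReal.ofReal q) μ :=
        eLpNorm_mono_enorm fun ω => by simpa using hbd ω
    _ ≤ _ + ∑ j ∈ Finset.range n, eLpNorm (fun ω => ‖μ[Z j | G j] ω‖ₑ) (ENNReal.ofReal q) μ := by
        refine (eLpNorm_add_le hm1 (Finset.aestronglyMeasurable_sum _ fun j _ => hm2 j) hq1).trans ?_
        gcongr
        exact eLpNorm_sum_le (fun j _ => hm2 j) hq1
    _ ≤ _ := by
        refine add_le_add (hmart.trans ?_) (le_of_eq (Finset.sum_congr rfl fun j _ => ?_))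
        · have h3 : (∑ j ∈ Finset.range n, eLpNorm (M j) (ENNReal.ofReal q) μ ^ 2) ^ (1 / 2 : ℝ) ≤
              2 * (∑ j ∈ Finset.range n, eLpNorm (Z j) (ENNReal.ofReal q) μ ^ 2) ^ (1 / 2 : ℝ) := by
            rw [mul_rpow_half, Finset.mul_sum]
            refine ENNReal.rpow_le_rpow (Finset.sum_le_sum fun j _ => ?_) (by norm_num)
            rw [← mul_pow]
            have := hMle j
            gcongr
          calc _ ≤ 2 * K * ENNReal.ofReal (smoothConst q) ^ (1 / 2 : ℝ) * (2 *
              (∑ j ∈ Finset.range n, eLpNorm (Z j) (ENNReal.ofReal q) μ ^ 2) ^ (1 / 2 : ℝ)) := by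
                gcongr
            _ = _ := by
                rw [aggConst, ENNReal.coe_mul, ENNReal.coe_mul,
                  ENNReal.coe_rpow_of_nonneg _ (by norm_num : (0 : ℝ) ≤ 1 / 2)]
                have : ((4 : ℝ≥0) : ℝ≥0∞) = 2 * 2 := by norm_num
                rw [this, ENNReal.ofReal]
                ring
        · exact eLpNorm_enorm _

/-- The maximal inequality for a process that consists of blocks, where `Zs l` bounds the process
inside the block `l` and `Z l` is its increment over that block. -/
theorem eLpNorm_iSup_blocks_le (hq : 2 ≤ q) {K : ℝ≥0} (e : E ≃L[ℝ] H)
    (he : ∀ x, ‖x‖ ≤ ‖e x‖ ∧ ‖e x‖ ≤ K * ‖x‖) {Z : ℕ → Ω → E}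
    (hZ : ∀ j, StronglyMeasurable[G (j + 1)] (Z j)) (hZq : ∀ j, MemLp (Z j) (ENNReal.ofReal q) μ)
    {Zs : ℕ → Ω → ℝ≥0∞} (hZs : ∀ j, AEMeasurable (Zs j) μ) (hle : ∀ j ω, ‖Z j ω‖ₑ ≤ Zs j ω)
    (n : ℕ) :
    eLpNorm (fun ω => ⨆ l ∈ Finset.range n, (‖(∑ j ∈ Finset.range l, Z j) ω‖ₑ + Zs l ω))
        (ENNReal.ofReal q) μ ≤
      (aggConst q K + 1) *
        (∑ j ∈ Finset.range n, eLpNorm (Zs j) (ENNReal.ofReal q) μ ^ 2) ^ (1 / 2 : ℝ)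
      + ∑ j ∈ Finset.range n, eLpNorm (μ[Z j | G j]) (ENNReal.ofReal q) μ := by
  have hq1 := one_le_ofReal hq
  have hm1 : AEStronglyMeasurable
      (fun ω => ⨆ l ∈ Finset.range (n + 1), ‖(∑ j ∈ Finset.range l, Z j) ω‖ₑ) μ := by
    refine (AEMeasurable.biSup _ (Finset.range (n + 1)).countable_toSet
      fun l _ => ?_).aestronglyMeasurable
    exact (memLp_finsetSum' (Finset.range l) fun j _ => hZq j).1.enorm
  have hm2 : AEStronglyMeasurable (fun ω => ⨆ l ∈ Finset.range n, Zs l ω) μ :=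
    (AEMeasurable.biSup _ (Finset.range n).countable_toSet
      fun l _ => hZs l).aestronglyMeasurable
  have hZle : ∀ j, eLpNorm (Z j) (ENNReal.ofReal q) μ ≤ eLpNorm (Zs j) (ENNReal.ofReal q) μ :=
    fun j => eLpNorm_mono_enorm fun ω => by simpa using hle j ω
  calc _ ≤ eLpNorm ((fun ω => ⨆ l ∈ Finset.range (n + 1), ‖(∑ j ∈ Finset.range l, Z j) ω‖ₑ)
        + fun ω => ⨆ l ∈ Finset.range n, Zs l ω) (ENNReal.ofReal q) μ := by
        refine eLpNorm_mono_enorm fun ω => ?_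
        simp only [enorm_eq_self, Pi.add_apply]
        refine iSup₂_le fun l hl => add_le_add ?_ ?_
        · exact le_iSup₂ (f := fun l _ => ‖(∑ j ∈ Finset.range l, Z j) ω‖ₑ) l
            (Finset.mem_range.2 ((Finset.mem_range.1 hl).trans n.lt_succ_self))
        · exact le_iSup₂ (f := fun l _ => Zs l ω) l hl
    _ ≤ _ := eLpNorm_add_le hm1 hm2 hq1
    _ ≤ (aggConst q K *
        (∑ j ∈ Finset.range n, eLpNorm (Zs j) (ENNReal.ofReal q) μ ^ 2) ^ (1 / 2 : ℝ)
      + ∑ j ∈ Finset.range n, eLpNorm (μ[Z j | G j]) (ENNReal.ofReal q) μ)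
      + (∑ j ∈ Finset.range n, eLpNorm (Zs j) (ENNReal.ofReal q) μ ^ 2) ^ (1 / 2 : ℝ) := by
        refine add_le_add ((eLpNorm_iSup_sum_le hq e he hZ hZq n).trans ?_)
          (eLpNorm_iSup_le_sqrt_sum hq hZs n)
        gcongr with j
        exact hZle j
    _ = _ := by ring

end Aggregation

/-! ### Stochastic sewing along a finite sequence of times -/

section Splitting

variable {w : ℕ → ℕ → ℝ≥0∞}

lemma control_mono (hw : ∀ a b c, a ≤ b → b ≤ c → w a b + w b c ≤ w a c) {a b c d : ℕ}
    (hab : a ≤ b) (hbc : b ≤ c) (hcd : c ≤ d) : w b c ≤ w a d :=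
  calc w b c ≤ w a b + w b c := le_add_self
    _ ≤ w a c := hw a b c hab hbc
    _ ≤ w a c + w c d := le_self_add
    _ ≤ w a d := hw a c d (hab.trans hbc) hcd

lemma control_diag (hw : ∀ a b c, a ≤ b → b ≤ c → w a b + w b c ≤ w a c) {a : ℕ}
    (h : w a a ≠ ∞) : w a a = 0 := by
  have h1 := hw a a a le_rfl le_rfl
  by_contra h0
  exact absurd h1 (not_le.2 (ENNReal.lt_add_right h h0))

/-- A control can be split below a threshold, up to one elementary interval `[i, i + 1]`. -/
lemma exists_control_split (hw : ∀ a b c, a ≤ b → b ≤ c → w a b + w b c ≤ w a c)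
    (hfin : ∀ a b, a ≤ b → w a b ≠ ∞) (θ : ℝ≥0∞) {a b : ℕ} (hab : a < b) :
    ∃ i, a ≤ i ∧ i < b ∧ w a i ≤ θ ∧ (i + 1 = b ∨ θ < w a (i + 1)) := by
  classical
  set Q : ℕ → Prop := fun i => a ≤ i ∧ w a i ≤ θ
  have ha : Q a := ⟨le_rfl, by rw [control_diag hw (hfin a a le_rfl)]; exact zero_le⟩
  have hle : Nat.findGreatest Q (b - 1) ≤ b - 1 := Nat.findGreatest_le _
  have hQ : Q (Nat.findGreatest Q (b - 1)) := Nat.findGreatest_spec (m := a) (by omega) ha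
  refine ⟨_, hQ.1, by omega, hQ.2, ?_⟩
  by_cases h : Nat.findGreatest Q (b - 1) + 1 = b
  · exact Or.inl h
  · right
    by_contra hcon
    rw [not_lt] at hcon
    exact Nat.findGreatest_is_greatest (P := Q) (n := b - 1)
      (k := Nat.findGreatest Q (b - 1) + 1) (by omega) (by omega) ⟨by have := hQ.1; omega, hcon⟩

/-- Greedy splitting into at most `2 N + 2` intervals, each of which is elementary or shorter than
`[a, b]` with control at most `θ`. -/
lemma exists_control_partition (hw : ∀ a b c, a ≤ b → b ≤ c → w a b + w b c ≤ w a c)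
    (hfin : ∀ a b, a ≤ b → w a b ≠ ∞) {θ : ℝ≥0∞} (hθ : θ ≠ ∞) (N : ℕ) {a b : ℕ} (hab : a ≤ b)
    (hN : w a b ≤ N * θ) :
    ∃ c : ℕ → ℕ, Monotone c ∧ c 0 = a ∧ (∀ k, 2 * N + 2 ≤ k → c k = b) ∧
      ∀ l, c (l + 1) ≤ c l + 1 ∨ (w (c l) (c (l + 1)) ≤ θ ∧ c (l + 1) - c l < b - a) := by
  induction N generalizing a with
  | zero =>
    rcases hab.eq_or_lt with rfl | hab
    · exact ⟨fun _ => a, monotone_const, rfl, fun _ _ => rfl, fun l => Or.inl (by simp)⟩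
    · refine ⟨fun k => if k = 0 then a else if k = 1 then b - 1 else b, ?_, rfl, ?_, ?_⟩
      · refine monotone_nat_of_le_succ fun n => ?_
        rcases n with _ | _ | n
        all_goals simp
        all_goals omega
      · intro k hk
        have h1 : k ≠ 0 := by omega
        have h2 : k ≠ 1 := by omega
        simp only [h1, h2, if_false]
      · intro l
        rcases l with _ | _ | l
        · right
          simp only [zero_add, one_ne_zero, if_true, if_false]
          refine ⟨?_, by omega⟩
          have h := control_mono hw (le_refl a) (by omega : a ≤ b - 1) (by omega : b - 1 ≤ b)
          refine (h.trans hN).trans ?_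
          simp
        · left; simp; omega
        · left; simp
  | succ N ih =>
    rcases hab.eq_or_lt with rfl | hab
    · exact ⟨fun _ => a, monotone_const, rfl, fun _ _ => rfl, fun l => Or.inl (by simp)⟩
    · obtain ⟨i, hai, hib, hwi, hi⟩ := exists_control_split hw hfin θ hab
      have hrest : w (i + 1) b ≤ N * θ := by
        rcases hi with rfl | hi
        · rw [control_diag hw (hfin _ _ le_rfl)]; exact zero_le
        · have h1 := hw a (i + 1) b (by omega) (by omega)
          have h2 : θ + w (i + 1) b ≤ θ + N * θ := by
            calc θ + w (i + 1) b ≤ w a (i + 1) + w (i + 1) b := by gcongr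
              _ ≤ (N + 1 : ℕ) * θ := h1.trans hN
              _ = _ := by push_cast; ring
          exact (ENNReal.add_le_add_iff_left hθ).1 h2
      obtain ⟨c, hcm, hc0, hcb, hc⟩ := ih (a := i + 1) (by omega) hrest
      refine ⟨fun k => if k = 0 then a else if k = 1 then i else c (k - 2), ?_, rfl, ?_, ?_⟩
      · refine monotone_nat_of_le_succ fun n => ?_
        rcases n with _ | _ | n
        · simpa using hai
        · simp [hc0]
        · simpa using hcm n.le_succ
      · intro k hk
        have h1 : k ≠ 0 := by omega
        have h2 : k ≠ 1 := by omega
        simp only [h1, h2, if_false]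
        exact hcb _ (by omega)
      · intro l
        rcases l with _ | _ | l
        · right
          simp only [zero_add, one_ne_zero, if_true, if_false]
          exact ⟨hwi, by omega⟩
        · left; simp [hc0]
        · rcases hc l with h | ⟨h1, h2⟩
          · left; simpa using h
          · right
            exact ⟨h1, show c (l + 1) - c l < b - a by omega⟩

/-- The constant in the estimate for the conditional mean. -/
noncomputable def driftConst (α : ℝ) : ℝ≥0∞ := 2 / (1 - 2 ^ (1 - α))

lemma two_rpow_lt_one {α : ℝ} (hα : 1 < α) : (2 : ℝ≥0∞) ^ (1 - α) < 1 := by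
  rw [show 1 - α = -(α - 1) by ring, ENNReal.rpow_neg]
  exact ENNReal.inv_lt_one.2 (ENNReal.one_lt_rpow (by norm_num) (by linarith))

lemma driftConst_ne_top {α : ℝ} (hα : 1 < α) : driftConst α ≠ ∞ := by
  refine ENNReal.div_ne_top (by norm_num) ?_
  exact (tsub_pos_of_lt (two_rpow_lt_one hα)).ne'

lemma driftConst_eq {α : ℝ} (hα : 1 < α) :
    driftConst α * 2 ^ (1 - α) + 2 = driftConst α := by
  have h1 := two_rpow_lt_one hα
  have h2 : (1 : ℝ≥0∞) - 2 ^ (1 - α) ≠ 0 := (tsub_pos_of_lt h1).ne'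
  have h3 : (1 : ℝ≥0∞) - 2 ^ (1 - α) ≠ ∞ := (tsub_le_self.trans_lt ENNReal.one_lt_top).ne
  have h4 : driftConst α * (1 - 2 ^ (1 - α)) = 2 := ENNReal.div_mul_cancel h2 h3
  calc driftConst α * 2 ^ (1 - α) + 2
      = driftConst α * 2 ^ (1 - α) + driftConst α * (1 - 2 ^ (1 - α)) := by rw [h4]
    _ = driftConst α * (2 ^ (1 - α) + (1 - 2 ^ (1 - α))) := by rw [mul_add]
    _ = _ := by rw [add_tsub_cancel_of_le h1.le, mul_one]

end Splitting

section Defect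

variable {Ω E : Type*} [AddCommGroup E]

/-- The lack of additivity `A_{a,m} - A_{a,c} - A_{c,m}` of a two-parameter family. -/
def defect {ι : Type*} (A : ι → ι → Ω → E) (a c m : ι) : Ω → E := A a m - A a c - A c m

/-- The difference between the Riemann sum over `[a, m]` and `A a m`. -/
def sewErr (A : ℕ → ℕ → Ω → E) (a m : ℕ) : Ω → E := ∑ i ∈ Finset.Ico a m, A i (i + 1) - A a m

variable {A : ℕ → ℕ → Ω → E}

lemma sewErr_add {a k m : ℕ} (hak : a ≤ k) (hkm : k ≤ m) :
    sewErr A a m = sewErr A a k + sewErr A k m - defect A a k m := by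
  unfold sewErr defect
  rw [← Finset.sum_Ico_consecutive _ hak hkm]
  abel

lemma sewErr_self (hdiag : ∀ i, A i i = 0) (a : ℕ) : sewErr A a a = 0 := by
  simp [sewErr, hdiag]

lemma sewErr_succ (a : ℕ) : sewErr A a (a + 1) = 0 := by
  simp [sewErr]

lemma sewErr_of_le_succ (hdiag : ∀ i, A i i = 0) {a b : ℕ} (hab : a ≤ b) (hb : b ≤ a + 1) :
    sewErr A a b = 0 := by
  rcases hab.eq_or_lt with rfl | h
  · exact sewErr_self hdiag a
  · obtain rfl : b = a + 1 := by omega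
    exact sewErr_succ a

lemma sewErr_blocks (hdiag : ∀ i, A i i = 0) {c : ℕ → ℕ} (hc : Monotone c) (l : ℕ) {m : ℕ}
    (hm : c l ≤ m) :
    sewErr A (c 0) m = ∑ j ∈ Finset.range l, sewErr A (c j) (c (j + 1)) + sewErr A (c l) m
      - ∑ j ∈ Finset.range l, defect A (c 0) (c j) (c (j + 1)) - defect A (c 0) (c l) m := by
  induction l generalizing m with
  | zero =>
    have : defect A (c 0) (c 0) m = 0 := by simp [defect, hdiag]
    simp [this]
  | succ l ih =>
    rw [sewErr_add (hc (Nat.zero_le (l + 1))) hm, ih (hc l.le_succ), Finset.sum_range_succ,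
      Finset.sum_range_succ]
    abel

end Defect

section Sewing

variable {Ω : Type*} {mΩ : MeasurableSpace Ω}
  {E : Type*} [NormedAddCommGroup E] [NormedSpace ℝ E]

/-- A family `A i j` of `G i`-measurable random variables, the defect of which has a conditional
mean that is controlled by a superadditive `w`. -/
structure HasSmallDrift [CompleteSpace E] (μ : Measure Ω) (G : Filtration ℕ mΩ) (q α : ℝ)
    (B : ℝ≥0∞) (w : ℕ → ℕ → ℝ≥0∞) (A : ℕ → ℕ → Ω → E) : Prop where
  meas : ∀ i j, StronglyMeasurable[G i] (A i j)
  memLp : ∀ i j, MemLp (A i j) (ENNReal.ofReal q) μ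
  diag : ∀ i, A i i = 0
  superadd : ∀ a b c, a ≤ b → b ≤ c → w a b + w b c ≤ w a c
  le_one : ∀ a b, a ≤ b → w a b ≤ 1
  drift : ∀ a c m, a ≤ c → c ≤ m →
    eLpNorm (μ[defect A a c m | G a]) (ENNReal.ofReal q) μ ≤ B * w a m ^ α

/-- The assumptions of the discrete stochastic sewing lemma: the defect is controlled with exponent
`α` for the conditional mean and `β` for the size, uniformly in the third argument. -/
structure IsSewable [CompleteSpace E] (μ : Measure Ω) (G : Filtration ℕ mΩ) (q α β : ℝ) (B : ℝ≥0∞)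
    (w : ℕ → ℕ → ℝ≥0∞) (A : ℕ → ℕ → Ω → E) : Prop extends HasSmallDrift μ G q α B w A where
  size : ∀ a c b, a ≤ c → c ≤ b →
    eLpNorm (fun ω => ⨆ m ∈ Finset.Icc c b, ‖defect A a c m ω‖ₑ) (ENNReal.ofReal q) μ ≤
      B * w a b ^ β

namespace HasSmallDrift

variable [CompleteSpace E] {μ : Measure Ω} {G : Filtration ℕ mΩ}
  {q α : ℝ} {B : ℝ≥0∞} {w : ℕ → ℕ → ℝ≥0∞} {A : ℕ → ℕ → Ω → E}

lemma ne_top (h : HasSmallDrift μ G q α B w A) (a b : ℕ) (hab : a ≤ b) : w a b ≠ ∞ :=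
  ((h.le_one a b hab).trans_lt ENNReal.one_lt_top).ne

lemma mono (h : HasSmallDrift μ G q α B w A) {a b c d : ℕ} (hab : a ≤ b) (hbc : b ≤ c)
    (hcd : c ≤ d) : w b c ≤ w a d := control_mono h.superadd hab hbc hcd

lemma memLp_defect (h : HasSmallDrift μ G q α B w A) (a c m : ℕ) :
    MemLp (defect A a c m) (ENNReal.ofReal q) μ :=
  ((h.memLp a m).sub (h.memLp a c)).sub (h.memLp c m)

lemma memLp_sewErr (h : HasSmallDrift μ G q α B w A) (a m : ℕ) :
    MemLp (sewErr A a m) (ENNReal.ofReal q) μ :=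
  (memLp_finsetSum' _ fun i _ => h.memLp i (i + 1)).sub (h.memLp a m)

lemma meas_sewErr (h : HasSmallDrift μ G q α B w A) {a m : ℕ} (ham : a ≤ m) :
    StronglyMeasurable[G m] (sewErr A a m) := by
  refine StronglyMeasurable.sub (Finset.stronglyMeasurable_sum _ fun i hi => ?_)
    ((h.meas a m).mono (G.mono ham))
  exact (h.meas i (i + 1)).mono (G.mono (Finset.mem_Ico.1 hi).2.le)

variable [IsFiniteMeasure μ]

lemma eLpNorm_condExp_le_of_le {m₁ m₂ : MeasurableSpace Ω} (h12 : m₁ ≤ m₂) (h2 : m₂ ≤ mΩ)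
    (hq : 2 ≤ q) (f : Ω → E) :
    eLpNorm (μ[f | m₁]) (ENNReal.ofReal q) μ ≤ eLpNorm (μ[f | m₂]) (ENNReal.ofReal q) μ := by
  rw [← eLpNorm_congr_ae (condExp_condExp_of_le (f := f) (μ := μ) h12 h2)]
  exact eLpNorm_condExp_le_eLpNorm _ (one_le_ofReal hq)

/-- The estimate for the conditional mean, by induction: the interval is cut into two intervals with
at most half of the control and an elementary one. The induction closes because
`driftConst α * 2 ^ (1 - α) + 2 = driftConst α`. -/
theorem eLpNorm_condExp_sewErr_le (h : HasSmallDrift μ G q α B w A) (hq : 2 ≤ q) (hα : 1 < α)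
    {a b : ℕ} (hab : a ≤ b) :
    eLpNorm (μ[sewErr A a b | G a]) (ENNReal.ofReal q) μ ≤ driftConst α * B * w a b ^ α := by
  induction hn : b - a using Nat.strong_induction_on generalizing a b with
  | _ n ih =>
  rcases Nat.lt_or_ge b (a + 2) with hb | hb
  · rw [sewErr_of_le_succ h.diag hab (by omega), condExp_zero, eLpNorm_zero]; exact zero_le
  -- the intervals `[a, i]` and `[i + 1, b]` both have at most half of the control
  obtain ⟨i, hai, hib, hwi, hi⟩ :=
    exists_control_split h.superadd h.ne_top (w a b / 2) (show a < b by omega)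
  have hwab := h.ne_top a b hab
  have hrest : w (i + 1) b ≤ w a b / 2 := by
    rcases hi with rfl | hi
    · rw [control_diag h.superadd (h.ne_top _ _ le_rfl)]; exact zero_le
    · have h1 := h.superadd a (i + 1) b (by omega) (by omega)
      have h2 : w a b / 2 + w (i + 1) b ≤ w a b / 2 + w a b / 2 := by
        rw [ENNReal.add_halves]
        exact le_trans (by gcongr) h1
      exact (ENNReal.add_le_add_iff_left (ENNReal.div_ne_top hwab (by norm_num))).1 h2
  have ih1 := ih (i - a) (by omega) (a := a) (b := i) hai rfl
  have ih2 := ih (b - (i + 1)) (by omega) (a := i + 1) (b := b) (by omega) rfl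
  have hq1 := one_le_ofReal hq
  have hα0 : 0 ≤ α := by linarith
  have hdec : sewErr A a b = sewErr A a i + sewErr A (i + 1) b - defect A a i (i + 1)
      - defect A a (i + 1) b := by
    rw [sewErr_add (k := i + 1) (by omega) (by omega), sewErr_add hai i.le_succ, sewErr_succ]
    abel
  have hint : ∀ {f : Ω → E}, MemLp f (ENNReal.ofReal q) μ → Integrable f μ :=
    fun hf => hf.integrable hq1
  have hcond : μ[sewErr A a b | G a] =ᵐ[μ] μ[sewErr A a i | G a] + μ[sewErr A (i + 1) b | G a]
      - μ[defect A a i (i + 1) | G a] - μ[defect A a (i + 1) b | G a] := by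
    rw [hdec]
    have i1 := h.memLp_sewErr a i
    have i2 := h.memLp_sewErr (i + 1) b
    have i3 := h.memLp_defect a i (i + 1)
    have i4 := h.memLp_defect a (i + 1) b
    refine (condExp_sub (hint ((i1.add i2).sub i3)) (hint i4) _).trans (EventuallyEq.sub ?_ .rfl)
    refine (condExp_sub (hint (i1.add i2)) (hint i3) _).trans (EventuallyEq.sub ?_ .rfl)
    exact condExp_add (hint i1) (hint i2) _
  have c1 := ((h.memLp_sewErr a i).condExp hq1 (m := G a)).1
  have c2 := ((h.memLp_sewErr (i + 1) b).condExp hq1 (m := G a)).1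
  have c3 := ((h.memLp_defect a i (i + 1)).condExp hq1 (m := G a)).1
  have c4 := ((h.memLp_defect a (i + 1) b).condExp hq1 (m := G a)).1
  have d3 := h.drift a i (i + 1) hai i.le_succ
  have d4 := h.drift a (i + 1) b (by omega) (by omega)
  have hhalf : ∀ x, x ≤ w a b / 2 → driftConst α * B * x ^ α ≤
      driftConst α * B * w a b ^ α * 2 ^ (-α) := by
    intro x hx
    rw [ENNReal.rpow_neg, mul_assoc (driftConst α * B), ← div_eq_mul_inv,
      ← ENNReal.div_rpow_of_nonneg _ _ hα0]
    gcongr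
  calc eLpNorm (μ[sewErr A a b | G a]) (ENNReal.ofReal q) μ
      ≤ eLpNorm (μ[sewErr A a i | G a]) (ENNReal.ofReal q) μ
        + eLpNorm (μ[sewErr A (i + 1) b | G a]) (ENNReal.ofReal q) μ
        + eLpNorm (μ[defect A a i (i + 1) | G a]) (ENNReal.ofReal q) μ
        + eLpNorm (μ[defect A a (i + 1) b | G a]) (ENNReal.ofReal q) μ := by
        rw [eLpNorm_congr_ae hcond]
        refine (eLpNorm_sub_le ((c1.add c2).sub c3) c4 hq1).trans (add_le_add ?_ le_rfl)
        refine (eLpNorm_sub_le (c1.add c2) c3 hq1).trans (add_le_add ?_ le_rfl)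
        exact eLpNorm_add_le c1 c2 hq1
    _ ≤ driftConst α * B * w a b ^ α * 2 ^ (-α) + driftConst α * B * w a b ^ α * 2 ^ (-α)
        + B * w a b ^ α + B * w a b ^ α := by
        gcongr
        · exact ih1.trans (hhalf _ hwi)
        · exact (eLpNorm_condExp_le_of_le (G.mono (by omega)) (G.le _) hq _).trans
            (ih2.trans (hhalf _ hrest))
        · refine d3.trans ?_
          gcongr
          exact h.mono le_rfl (by omega) (by omega)
    _ = (driftConst α * 2 ^ (1 - α) + 2) * B * w a b ^ α := by
        rw [sub_eq_add_neg, ENNReal.rpow_add _ _ (by norm_num) (by norm_num), ENNReal.rpow_one]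
        ring
    _ = _ := by rw [driftConst_eq hα]

end HasSmallDrift

end Sewing

section SewingConstant

lemma exists_splitNumber {β : ℝ} (hβ : 1 / 2 < β) (C : ℝ≥0) :
    ∃ N : ℕ, 1 ≤ N ∧
      (C + 1) * ((2 * N + 2 : ℕ) : ℝ≥0∞) ^ (1 / 2 : ℝ) * (N : ℝ≥0∞) ^ (-β) ≤ 1 / 2 := by
  have ht : Tendsto (fun N : ℕ => (N : ℝ) ^ (-(β - 1 / 2))) atTop (𝓝 0) :=
    (tendsto_rpow_neg_atTop (by linarith)).comp tendsto_natCast_atTop_atTop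
  have hpos : (0 : ℝ) < 1 / (4 * (C + 1)) := by positivity
  obtain ⟨N, hN1, hN⟩ := ((eventually_ge_atTop 1).and (ht.eventually (gt_mem_nhds hpos))).exists
  refine ⟨N, hN1, ?_⟩
  have hN0 : (0 : ℝ) < N := by exact_mod_cast hN1
  have h1 : ((2 * N + 2 : ℕ) : ℝ≥0∞) ^ (1 / 2 : ℝ) ≤ 2 * (N : ℝ≥0∞) ^ (1 / 2 : ℝ) := by
    rw [mul_rpow_half]
    refine ENNReal.rpow_le_rpow ?_ (by norm_num)
    have : 2 * N + 2 ≤ 2 ^ 2 * N := by omega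
    exact_mod_cast this
  have hNe : (N : ℝ≥0∞) ≠ 0 := by exact_mod_cast (by omega : N ≠ 0)
  calc (C + 1) * ((2 * N + 2 : ℕ) : ℝ≥0∞) ^ (1 / 2 : ℝ) * (N : ℝ≥0∞) ^ (-β)
      ≤ (C + 1) * (2 * (N : ℝ≥0∞) ^ (1 / 2 : ℝ)) * (N : ℝ≥0∞) ^ (-β) := by gcongr
    _ = 2 * (C + 1) * (N : ℝ≥0∞) ^ (-(β - 1 / 2)) := by
        rw [show -(β - 1 / 2) = 1 / 2 + -β by ring,
          ENNReal.rpow_add _ _ hNe (ENNReal.natCast_ne_top N)]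
        ring
    _ = ENNReal.ofReal (2 * (C + 1) * (N : ℝ) ^ (-(β - 1 / 2))) := by
        rw [ENNReal.ofReal_mul (by positivity), ENNReal.ofReal_mul (by norm_num),
          ENNReal.ofReal_add (by positivity) (by norm_num), ← ENNReal.ofReal_rpow_of_pos hN0]
        simp
    _ ≤ ENNReal.ofReal (1 / 2) := by
        refine ENNReal.ofReal_le_ofReal ?_
        rw [lt_div_iff₀ (by positivity)] at hN
        linarith
    _ = 1 / 2 := by
        rw [ENNReal.ofReal_div_of_pos (by norm_num)]; simp

/-- The number of pieces into which an interval is split in the proof of the sewing lemma. -/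
noncomputable def splitNumber (β : ℝ) (C : ℝ≥0) : ℕ :=
  open Classical in if h : 1 / 2 < β then (exists_splitNumber h C).choose else 1

lemma splitNumber_spec {β : ℝ} (hβ : 1 / 2 < β) (C : ℝ≥0) :
    1 ≤ splitNumber β C ∧ (C + 1) * ((2 * splitNumber β C + 2 : ℕ) : ℝ≥0∞) ^ (1 / 2 : ℝ) *
      (splitNumber β C : ℝ≥0∞) ^ (-β) ≤ 1 / 2 := by
  rw [splitNumber, dif_pos hβ]
  exact (exists_splitNumber hβ C).choose_spec

/-- The constant in the discrete stochastic sewing lemma. -/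
noncomputable def sewConst (q : ℝ) (K : ℝ≥0) (α β : ℝ) : ℝ≥0∞ :=
  2 * ((2 * splitNumber β (aggConst q K) + 2 : ℕ) * (driftConst α + 1))

lemma sewConst_ne_top {q : ℝ} {K : ℝ≥0} {α β : ℝ} (hα : 1 < α) : sewConst q K α β ≠ ∞ :=
  ENNReal.mul_ne_top (by norm_num) (ENNReal.mul_ne_top (ENNReal.natCast_ne_top _)
    (ENNReal.add_ne_top.2 ⟨driftConst_ne_top hα, by norm_num⟩))

end SewingConstant

/-- The filtration observed along an increasing sequence of times. -/
def reindexFiltration {Ω ι : Type*} [Preorder ι] {mΩ : MeasurableSpace Ω} (G : Filtration ι mΩ)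
    (c : ℕ → ι) (hc : Monotone c) : Filtration ℕ mΩ where
  seq l := G (c l)
  mono' _ _ h := G.mono (hc h)
  le' l := G.le (c l)

lemma exists_block {ι : Type*} [LinearOrder ι] {c : ℕ → ι} {L : ℕ} {m : ι} (h0 : c 0 ≤ m)
    (hL : m ≤ c L) (hL0 : 0 < L) : ∃ l < L, c l ≤ m ∧ m ≤ c (l + 1) := by
  induction L with
  | zero => omega
  | succ L ih =>
    rcases lt_or_ge m (c L) with h | h
    · rcases Nat.eq_zero_or_pos L with rfl | hL0
      · exact absurd h0 (not_le.2 h)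
      · obtain ⟨l, hl, h1⟩ := ih h.le hL0
        exact ⟨l, by omega, h1⟩
    · exact ⟨L, by omega, h, hL⟩

namespace IsSewable

variable {Ω : Type*} {mΩ : MeasurableSpace Ω}
  {E : Type*} [NormedAddCommGroup E] [NormedSpace ℝ E]
  [CompleteSpace E] {μ : Measure Ω} [IsFiniteMeasure μ] {G : Filtration ℕ mΩ}
  {q α β : ℝ} {B : ℝ≥0∞} {w : ℕ → ℕ → ℝ≥0∞} {A : ℕ → ℕ → Ω → E}
  {H : Type*} [NormedAddCommGroup H] [InnerProductSpace ℝ H] [CompleteSpace H]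

/-- The discrete stochastic sewing lemma, in maximal form. The interval is split into boundedly many
pieces of small control; the errors over the pieces are combined by the maximal inequality for
martingale differences, the constant of which is compensated by the smallness of the pieces. -/
theorem eLpNorm_iSup_sewErr_le (h : IsSewable μ G q α β B w A) (hq : 2 ≤ q) (hα : 1 < α)
    (hβ : 1 / 2 < β) (hβα : β ≤ α) {K : ℝ≥0} (e : E ≃L[ℝ] H)
    (he : ∀ x, ‖x‖ ≤ ‖e x‖ ∧ ‖e x‖ ≤ K * ‖x‖) {a b : ℕ} (hab : a ≤ b) :
    eLpNorm (fun ω => ⨆ m ∈ Finset.Icc a b, ‖sewErr A a m ω‖ₑ) (ENNReal.ofReal q) μ ≤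
      sewConst q K α β * B * w a b ^ β := by
  have hq1 := one_le_ofReal hq
  have hβ0 : 0 ≤ β := by linarith
  have hmeas : ∀ a b, AEMeasurable (fun ω => ⨆ m ∈ Finset.Icc a b, ‖sewErr A a m ω‖ₑ) μ :=
    fun a b => AEMeasurable.biSup _ (Finset.Icc a b).countable_toSet
      fun m _ => (h.memLp_sewErr a m).1.enorm
  induction hn : b - a using Nat.strong_induction_on generalizing a b with
  | _ n ih =>
  rcases Nat.lt_or_ge b (a + 2) with hb | hb
  · have h0 : ∀ ω, ⨆ m ∈ Finset.Icc a b, ‖sewErr A a m ω‖ₑ = 0 := fun ω => by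
      simp only [ENNReal.iSup_eq_zero, Finset.mem_Icc]
      intro m hm
      rw [sewErr_of_le_succ h.diag hm.1 (by omega)]; simp
    simp only [h0]
    simp
  obtain ⟨hN1, hN⟩ := splitNumber_spec hβ (aggConst q K)
  set N := splitNumber β (aggConst q K) with hNdef
  have hN0 : (N : ℝ≥0∞) ≠ 0 := by exact_mod_cast (by omega : N ≠ 0)
  set L := 2 * N + 2 with hL
  have hwab := h.ne_top a b hab
  obtain ⟨c, hcm, hc0, hcL, hc⟩ := exists_control_partition (θ := w a b / N) h.superadd h.ne_top
    (ENNReal.div_ne_top hwab hN0) N hab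
    (by rw [ENNReal.mul_div_cancel hN0 (ENNReal.natCast_ne_top N)])
  have hcl : ∀ l, a ≤ c l := fun l => hc0 ▸ hcm (Nat.zero_le l)
  have hcu : ∀ l, c l ≤ b := fun l => by
    rcases le_total l L with hl | hl
    · exact hcL L le_rfl ▸ hcm hl
    · exact (hcL l hl).le
  -- the increments over the pieces, the incomplete last piece, and the defects of the coarse sums
  set Z : ℕ → Ω → E := fun l => sewErr A (c l) (c (l + 1)) with hZ
  set Zs : ℕ → Ω → ℝ≥0∞ := fun l ω => ⨆ m ∈ Finset.Icc (c l) (c (l + 1)), ‖sewErr A (c l) m ω‖ₑ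
    with hZs
  set g : ℕ → Ω → ℝ≥0∞ := fun l ω => ⨆ m ∈ Finset.Icc (c l) b, ‖defect A a (c l) m ω‖ₑ with hg
  have hgm : ∀ l, AEStronglyMeasurable (g l) μ := fun l =>
    (AEMeasurable.biSup _ (Finset.Icc (c l) b).countable_toSet
      fun m _ => (h.memLp_defect a (c l) m).1.enorm).aestronglyMeasurable
  have hblocks := eLpNorm_iSup_blocks_le (G := reindexFiltration G c hcm) (μ := μ) hq e he
    (Z := Z) (Zs := Zs) (fun l => h.meas_sewErr (hcm l.le_succ)) (fun l => h.memLp_sewErr _ _)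
    (fun l => hmeas _ _) (fun l ω => le_iSup₂ (f := fun m _ => ‖sewErr A (c l) m ω‖ₑ) (c (l + 1))
      (Finset.mem_Icc.2 ⟨hcm l.le_succ, le_rfl⟩)) L
  have hpoint : ∀ ω, ⨆ m ∈ Finset.Icc a b, ‖sewErr A a m ω‖ₑ ≤
      (⨆ l ∈ Finset.range L, (‖(∑ j ∈ Finset.range l, Z j) ω‖ₑ + Zs l ω))
        + ∑ j ∈ Finset.range L, g j ω := by
    intro ω
    refine iSup₂_le fun m hm => ?_
    rw [Finset.mem_Icc] at hm
    obtain ⟨l, hlL, hlm, hml⟩ := exists_block (hc0.le.trans hm.1)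
      (hm.2.trans (hcL L le_rfl).ge) (by omega)
    have hdec := sewErr_blocks h.diag hcm l hlm
    rw [hc0] at hdec
    have e1 : sewErr A a m ω = ((∑ j ∈ Finset.range l, Z j) ω + sewErr A (c l) m ω)
        - (∑ j ∈ Finset.range l, defect A a (c j) (c (j + 1)) ω + defect A a (c l) m ω) := by
      rw [hdec]; simp [hZ]; abel
    rw [e1]
    refine enorm_sub_le.trans (add_le_add ?_ ?_)
    · refine (enorm_add_le _ _).trans ?_
      refine le_trans ?_ (le_iSup₂ (f := fun l _ => ‖(∑ j ∈ Finset.range l, Z j) ω‖ₑ + Zs l ω) l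
        (Finset.mem_range.2 hlL))
      gcongr
      exact le_iSup₂ (f := fun m _ => ‖sewErr A (c l) m ω‖ₑ) m (Finset.mem_Icc.2 ⟨hlm, hml⟩)
    · calc ‖∑ j ∈ Finset.range l, defect A a (c j) (c (j + 1)) ω + defect A a (c l) m ω‖ₑ
          ≤ ∑ j ∈ Finset.range l, g j ω + g l ω := by
            refine (enorm_add_le _ _).trans (add_le_add ((enorm_sum_le _ _).trans
              (Finset.sum_le_sum fun j _ => ?_)) ?_)
            · exact le_iSup₂ (f := fun m _ => ‖defect A a (c j) m ω‖ₑ) (c (j + 1))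
                (Finset.mem_Icc.2 ⟨hcm j.le_succ, hcu _⟩)
            · exact le_iSup₂ (f := fun m _ => ‖defect A a (c l) m ω‖ₑ) m
                (Finset.mem_Icc.2 ⟨hlm, hm.2⟩)
        _ = ∑ j ∈ Finset.range (l + 1), g j ω := (Finset.sum_range_succ _ _).symm
        _ ≤ ∑ j ∈ Finset.range L, g j ω :=
            Finset.sum_le_sum_of_subset (Finset.range_subset_range.2 hlL)
  -- the induction hypothesis gains the factor `N ^ (-β)` on each piece
  have hZsle : ∀ l, eLpNorm (Zs l) (ENNReal.ofReal q) μ ≤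
      sewConst q K α β * B * w a b ^ β * (N : ℝ≥0∞) ^ (-β) := by
    intro l
    rcases hc l with hl | ⟨hl1, hl2⟩
    · have h0 : Zs l = 0 := by
        funext ω
        simp only [hZs, ENNReal.iSup_eq_zero, Finset.mem_Icc, Pi.zero_apply]
        intro m hm
        rw [sewErr_of_le_succ h.diag hm.1 (by omega)]; simp
      rw [h0, eLpNorm_zero]; exact zero_le
    · refine (ih _ (hn ▸ hl2) (hcm l.le_succ) rfl).trans ?_
      rw [mul_assoc _ (w a b ^ β), ENNReal.rpow_neg, ← div_eq_mul_inv,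
        ← ENNReal.div_rpow_of_nonneg _ _ hβ0]
      gcongr
  have hwα : w a b ^ α ≤ w a b ^ β := ENNReal.rpow_le_rpow_of_exponent_ge (h.le_one a b hab) hβα
  have hmsup : AEStronglyMeasurable (fun ω => ⨆ l ∈ Finset.range L,
      (‖(∑ j ∈ Finset.range l, Z j) ω‖ₑ + Zs l ω)) μ :=
    (AEMeasurable.biSup _ (Finset.range L).countable_toSet fun l _ =>
      ((memLp_finsetSum' (Finset.range l) fun j _ => h.memLp_sewErr _ _).1.enorm.add
        (hmeas _ _))).aestronglyMeasurable
  set R := B * w a b ^ β with hR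
  calc eLpNorm (fun ω => ⨆ m ∈ Finset.Icc a b, ‖sewErr A a m ω‖ₑ) (ENNReal.ofReal q) μ
      ≤ eLpNorm ((fun ω => ⨆ l ∈ Finset.range L, (‖(∑ j ∈ Finset.range l, Z j) ω‖ₑ + Zs l ω))
        + ∑ j ∈ Finset.range L, g j) (ENNReal.ofReal q) μ :=
        eLpNorm_mono_enorm fun ω => by simpa using hpoint ω
    _ ≤ _ + ∑ j ∈ Finset.range L, eLpNorm (g j) (ENNReal.ofReal q) μ := by
        refine (eLpNorm_add_le hmsup (Finset.aestronglyMeasurable_sum _ fun j _ => hgm j)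
          hq1).trans ?_
        gcongr
        exact eLpNorm_sum_le (fun j _ => hgm j) hq1
    _ ≤ ((aggConst q K + 1) * (∑ j ∈ Finset.range L,
          (sewConst q K α β * R * (N : ℝ≥0∞) ^ (-β)) ^ 2) ^ (1 / 2 : ℝ)
        + ∑ j ∈ Finset.range L, driftConst α * R) + ∑ j ∈ Finset.range L, R := by
        refine add_le_add (hblocks.trans (add_le_add ?_ (Finset.sum_le_sum fun j _ => ?_)))
          (Finset.sum_le_sum fun j _ => h.size a (c j) b (hcl j) (hcu j))
        · gcongr with j
          rw [hR, ← mul_assoc]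
          exact hZsle j
        · refine (h.eLpNorm_condExp_sewErr_le hq hα (hcm j.le_succ)).trans ?_
          rw [hR, ← mul_assoc]
          gcongr
          exact (ENNReal.rpow_le_rpow (h.mono (hcl j) (hcm j.le_succ) (hcu _))
            (by linarith)).trans hwα
    _ = ((aggConst q K + 1) * (L : ℝ≥0∞) ^ (1 / 2 : ℝ) * (N : ℝ≥0∞) ^ (-β)) * (sewConst q K α β * R)
        + L * (driftConst α + 1) * R := by
        simp only [Finset.sum_const, Finset.card_range, nsmul_eq_mul]
        rw [mul_comm (L : ℝ≥0∞) (_ ^ 2), ← mul_rpow_half]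
        ring
    -- the choice of `N`: since `β > 1/2`, the factor `N ^ (-β)` beats `L ^ (1/2)`
    _ ≤ 1 / 2 * (sewConst q K α β * R) + L * (driftConst α + 1) * R := by gcongr
    _ = sewConst q K α β * R := by
        have h2 : (1 / 2 : ℝ≥0∞) * sewConst q K α β = L * (driftConst α + 1) := by
          rw [sewConst, ← mul_assoc, one_div, ENNReal.inv_mul_cancel (by norm_num) (by norm_num),
            one_mul]
        rw [← h2, ← mul_assoc, ← add_mul, ← add_mul, one_div, ENNReal.inv_two_add_inv_two, one_mul]
    _ = _ := by rw [hR, mul_assoc]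

end IsSewable

/-! ### Duality for the norms `‖·‖_{q,r,s}` -/

section Weights

/-- Bounded `m`-measurable densities in the unit ball of the dual of `L^r`. The defining inequality
is Hölder's inequality, so that the conjugate exponent does not appear. -/
structure IsWeight {Ω : Type*} (m : MeasurableSpace Ω) {mΩ : MeasurableSpace Ω} (P : Measure Ω)
    (r : ℝ≥0∞) (h : Ω → ℝ≥0) : Prop where
  measurable : Measurable[m] h
  bounded : ∃ C : ℝ≥0, ∀ ω, h ω ≤ C
  dual : ∀ g : Ω → ℝ≥0∞, Measurable g → ∫⁻ ω, h ω * g ω ∂P ≤ eLpNorm g r P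

/-- The measure with density `h` with respect to `P`. -/
noncomputable def weighted {Ω : Type*} {mΩ : MeasurableSpace Ω} (P : Measure Ω) (h : Ω → ℝ≥0) : Measure Ω :=
  P.withDensity fun ω => (h ω : ℝ≥0∞)

variable {Ω : Type*} {m m' mΩ : MeasurableSpace Ω} {P : Measure Ω} {r : ℝ≥0∞} {h : Ω → ℝ≥0}

lemma IsWeight.mono (hh : IsWeight m P r h) (hm : m ≤ m') : IsWeight m' P r h :=
  ⟨hh.measurable.mono hm le_rfl, hh.bounded, hh.dual⟩

lemma isWeight_one [IsProbabilityMeasure P] (hr : 1 ≤ r) : IsWeight m P r (fun _ => 1) := by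
  refine ⟨measurable_const, ⟨1, fun _ => le_rfl⟩, fun g hg => ?_⟩
  calc ∫⁻ ω, (1 : ℝ≥0) * g ω ∂P = eLpNorm g 1 P := by
        rw [eLpNorm_one_eq_lintegral_enorm]; simp
    _ ≤ eLpNorm g r P := eLpNorm_le_eLpNorm_of_exponent_le hr hg.aestronglyMeasurable

lemma weighted_one : weighted P (fun _ => 1) = P := by
  simp [weighted]

lemma weighted_le_smul {C : ℝ≥0} (hC : ∀ ω, h ω ≤ C) : weighted P h ≤ (C : ℝ≥0∞) • P := by
  rw [← withDensity_const]
  exact withDensity_mono (Eventually.of_forall fun ω => by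
    show (h ω : ℝ≥0∞) ≤ C
    exact_mod_cast hC ω)

lemma weighted_ac : weighted P h ≪ P := withDensity_absolutelyContinuous _ _

lemma IsWeight.isFiniteMeasure [IsFiniteMeasure P] (hh : IsWeight m P r h) :
    IsFiniteMeasure (weighted P h) := by
  obtain ⟨C, hC⟩ := hh.bounded
  refine ⟨(weighted_le_smul (P := P) hC Set.univ).trans_lt ?_⟩
  rw [Measure.smul_apply, smul_eq_mul]
  exact ENNReal.mul_lt_top ENNReal.coe_lt_top (measure_lt_top P _)

lemma IsWeight.memLp {E : Type*} [NormedAddCommGroup E] (hh : IsWeight m P r h) {p : ℝ≥0∞}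
    {f : Ω → E} (hf : MemLp f p P) : MemLp f p (weighted P h) := by
  obtain ⟨C, hC⟩ := hh.bounded
  exact hf.of_measure_le_smul ENNReal.coe_ne_top (weighted_le_smul hC)

/-- A change of density by a bounded `m`-measurable function does not affect conditional
expectations given a larger `σ`-algebra. -/
lemma IsWeight.condExp_ae_eq [IsFiniteMeasure P] {E : Type*} [NormedAddCommGroup E]
    [NormedSpace ℝ E] [CompleteSpace E] (hh : IsWeight m P r h) (hm : m ≤ mΩ) {f : Ω → E}
    (hf : Integrable f P) : P[f | m] =ᵐ[weighted P h] (weighted P h)[f | m] := by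
  have := hh.isFiniteMeasure
  have hmeas : Measurable h := hh.measurable.mono hm le_rfl
  obtain ⟨C, hC⟩ := hh.bounded
  have hint : ∀ {g : Ω → E}, Integrable g P → Integrable g (weighted P h) := fun hg => by
    rw [← memLp_one_iff_integrable] at hg ⊢
    exact hh.memLp hg
  have hhR : StronglyMeasurable[m] fun ω => (h ω : ℝ) :=
    (measurable_coe_nnreal_real.comp hh.measurable).stronglyMeasurable
  have hbd : ∀ᵐ ω ∂P, ‖(h ω : ℝ)‖ ≤ C := Eventually.of_forall fun ω => by
    simpa using hC ω
  have hpull := condExp_stronglyMeasurable_bilin_of_bound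
    (ContinuousLinearMap.lsmul ℝ ℝ : ℝ →L[ℝ] E →L[ℝ] E) hm hhR hf C hbd
  have hmulint : Integrable (fun ω => (h ω : ℝ) • f ω) P :=
    hf.bdd_smul (C : ℝ) (hhR.mono hm).aestronglyMeasurable hbd
  refine ae_eq_condExp_of_forall_setIntegral_eq hm (hint hf)
    (fun s _ _ => (hint integrable_condExp).integrableOn) (fun s hs _ => ?_)
    stronglyMeasurable_condExp.aestronglyMeasurable
  unfold weighted
  rw [setIntegral_withDensity_eq_setIntegral_smul hmeas _ (hm s hs),
    setIntegral_withDensity_eq_setIntegral_smul hmeas _ (hm s hs)]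
  have e1 : ∫ ω in s, h ω • P[f | m] ω ∂P = ∫ ω in s, P[fun ω => (h ω : ℝ) • f ω | m] ω ∂P := by
    refine setIntegral_congr_ae (hm s hs) ?_
    filter_upwards [hpull] with ω hω _
    rw [NNReal.smul_def]
    exact hω.symm
  rw [e1, setIntegral_condExp hm hmulint hs]
  simp only [NNReal.smul_def]

/-- The norm of `L^r` is attained, up to approximation, on weights. -/
lemma eLpNorm_le_of_forall_weight [IsProbabilityMeasure P] (hr : 1 ≤ r) (hm : m ≤ mΩ)
    {g : Ω → ℝ≥0∞} (hg : Measurable[m] g) {K : ℝ≥0∞}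
    (hK : ∀ h, IsWeight m P r h → ∫⁻ ω, h ω * g ω ∂P ≤ K) : eLpNorm g r P ≤ K := by
  have hgm : Measurable g := hg.mono hm le_rfl
  rcases eq_or_ne r ∞ with rfl | hrt
  · rw [eLpNorm_exponent_top, eLpNormEssSup_eq_essSup_enorm]
    simp only [enorm_eq_self]
    by_contra! hcon
    obtain ⟨K', hK1, hK2⟩ := exists_between hcon
    -- for `r = ∞`, test with the normalized indicator of a set on which `g` is large
    set S : Set Ω := {ω | K' < g ω} with hS
    have hSm : MeasurableSet[m] S := measurableSet_lt measurable_const hg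
    have hS0 : P S ≠ 0 := by
      intro h0
      refine absurd hK2 (not_lt.2 (essSup_le_of_ae_le _ ?_))
      rw [EventuallyLE, ae_iff]
      simpa [hS] using h0
    have hSt : P S ≠ ∞ := measure_ne_top P S
    have hinv : ((P S)⁻¹).toNNReal = (P S)⁻¹ := ENNReal.coe_toNNReal (ENNReal.inv_ne_top.2 hS0)
    have hind : ∀ f : Ω → ℝ≥0∞,
        ∫⁻ ω, ((S.indicator (fun _ => ((P S)⁻¹).toNNReal) ω : ℝ≥0) : ℝ≥0∞) * f ω ∂P
          = (P S)⁻¹ * ∫⁻ ω in S, f ω ∂P := by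
      intro f
      rw [← lintegral_const_mul' _ _ (ENNReal.inv_ne_top.2 hS0),
        ← lintegral_indicator (hm S hSm)]
      refine lintegral_congr fun ω => ?_
      by_cases hω : ω ∈ S
      · rw [Set.indicator_of_mem hω, Set.indicator_of_mem hω, hinv]
      · simp [hω]
    have hw : IsWeight m P ∞ (S.indicator fun _ => ((P S)⁻¹).toNNReal) := by
      refine ⟨measurable_const.indicator hSm, ⟨((P S)⁻¹).toNNReal, fun ω =>
        Set.indicator_le_self' (fun _ _ => zero_le) ω⟩, fun f hf => ?_⟩
      rw [hind f]
      calc (P S)⁻¹ * ∫⁻ ω in S, f ω ∂P ≤ (P S)⁻¹ * (eLpNorm f ∞ P * P S) := by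
            gcongr
            rw [← setLIntegral_const]
            refine lintegral_mono_ae (ae_restrict_of_ae ?_)
            rw [eLpNorm_exponent_top]
            simpa using enorm_ae_le_eLpNormEssSup f P
        _ = eLpNorm f ∞ P := by
            rw [mul_comm, mul_assoc, ENNReal.mul_inv_cancel hS0 hSt, mul_one]
    have h1 := hK _ hw
    rw [hind g] at h1
    refine absurd (h1.trans_lt hK1) (not_lt.2 ?_)
    calc K' = (P S)⁻¹ * (K' * P S) := by
          rw [mul_comm, mul_assoc, ENNReal.mul_inv_cancel hS0 hSt, mul_one]
      _ ≤ (P S)⁻¹ * ∫⁻ ω in S, g ω ∂P := by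
          gcongr
          rw [← setLIntegral_const]
          exact setLIntegral_mono hgm fun ω hω => le_of_lt hω
  · set ρ := r.toReal with hρ
    have hρ1 : 1 ≤ ρ := by
      rw [hρ, ← ENNReal.toReal_one]; exact (ENNReal.toReal_le_toReal (by simp) hrt).2 hr
    have hρ0 : 0 < ρ := by linarith
    have hr0 : r ≠ 0 := (zero_lt_one.trans_le hr).ne'
    rw [eLpNorm_eq_lintegral_rpow_enorm_toReal hr0 hrt, one_div, ENNReal.rpow_inv_le_iff hρ0]
    simp only [enorm_eq_self]
    -- the claim for the truncations of `g`
    have hn : ∀ n : ℕ, ∫⁻ ω, (min (g ω) n) ^ ρ ∂P ≤ K ^ ρ := by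
      intro n
      set gn : Ω → ℝ≥0∞ := fun ω => min (g ω) n with hgn
      have hgnm : Measurable[m] gn := hg.min measurable_const
      have hgnm' : Measurable gn := hgnm.mono hm le_rfl
      set J := ∫⁻ ω, gn ω ^ ρ ∂P with hJ
      have hJt : J ≠ ∞ := by
        refine (lt_of_le_of_lt (lintegral_mono (g := fun _ => (n : ℝ≥0∞) ^ ρ) fun ω => ?_) ?_).ne
        · exact ENNReal.rpow_le_rpow (min_le_right _ _) hρ0.le
        · rw [lintegral_const]
          exact ENNReal.mul_lt_top (ENNReal.rpow_lt_top_of_nonneg hρ0.le (by simp))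
            (measure_lt_top _ _)
      rcases eq_or_ne J 0 with hJ0 | hJ0
      · rw [hJ0]; exact zero_le
      -- the extremal density for Hölder's inequality
      set c := J ^ ((ρ - 1) / ρ) with hc
      have hexp : 0 ≤ (ρ - 1) / ρ := div_nonneg (by linarith) hρ0.le
      have hc0 : c ≠ 0 := (ENNReal.rpow_pos (pos_iff_ne_zero.2 hJ0) hJt).ne'
      have hct : c ≠ ∞ := ENNReal.rpow_ne_top_of_nonneg hexp hJt
      have hbd : ∀ ω, gn ω ^ (ρ - 1) / c ≤ (n : ℝ≥0∞) ^ (ρ - 1) / c := fun ω => by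
        gcongr
        exact min_le_right _ _
      have hbt : (n : ℝ≥0∞) ^ (ρ - 1) / c ≠ ∞ :=
        ENNReal.div_ne_top (ENNReal.rpow_ne_top_of_nonneg (by linarith) (by simp)) hc0
      have hcoe : ∀ ω, (((gn ω ^ (ρ - 1) / c).toNNReal : ℝ≥0) : ℝ≥0∞) = gn ω ^ (ρ - 1) / c :=
        fun ω => ENNReal.coe_toNNReal ((hbd ω).trans_lt (lt_top_iff_ne_top.2 hbt)).ne
      have hw : IsWeight m P r fun ω => (gn ω ^ (ρ - 1) / c).toNNReal := by
        refine ⟨((hgnm.pow_const _).div_const _).ennreal_toNNReal,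
          ⟨((n : ℝ≥0∞) ^ (ρ - 1) / c).toNNReal, fun ω => ENNReal.toNNReal_mono hbt (hbd ω)⟩,
          fun f hf => ?_⟩
        simp only [hcoe]
        have hH := ENNReal.lintegral_mul_norm_pow_le (μ := P) (hgnm'.pow_const ρ).aemeasurable
          (hf.pow_const ρ).aemeasurable (p := (ρ - 1) / ρ) (q := 1 / ρ) hexp (by positivity)
          (by field_simp; ring)
        have e1 : ∀ ω, gn ω ^ (ρ - 1) / c * f ω =
            c⁻¹ * ((gn ω ^ ρ) ^ ((ρ - 1) / ρ) * (f ω ^ ρ) ^ (1 / ρ)) := fun ω => by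
          rw [← ENNReal.rpow_mul, ← ENNReal.rpow_mul, mul_div_cancel₀ _ hρ0.ne',
            mul_div_cancel₀ _ hρ0.ne', ENNReal.rpow_one, div_eq_mul_inv]
          ring
        simp only [e1]
        rw [lintegral_const_mul' _ _ (ENNReal.inv_ne_top.2 hc0),
          eLpNorm_eq_lintegral_rpow_enorm_toReal hr0 hrt]
        simp only [enorm_eq_self]
        calc c⁻¹ * _ ≤ c⁻¹ * (c * (∫⁻ ω, f ω ^ ρ ∂P) ^ (1 / ρ)) := by gcongr
          _ = _ := by rw [← mul_assoc, ENNReal.inv_mul_cancel hc0 hct, one_mul]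
      have h1 := hK _ hw
      simp only [hcoe] at h1
      have h2 : J / c ≤ K := by
        refine le_trans ?_ h1
        rw [div_eq_mul_inv, mul_comm, hJ, ← lintegral_const_mul' _ _ (ENNReal.inv_ne_top.2 hc0)]
        refine lintegral_mono fun ω => ?_
        have e2 : gn ω ^ ρ = gn ω ^ (ρ - 1) * gn ω := by
          rcases eq_or_ne (gn ω) 0 with h0 | h0
          · rw [h0, mul_zero, ENNReal.zero_rpow_of_pos hρ0]
          · rw [show ρ = ρ - 1 + 1 by ring, ENNReal.rpow_add _ _ h0
              ((min_le_right _ _).trans_lt (by simp : (n : ℝ≥0∞) < ∞)).ne, ENNReal.rpow_one]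
            simp
        rw [e2, ← mul_assoc, mul_comm c⁻¹, ← div_eq_mul_inv]
        gcongr
        exact min_le_left _ _
      have h3 : J / c = J ^ (1 / ρ) := by
        have : 1 / ρ = 1 - (ρ - 1) / ρ := by field_simp; ring
        rw [this, ENNReal.rpow_sub _ _ hJ0 hJt, ENNReal.rpow_one]
      rw [h3, one_div, ENNReal.rpow_inv_le_iff hρ0] at h2
      exact h2
    have hsup : ∀ ω, g ω ^ ρ = ⨆ n : ℕ, (min (g ω) n) ^ ρ := by
      intro ω
      have h1 : g ω = ⨆ n : ℕ, min (g ω) n := by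
        rw [← inf_iSup_eq, ENNReal.iSup_natCast, inf_top_eq]
      apply le_antisymm
      · rw [← ENNReal.le_rpow_inv_iff hρ0]
        conv_lhs => rw [h1]
        refine iSup_le fun n => ?_
        rw [ENNReal.le_rpow_inv_iff hρ0]
        exact le_iSup (fun n : ℕ => (min (g ω) n) ^ ρ) n
      · exact iSup_le fun n => ENNReal.rpow_le_rpow (min_le_left _ _) hρ0.le
    rw [lintegral_congr hsup, lintegral_iSup (fun n => (hgm.min measurable_const).pow_const ρ)]
    · exact iSup_le hn
    · intro i j hij ω
      refine ENNReal.rpow_le_rpow (min_le_min le_rfl ?_) hρ0.le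
      exact_mod_cast hij

/-- The pull-out property of the conditional expectation of `[0,∞]`-valued random variables. -/
lemma lintegral_mul_condLExp [IsFiniteMeasure P] (hm : m ≤ mΩ) {h X : Ω → ℝ≥0∞}
    (hh : Measurable[m] h) (hX : AEMeasurable X P) :
    ∫⁻ ω, h ω * condLExp m P X ω ∂P = ∫⁻ ω, h ω * X ω ∂P := by
  have e : (P.withDensity X).trim hm = (P.withDensity (condLExp m P X)).trim hm := by
    refine @Measure.ext _ m _ _ fun s hs => ?_
    rw [trim_measurableSet_eq hm hs, trim_measurableSet_eq hm hs, withDensity_apply _ (hm s hs),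
      withDensity_apply _ (hm s hs), setLIntegral_condLExp hm P X hs]
  have h1 : ∀ X : Ω → ℝ≥0∞, AEMeasurable X P →
      ∫⁻ ω, h ω * X ω ∂P = ∫⁻ ω, h ω ∂((P.withDensity X).trim hm) := fun X hX => by
    rw [lintegral_trim hm hh, lintegral_withDensity_eq_lintegral_mul₀ hX
      (hh.mono hm le_rfl).aemeasurable]
    refine lintegral_congr fun ω => ?_
    rw [Pi.mul_apply, mul_comm]
  rw [h1 X hX, h1 _ (measurable_condLExp' m P X).aemeasurable, e]

end Weights

section CondNorm

variable {T : ℝ} {Ω : Type*} {mΩ : MeasurableSpace Ω} {P : Measure Ω} [IsProbabilityMeasure P]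
  {F : Filtration (TimeInterval T) mΩ} {q : ℝ} {r : ℝ≥0∞} {s t : TimeInterval T}

omit [IsProbabilityMeasure P] in
lemma lintegral_weighted {h : Ω → ℝ≥0} (hh : Measurable h) {f : Ω → ℝ≥0∞}
    (hf : AEMeasurable f P) : ∫⁻ ω, f ω ∂(weighted P h) = ∫⁻ ω, h ω * f ω ∂P :=
  lintegral_withDensity_eq_lintegral_mul₀ hh.coe_nnreal_ennreal.aemeasurable hf

lemma IsWeight.eLpNorm_le_condNorm {h : Ω → ℝ≥0} (hq : 2 ≤ q) (hh : IsWeight (F s) P r h)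
    {f : Ω → ℝ≥0∞} (hf : AEMeasurable f P) :
    eLpNorm f (ENNReal.ofReal q) (weighted P h) ≤ condNorm F P q r s f := by
  have hq0 : 0 < q := by linarith
  have hm : Measurable h := hh.measurable.mono (F.le s) le_rfl
  rw [eLpNorm_eq_lintegral_ennreal hq0, condNorm,
    lintegral_weighted hm (hf.pow_const q),
    ← lintegral_mul_condLExp (F.le s) hh.measurable.coe_nnreal_ennreal (hf.pow_const q)]
  exact ENNReal.rpow_le_rpow (hh.dual _ (measurable_condLExp' _ _ _)) (by positivity)

lemma condNorm_le_of_forall_weight (hq : 2 ≤ q) (hr : 1 ≤ r) {f : Ω → ℝ≥0∞} (hf : AEMeasurable f P)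
    {K : ℝ≥0∞} (hK : ∀ h, IsWeight (F s) P r h →
      eLpNorm f (ENNReal.ofReal q) (weighted P h) ≤ K) :
    condNorm F P q r s f ≤ K := by
  have hq0 : 0 < q := by linarith
  rw [condNorm, one_div, ENNReal.rpow_inv_le_iff hq0]
  refine eLpNorm_le_of_forall_weight hr (F.le s) (measurable_condLExp _ _ _) fun h hh => ?_
  have hm : Measurable h := hh.measurable.mono (F.le s) le_rfl
  rw [lintegral_mul_condLExp (F.le s) hh.measurable.coe_nnreal_ennreal (hf.pow_const q),
    ← lintegral_weighted hm (hf.pow_const q), ← eLpNorm_rpow_ennreal hq0]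
  exact ENNReal.rpow_le_rpow (hK h hh) hq0.le

lemma condNorm_mono_time (hq : 2 ≤ q) (hr : 1 ≤ r) (hst : s ≤ t) {f : Ω → ℝ≥0∞}
    (hf : AEMeasurable f P) : condNorm F P q r s f ≤ condNorm F P q r t f :=
  condNorm_le_of_forall_weight hq hr hf fun _ hh =>
    (hh.mono (F.mono hst)).eLpNorm_le_condNorm hq hf

omit [IsProbabilityMeasure P] in
lemma condNorm_mono_ae (hq : 2 ≤ q) {f g : Ω → ℝ≥0∞} (hfg : f ≤ᵐ[P] g) :
    condNorm F P q r s f ≤ condNorm F P q r s g := by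
  refine ENNReal.rpow_le_rpow (eLpNorm_mono_enorm_ae ?_) (by positivity)
  have h := condLExp_mono (mΩ := F s) (P := P) (X := fun ω => f ω ^ q) (Y := fun ω => g ω ^ q)
    (by filter_upwards [hfg] with ω hω using ENNReal.rpow_le_rpow hω (by linarith))
  filter_upwards [h] with ω hω
  simpa using hω

omit [IsProbabilityMeasure P] in
lemma condNorm_mono (hq : 2 ≤ q) {f g : Ω → ℝ≥0∞} (hfg : ∀ ω, f ω ≤ g ω) :
    condNorm F P q r s f ≤ condNorm F P q r s g :=
  condNorm_mono_ae hq (Eventually.of_forall hfg)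

lemma condNorm_add_le (hq : 2 ≤ q) (hr : 1 ≤ r) {f g : Ω → ℝ≥0∞} (hf : AEMeasurable f P)
    (hg : AEMeasurable g P) :
    condNorm F P q r s (fun ω => f ω + g ω) ≤ condNorm F P q r s f + condNorm F P q r s g := by
  refine condNorm_le_of_forall_weight hq hr (hf.add hg) fun h hh => ?_
  have hf' : AEStronglyMeasurable f (weighted P h) := (hf.mono_ac weighted_ac).aestronglyMeasurable
  have hg' : AEStronglyMeasurable g (weighted P h) := (hg.mono_ac weighted_ac).aestronglyMeasurable
  exact (eLpNorm_add_le hf' hg' (one_le_ofReal hq)).trans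
    (add_le_add (hh.eLpNorm_le_condNorm hq hf) (hh.eLpNorm_le_condNorm hq hg))

omit [IsProbabilityMeasure P] in
lemma condNorm_zero (hq : 2 ≤ q) : condNorm F P q r s (fun _ => 0) = 0 := by
  have hq0 : 0 < q := by linarith
  have : (fun _ : Ω => (0 : ℝ≥0∞) ^ q) = 0 := by
    funext ω; simp [ENNReal.zero_rpow_of_pos hq0]
  rw [condNorm, this, condLExp_zero, eLpNorm_zero]
  exact ENNReal.zero_rpow_of_pos (by positivity)

lemma condNorm_sum_le (hq : 2 ≤ q) (hr : 1 ≤ r) {ι : Type*} (S : Finset ι) {f : ι → Ω → ℝ≥0∞}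
    (hf : ∀ i ∈ S, AEMeasurable (f i) P) :
    condNorm F P q r s (fun ω => ∑ i ∈ S, f i ω) ≤ ∑ i ∈ S, condNorm F P q r s (f i) := by
  classical
  induction S using Finset.induction_on with
  | empty => simp [condNorm_zero hq]
  | insert i S hi ih =>
    simp only [Finset.sum_insert hi]
    refine (condNorm_add_le hq hr (hf i (Finset.mem_insert_self i S))
      (Finset.aemeasurable_fun_sum _ fun j hj => hf j (Finset.mem_insert_of_mem hj))).trans ?_
    gcongr
    exact ih fun j hj => hf j (Finset.mem_insert_of_mem hj)

variable {V : Type*} [NormedAddCommGroup V]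

lemma eLpNorm_le_condNorm (hq : 2 ≤ q) (hr : 1 ≤ r) {f : Ω → V} (hf : AEStronglyMeasurable f P) :
    eLpNorm f (ENNReal.ofReal q) P ≤ condNorm F P q r s fun ω => ‖f ω‖ₑ := by
  have h := (isWeight_one (m := F s) (P := P) hr).eLpNorm_le_condNorm hq hf.enorm
  rwa [weighted_one, eLpNorm_enorm] at h

/-- For an `F_s`-measurable random variable, `‖·‖_{q,r,s}` is the norm of `L^{qr}`. -/
lemma eLpNorm_eq_condNorm (hq : 2 ≤ q) {f : Ω → V} (hf : StronglyMeasurable[F s] f) :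
    eLpNorm f (ENNReal.ofReal q * r) P = condNorm F P q r s fun ω => ‖f ω‖ₑ := by
  have hq0 : 0 < q := by linarith
  have hm : Measurable[F s] fun ω => ‖f ω‖ₑ ^ q := hf.enorm.pow_const q
  rw [condNorm, condLExp_eq_self (F.le s) P hm, eLpNorm_enorm_rpow f hq0, ← ENNReal.rpow_mul,
    mul_one_div_cancel hq0.ne', ENNReal.rpow_one, mul_comm]

variable [NormedSpace ℝ V] [CompleteSpace V]

lemma eLpNorm_condExp_le_condNorm (hq : 2 ≤ q) (hr : 1 ≤ r) {f : Ω → V}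
    (hf : MemLp f (ENNReal.ofReal q) P) :
    eLpNorm (P[f | F s]) (ENNReal.ofReal q * r) P ≤ condNorm F P q r s fun ω => ‖f ω‖ₑ := by
  have hq1 := one_le_ofReal hq
  rw [eLpNorm_eq_condNorm hq stronglyMeasurable_condExp]
  refine condNorm_le_of_forall_weight hq hr (hf.condExp hq1).1.enorm fun h hh => ?_
  have := hh.isFiniteMeasure
  rw [eLpNorm_enorm, eLpNorm_congr_ae (hh.condExp_ae_eq (F.le s) (hf.integrable hq1))]
  refine (eLpNorm_condExp_le_eLpNorm _ hq1).trans ?_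
  rw [← eLpNorm_enorm]
  exact hh.eLpNorm_le_condNorm hq hf.1.enorm

/-- Under a weight for `F_s`, the `L^q` norm of a conditional expectation given `F_t`, `s ≤ t`, is
bounded by the `L^{qr}` norm. -/
lemma IsWeight.eLpNorm_condExp_le {h : Ω → ℝ≥0} (hq : 2 ≤ q) (hh : IsWeight (F s) P r h)
    (hst : s ≤ t) {f : Ω → V} (hf : MemLp f (ENNReal.ofReal q) P) :
    eLpNorm ((weighted P h)[f | F t]) (ENNReal.ofReal q) (weighted P h) ≤
      eLpNorm (P[f | F t]) (ENNReal.ofReal q * r) P := by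
  have hq1 := one_le_ofReal hq
  have hh' := hh.mono (F.mono hst)
  rw [← eLpNorm_congr_ae (hh'.condExp_ae_eq (F.le t) (hf.integrable hq1)),
    eLpNorm_eq_condNorm hq stronglyMeasurable_condExp, ← eLpNorm_enorm]
  exact hh'.eLpNorm_le_condNorm hq (hf.condExp hq1).1.enorm

end CondNorm

/-! ### Partitions and variation -/

section Sequences

variable {T : ℝ} {s t : TimeInterval T}

/-- A non-decreasing sequence of times that starts at `s` and is equal to `t` from the index `n` on:
a partition of `[s, t]` with at most `n` intervals, where repetitions are allowed. -/
structure IsTimeSeq (s t : TimeInterval T) (u : ℕ → TimeInterval T) (n : ℕ) : Prop where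
  mono : Monotone u
  zero : u 0 = s
  last : ∀ k, n ≤ k → u k = t

/-- The sum of `A` over consecutive members of a sequence of times. -/
def seqSum {M : Type*} [AddCommMonoid M] (A : TimeInterval T → TimeInterval T → M)
    (u : ℕ → TimeInterval T) (n : ℕ) : M :=
  ∑ k ∈ Finset.range n, A (u k) (u (k + 1))

namespace IsTimeSeq

variable {u : ℕ → TimeInterval T} {n : ℕ}

lemma mem (h : IsTimeSeq s t u n) (k : ℕ) : s ≤ u k ∧ u k ≤ t := by
  refine ⟨h.zero ▸ h.mono (Nat.zero_le k), ?_⟩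
  rw [← h.last (max n k) (le_max_left _ _)]
  exact h.mono (le_max_right _ _)

lemma min_right (h : IsTimeSeq s t u n) {τ : TimeInterval T} (hs : s ≤ τ) (ht : τ ≤ t) :
    IsTimeSeq s τ (fun k => min (u k) τ) n :=
  ⟨fun _ _ hij => min_le_min (h.mono hij) le_rfl, by simp [h.zero, hs],
    fun k hk => by simp [h.last k hk, ht]⟩

lemma max_left (h : IsTimeSeq s t u n) {τ : TimeInterval T} (hs : s ≤ τ) (ht : τ ≤ t) :
    IsTimeSeq τ t (fun k => max (u k) τ) n :=
  ⟨fun _ _ hij => max_le_max (h.mono hij) le_rfl, by simp [h.zero, hs],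
    fun k hk => by simp [h.last k hk, ht]⟩

lemma gap_min {δ : ℝ} (hδ : 0 < δ) (hu : ∀ k, (u (k + 1) : ℝ) - u k < δ) (τ : TimeInterval T)
    (k : ℕ) : ((min (u (k + 1)) τ : TimeInterval T) : ℝ) - (min (u k) τ : TimeInterval T) < δ := by
  have h1 := hu k
  rcases le_total (u (k + 1)) τ with h2 | h2 <;> rcases le_total (u k) τ with h3 | h3 <;>
    simp only [h2, h3, min_eq_left, min_eq_right]
  · exact h1
  · have : (u (k + 1) : ℝ) ≤ τ := h2
    linarith
  · have : (τ : ℝ) ≤ u (k + 1) := h2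
    linarith
  · linarith

lemma gap_max {δ : ℝ} (hδ : 0 < δ) (hu : ∀ k, (u (k + 1) : ℝ) - u k < δ) (τ : TimeInterval T)
    (k : ℕ) : ((max (u (k + 1)) τ : TimeInterval T) : ℝ) - (max (u k) τ : TimeInterval T) < δ := by
  have h1 := hu k
  rcases le_total (u (k + 1)) τ with h2 | h2 <;> rcases le_total (u k) τ with h3 | h3 <;>
    simp only [h2, h3, max_eq_left, max_eq_right]
  · linarith
  · have : (u (k + 1) : ℝ) ≤ τ := h2
    have : (τ : ℝ) ≤ u k := h3
    linarith
  · have : (u k : ℝ) ≤ τ := h3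
    linarith
  · exact h1

end IsTimeSeq

namespace TimePartition

/-- The points of a partition as an infinite sequence. -/
def seq (π : TimePartition s t) (k : ℕ) : TimeInterval T :=
  π.time ⟨min k π.n, Nat.lt_succ_of_le (min_le_right _ _)⟩

lemma isTimeSeq_seq (π : TimePartition s t) : IsTimeSeq s t π.seq π.n := by
  refine ⟨fun i j hij => π.strictMono_time.monotone ?_, ?_, fun k hk => ?_⟩
  · exact Fin.mk_le_mk.2 (min_le_min hij le_rfl)
  · refine Eq.trans ?_ π.time_zero
    simp [seq]
  · refine Eq.trans ?_ π.time_last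
    unfold seq; congr 1; ext; simp [hk]

lemma seq_castSucc (π : TimePartition s t) (i : Fin π.n) : π.seq i = π.time i.castSucc := by
  unfold seq; congr 1; ext; simp

lemma seq_succ (π : TimePartition s t) (i : Fin π.n) : π.seq (i + 1) = π.time i.succ := by
  unfold seq; congr 1; ext; simp

lemma seq_lt (π : TimePartition s t) {k : ℕ} (hk : k < π.n) : π.seq k < π.seq (k + 1) := by
  have h1 := π.seq_castSucc ⟨k, hk⟩
  have h2 := π.seq_succ ⟨k, hk⟩
  simp only at h1 h2
  rw [h1, h2]
  exact π.strictMono_time Fin.castSucc_lt_succ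

lemma sum_eq_seqSum {M : Type*} [AddCommMonoid M] (π : TimePartition s t)
    (A : TimeInterval T → TimeInterval T → M) : π.sum A = seqSum A π.seq π.n := by
  rw [TimePartition.sum, seqSum, Finset.sum_range]
  refine Finset.sum_congr rfl fun i _ => ?_
  rw [π.seq_castSucc, π.seq_succ]

lemma seq_gap_le (π : TimePartition s t) (k : ℕ) :
    (π.seq (k + 1) : ℝ) - π.seq k ≤ max π.mesh 0 := by
  rcases Nat.lt_or_ge k π.n with hk | hk
  · refine le_trans ?_ (le_max_left _ _)
    have h1 := π.seq_castSucc ⟨k, hk⟩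
    have h2 := π.seq_succ ⟨k, hk⟩
    simp only at h1 h2
    rw [h1, h2]
    exact le_ciSup (f := fun i : Fin π.n => (π.time i.succ : ℝ) - (π.time i.castSucc : ℝ))
      (Set.finite_range _).bddAbove ⟨k, hk⟩
  · rw [π.isTimeSeq_seq.last k hk, π.isTimeSeq_seq.last (k + 1) (by omega)]
    simp

lemma mesh_nonneg (π : TimePartition s t) : 0 ≤ π.mesh :=
  Real.iSup_nonneg fun _ =>
    sub_nonneg.2 (Subtype.coe_le_coe.2 (π.strictMono_time Fin.castSucc_lt_succ).le)

/-- The partition given by a strictly increasing sequence of times. -/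
def ofSeq (u : ℕ → TimeInterval T) (n : ℕ) (h0 : u 0 = s) (hn : u n = t)
    (hu : ∀ k < n, u k < u (k + 1)) : TimePartition s t where
  n := n
  time := fun i => u i
  strictMono_time := Fin.strictMono_iff_lt_succ.2 fun i => hu i i.2
  time_zero := h0
  time_last := hn

lemma sum_ofSeq {M : Type*} [AddCommMonoid M] (A : TimeInterval T → TimeInterval T → M)
    (u : ℕ → TimeInterval T) (n : ℕ) (h0 : u 0 = s) (hn : u n = t)
    (hu : ∀ k < n, u k < u (k + 1)) : (ofSeq u n h0 hn hu).sum A = seqSum A u n := by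
  rw [TimePartition.sum, seqSum, Finset.sum_range]
  rfl

lemma mesh_ofSeq_le {u : ℕ → TimeInterval T} {n : ℕ} {h0 : u 0 = s} {hn : u n = t}
    {hu : ∀ k < n, u k < u (k + 1)} {δ : ℝ} (hδ : 0 ≤ δ)
    (h : ∀ k < n, (u (k + 1) : ℝ) - u k ≤ δ) : (ofSeq u n h0 hn hu).mesh ≤ δ :=
  Real.iSup_le (fun i => h i i.2) hδ

end TimePartition

instance {T : ℝ} : DenselyOrdered (TimeInterval T) := inferInstance

lemma nhdsGT_neBot_of_lt {a b : TimeInterval T} (h : a < b) : (𝓝[>] a).NeBot :=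
  nhdsGT_neBot_of_exists_gt ⟨b, h⟩

lemma nhdsLT_neBot_of_lt {a b : TimeInterval T} (h : a < b) : (𝓝[<] b).NeBot :=
  nhdsLT_neBot_of_exists_lt ⟨a, h⟩

lemma eventually_gt_of_lt {a b : TimeInterval T} (h : a < b) :
    ∀ᶠ v in 𝓝[>] a, a < v ∧ v < b := Ioo_mem_nhdsGT h

lemma eventually_lt_of_lt {a b : TimeInterval T} (h : a < b) :
    ∀ᶠ v in 𝓝[<] b, a < v ∧ v < b := Ioo_mem_nhdsLT h

lemma eventually_gt_dist (a : TimeInterval T) {δ : ℝ} (hδ : 0 < δ) :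
    ∀ᶠ v : TimeInterval T in 𝓝[>] a, (v : ℝ) - a < δ := by
  have h : Tendsto (fun v : TimeInterval T => (v : ℝ) - a) (𝓝 a) (𝓝 ((a : ℝ) - a)) := by
    apply Continuous.tendsto; fun_prop
  rw [sub_self] at h
  exact (h.mono_left nhdsWithin_le_nhds).eventually (gt_mem_nhds hδ)

lemma eventually_lt_dist (a : TimeInterval T) {δ : ℝ} (hδ : 0 < δ) :
    ∀ᶠ v : TimeInterval T in 𝓝[<] a, (a : ℝ) - v < δ := by
  have h : Tendsto (fun v : TimeInterval T => (a : ℝ) - v) (𝓝 a) (𝓝 ((a : ℝ) - a)) := by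
    apply Continuous.tendsto; fun_prop
  rw [sub_self] at h
  exact (h.mono_left nhdsWithin_le_nhds).eventually (gt_mem_nhds hδ)

lemma exists_dist_of_eventually_gt {a : TimeInterval T} {p : TimeInterval T → Prop}
    (h : ∀ᶠ v in 𝓝[>] a, p v) : ∃ δ > 0, ∀ v, a < v → (v : ℝ) - a < δ → p v := by
  rw [eventually_nhdsWithin_iff, Metric.eventually_nhds_iff] at h
  obtain ⟨δ, hδ, h⟩ := h
  refine ⟨δ, hδ, fun v hv hvd => h ?_ hv⟩
  rw [Subtype.dist_eq, Real.dist_eq, abs_of_nonneg (sub_nonneg.2 (Subtype.coe_le_coe.2 hv.le))]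
  exact hvd

/-- A property of pairs of times that holds locally to the left and to the right of every time can
be chained from `s` to `t`. -/
lemma exists_timeSeq {Q : TimeInterval T → TimeInterval T → Prop} (hst : s ≤ t)
    (hl : ∀ τ, s < τ → τ ≤ t → ∀ᶠ u in 𝓝[<] τ, Q u τ)
    (hr : ∀ τ, s ≤ τ → τ < t → ∀ᶠ v in 𝓝[>] τ, Q τ v) :
    ∃ u n, IsTimeSeq s t u n ∧ ∀ k < n, u k < u (k + 1) ∧ Q (u k) (u (k + 1)) := by
  set S : Set (TimeInterval T) := {x | ∃ u n, IsTimeSeq s x u n ∧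
    ∀ k < n, u k < u (k + 1) ∧ Q (u k) (u (k + 1))} with hS
  have hstep : ∀ a b, a ∈ S → a < b → Q a b → b ∈ S := by
    rintro a b ⟨u, n, hu, huQ⟩ hab hQ
    refine ⟨fun k => if k ≤ n then u k else b, n + 1, ⟨?_, ?_, ?_⟩, ?_⟩
    · refine monotone_nat_of_le_succ fun k => ?_
      by_cases h1 : k + 1 ≤ n
      · simp [h1, (by omega : k ≤ n), hu.mono k.le_succ]
      · by_cases h2 : k ≤ n
        · simp [h1, h2, ((hu.mem k).2.trans hab.le)]
        · simp [h1, h2]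
    · simp [hu.zero]
    · intro k hk
      exact if_neg (by omega)
    · intro k hk
      rcases Nat.lt_or_ge k n with h1 | h1
      · simpa [h1.le, Nat.succ_le_of_lt h1] using huQ k h1
      · obtain rfl : k = n := by omega
        have := hu.last k le_rfl
        simp [this, hab, hQ]
  have hsS : s ∈ S := ⟨fun _ => s, 0, ⟨monotone_const, rfl, fun _ _ => rfl⟩, by simp⟩
  obtain ⟨τ, hτ⟩ : ∃ τ, IsLUB (S ∩ Set.Iic t) τ := by
    have hne : ((fun x : TimeInterval T => (x : ℝ)) '' (S ∩ Set.Iic t)).Nonempty :=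
      ⟨s, s, ⟨hsS, hst⟩, rfl⟩
    have hbd : BddAbove ((fun x : TimeInterval T => (x : ℝ)) '' (S ∩ Set.Iic t)) := by
      refine ⟨t, ?_⟩
      rintro _ ⟨x, hx, rfl⟩
      exact hx.2
    have h := isLUB_csSup hne hbd
    have h1 : (s : ℝ) ≤ sSup ((fun x : TimeInterval T => (x : ℝ)) '' (S ∩ Set.Iic t)) :=
      h.1 ⟨s, ⟨hsS, hst⟩, rfl⟩
    have h2 : sSup ((fun x : TimeInterval T => (x : ℝ)) '' (S ∩ Set.Iic t)) ≤ t := by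
      refine h.2 ?_
      rintro _ ⟨x, hx, rfl⟩
      exact hx.2
    refine ⟨⟨_, s.2.1.trans h1, h2.trans t.2.2⟩, fun x hx => h.1 ⟨x, hx, rfl⟩, fun y hy => ?_⟩
    refine h.2 ?_
    rintro _ ⟨x, hx, rfl⟩
    exact hy hx
  have hsτ : s ≤ τ := hτ.1 ⟨hsS, hst⟩
  have hτt : τ ≤ t := hτ.2 fun x hx => hx.2
  have hτS : τ ∈ S := by
    by_contra hcon
    have hlt : s < τ := lt_of_le_of_ne hsτ fun h => hcon (h ▸ hsS)
    obtain ⟨a, ha, hQ⟩ := (mem_nhdsLT_iff_exists_Ioo_subset' hlt).1 (hl τ hlt hτt)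
    obtain ⟨x, hx, hax, hxτ⟩ := hτ.exists_between ha
    have hne : x ≠ τ := fun h => hcon (h ▸ hx.1)
    exact hcon (hstep x τ hx.1 (lt_of_le_of_ne hxτ hne) (hQ ⟨hax, lt_of_le_of_ne hxτ hne⟩))
  rcases hτt.eq_or_lt with rfl | hlt
  · exact hτS
  · exfalso
    have := nhdsGT_neBot_of_lt hlt
    obtain ⟨v, hQ, hv1, hv2⟩ := ((hr τ hsτ hlt).and (eventually_gt_of_lt hlt)).exists
    exact absurd (hτ.1 ⟨hstep τ v hτS hv1 hQ, hv2.le⟩) (not_le.2 hv1)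

lemma exists_timePartition_mesh_lt (hst : s ≤ t) {δ : ℝ} (hδ : 0 < δ) :
    ∃ π : TimePartition s t, π.mesh < δ := by
  obtain ⟨u, n, hu, hQ⟩ := exists_timeSeq (Q := fun a b => (b : ℝ) - a < δ / 2) hst
    (fun τ _ _ => eventually_lt_dist τ (half_pos hδ))
    (fun τ _ _ => eventually_gt_dist τ (half_pos hδ))
  refine ⟨TimePartition.ofSeq u n hu.zero (hu.last n le_rfl) fun k hk => (hQ k hk).1, ?_⟩
  refine (TimePartition.mesh_ofSeq_le (half_pos hδ).le fun k hk => (hQ k hk).2.le).trans_lt ?_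
  linarith

lemma eventually_meshToZero_iff {p : TimePartition s t → Prop} :
    (∀ᶠ π in meshToZero s t, p π) ↔ ∃ δ > 0, ∀ π : TimePartition s t, π.mesh < δ → p π := by
  rw [meshToZero, eventually_comap]
  constructor
  · intro h
    obtain ⟨δ, hδ, h⟩ := Metric.eventually_nhds_iff.1 h
    refine ⟨δ, hδ, fun π hπ => h ?_ π rfl⟩
    rwa [Real.dist_eq, sub_zero, abs_of_nonneg π.mesh_nonneg]
  · rintro ⟨δ, hδ, h⟩
    filter_upwards [gt_mem_nhds hδ] with x hx π hπ
    exact h π (hπ ▸ hx)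

lemma meshToZero_neBot (hst : s ≤ t) : (meshToZero s t).NeBot := by
  rw [← frequently_true_iff_neBot]
  intro h
  obtain ⟨δ, hδ, h⟩ := eventually_meshToZero_iff.1 h
  obtain ⟨π, hπ⟩ := exists_timePartition_mesh_lt hst hδ
  exact h π hπ trivial

end Sequences

section Variation

variable {T : ℝ} {p : ℝ} {g : TimeInterval T → TimeInterval T → ℝ≥0∞} {s u t v : TimeInterval T}

lemma nonempty_timePartition (hst : s ≤ t) : Nonempty (TimePartition s t) :=
  ⟨(exists_timePartition_mesh_lt hst one_pos).choose⟩

lemma pVar_rpow (hp : 0 < p) : pVar p g s t ^ p = ⨆ π : TimePartition s t,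
    π.sum fun u v => g u v ^ p := by
  rw [pVar, ← ENNReal.rpow_mul, one_div_mul_cancel hp.ne', ENNReal.rpow_one]

lemma seqSum_le_pVar_rpow (hp : 0 < p) {x : ℕ → TimeInterval T} {n : ℕ} (h0 : x 0 = s)
    (hn : x n = t) (hx : ∀ k < n, x k < x (k + 1)) :
    seqSum (fun u v => g u v ^ p) x n ≤ pVar p g s t ^ p := by
  rw [pVar_rpow hp, ← TimePartition.sum_ofSeq _ x n h0 hn hx]
  exact le_iSup (fun π : TimePartition s t => π.sum fun u v => g u v ^ p) _

lemma pVar_rpow_add_le (hp : 0 < p) (hsu : s ≤ u) (hut : u ≤ t) :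
    pVar p g s u ^ p + pVar p g u t ^ p ≤ pVar p g s t ^ p := by
  have := nonempty_timePartition hsu
  have := nonempty_timePartition hut
  rw [pVar_rpow (s := s) (t := u) hp, pVar_rpow (s := u) (t := t) hp]
  refine ENNReal.iSup_add_iSup_le fun π₁ π₂ => ?_
  have h1 := π₁.isTimeSeq_seq
  have h2 := π₂.isTimeSeq_seq
  set x : ℕ → TimeInterval T := fun k => if k < π₁.n then π₁.seq k else π₂.seq (k - π₁.n) with hx
  have e1 : ∀ k ≤ π₁.n, x k = π₁.seq k := by
    intro k hk
    rcases hk.eq_or_lt with rfl | hk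
    · simp [hx, h2.zero, h1.last _ le_rfl]
    · simp [hx, hk]
  have e2 : ∀ k, x (π₁.n + k) = π₂.seq k := fun k => by simp [hx]
  have hsum : seqSum (fun u v => g u v ^ p) x (π₁.n + π₂.n) =
      seqSum (fun u v => g u v ^ p) π₁.seq π₁.n + seqSum (fun u v => g u v ^ p) π₂.seq π₂.n := by
    unfold seqSum
    rw [Finset.sum_range_add]
    congr 1
    · refine Finset.sum_congr rfl fun k hk => ?_
      rw [Finset.mem_range] at hk
      rw [e1 k hk.le, e1 (k + 1) hk]
    · refine Finset.sum_congr rfl fun k _ => ?_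
      rw [e2, add_assoc, e2]
  rw [π₁.sum_eq_seqSum, π₂.sum_eq_seqSum, ← hsum]
  refine seqSum_le_pVar_rpow hp ?_ ?_ fun k hk => ?_
  · rw [e1 0 (Nat.zero_le _), h1.zero]
  · rw [e2, h2.last _ le_rfl]
  · rcases Nat.lt_or_ge k π₁.n with h | h
    · rw [e1 k h.le, e1 (k + 1) h]; exact π₁.seq_lt h
    · obtain ⟨j, rfl⟩ := Nat.exists_eq_add_of_le h
      rw [add_assoc, e2, e2]; exact π₂.seq_lt (by omega)

lemma pVar_mono (hp : 0 < p) (hsu : s ≤ u) (huv : u ≤ v) (hvt : v ≤ t) :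
    pVar p g u v ≤ pVar p g s t := by
  rw [← ENNReal.rpow_le_rpow_iff hp]
  calc pVar p g u v ^ p ≤ pVar p g s u ^ p + pVar p g u v ^ p := le_add_self
    _ ≤ pVar p g s v ^ p := pVar_rpow_add_le hp hsu huv
    _ ≤ pVar p g s v ^ p + pVar p g v t ^ p := le_self_add
    _ ≤ _ := pVar_rpow_add_le hp (hsu.trans huv) hvt

lemma le_pVar (hp : 0 < p) (hg : ∀ s, g s s = 0) (hst : s ≤ t) : g s t ≤ pVar p g s t := by
  rcases hst.eq_or_lt with rfl | hlt
  · rw [hg]; exact zero_le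
  rw [← ENNReal.rpow_le_rpow_iff hp]
  refine le_trans ?_ (seqSum_le_pVar_rpow (x := fun k => if k = 0 then s else t) (n := 1) hp
    (by simp) (by simp) fun k hk => ?_)
  · simp [seqSum]
  · obtain rfl : k = 0 := by omega
    simpa using hlt

lemma pVarLeft_self : pVarLeft p g s s = 0 := by
  rw [pVarLeft, ENNReal.iSup_eq_zero]
  intro u
  rw [ENNReal.iSup_eq_zero]
  exact fun h => absurd (h.1.trans_lt h.2) (lt_irrefl _)

lemma pVar_le_pVarLeft (hsu : s ≤ u) (hut : u < t) : pVar p g s u ≤ pVarLeft p g s t :=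
  le_iSup₂ (f := fun (u : TimeInterval T) (_ : s ≤ u ∧ u < t) => pVar p g s u) u ⟨hsu, hut⟩

lemma pVarLeft_le_pVar (hp : 0 < p) : pVarLeft p g s t ≤ pVar p g s t :=
  iSup₂_le fun _ hu => pVar_mono hp le_rfl hu.1 hu.2.le

lemma pVar_rpow_add_pVarLeft_le (hp : 0 < p) (hsu : s ≤ u) (hut : u < t) :
    pVar p g s u ^ p + pVarLeft p g u t ^ p ≤ pVarLeft p g s t ^ p := by
  have h1 : pVar p g s u ^ p ≤ pVarLeft p g s t ^ p :=
    ENNReal.rpow_le_rpow (pVar_le_pVarLeft hsu hut) hp.le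
  rcases eq_or_ne (pVar p g s u ^ p) ∞ with h | h
  · have h2 : pVarLeft p g s t ^ p = ∞ := top_le_iff.1 (h ▸ h1)
    rw [h2]; exact le_top
  calc pVar p g s u ^ p + pVarLeft p g u t ^ p
      ≤ pVar p g s u ^ p + (pVarLeft p g s t ^ p - pVar p g s u ^ p) := by
        gcongr
        rw [← ENNReal.le_rpow_inv_iff hp]
        refine iSup₂_le fun y hy => ?_
        rw [ENNReal.le_rpow_inv_iff hp]
        refine ENNReal.le_sub_of_add_le_left h ?_
        refine (pVar_rpow_add_le hp hsu hy.1).trans ?_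
        exact ENNReal.rpow_le_rpow (pVar_le_pVarLeft (hsu.trans hy.1) hy.2) hp.le
    _ = _ := add_tsub_cancel_of_le h1

lemma pVarLeft_rpow_add_le (hp : 0 < p) (hsu : s ≤ u) (hut : u ≤ t) :
    pVarLeft p g s u ^ p + pVarLeft p g u t ^ p ≤ pVarLeft p g s t ^ p := by
  rcases hut.eq_or_lt with rfl | hlt
  · rw [pVarLeft_self, ENNReal.zero_rpow_of_pos hp, add_zero]
  · refine le_trans ?_ (pVar_rpow_add_pVarLeft_le hp hsu hlt)
    gcongr
    exact pVarLeft_le_pVar hp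

lemma le_pVarLeft (hp : 0 < p) (hg : ∀ s, g s s = 0) (hsu : s ≤ u) (hut : u < t) :
    g s u ≤ pVarLeft p g s t := (le_pVar hp hg hsu).trans (pVar_le_pVarLeft hsu hut)

lemma tendsto_zero_of_rpow_tendsto {ι : Type*} {l : Filter ι} {f : ι → ℝ≥0∞} (hp : 0 < p)
    (h : Tendsto (fun i => f i ^ p) l (𝓝 0)) : Tendsto f l (𝓝 0) := by
  have h1 := h.ennrpow_const p⁻¹
  rw [ENNReal.zero_rpow_of_pos (inv_pos.2 hp)] at h1
  refine h1.congr fun i => ?_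
  rw [← ENNReal.rpow_mul, mul_inv_cancel₀ hp.ne', ENNReal.rpow_one]

/-- If `a + b i ≤ M < ∞` where `a i` gets arbitrarily close to `M`, then `b` tends to `0`. -/
lemma tendsto_zero_of_add_le {ι : Type*} {l : Filter ι} {a b : ι → ℝ≥0∞} {M : ℝ≥0∞} (hM : M ≠ ∞)
    (hab : ∀ᶠ i in l, a i + b i ≤ M) (ha : ∀ c < M, ∀ᶠ i in l, c ≤ a i) :
    Tendsto b l (𝓝 0) := by
  rw [ENNReal.tendsto_nhds_zero]
  intro ε hε
  rcases eq_or_ne M 0 with rfl | hM0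
  · filter_upwards [hab] with i hi
    exact (le_add_self.trans hi).trans zero_le
  · filter_upwards [hab, ha (M - ε) (ENNReal.sub_lt_self hM hM0 hε.ne')] with i h1 h2
    have h3 : M - ε ≠ ∞ := (tsub_le_self.trans_lt hM.lt_top).ne
    refine (ENNReal.add_le_add_iff_left h3).1 ?_
    calc M - ε + b i ≤ a i + b i := by gcongr
      _ ≤ M := h1
      _ ≤ M - ε + ε := le_tsub_add

/-- The variation of a function that is right-continuous in its first argument vanishes on short
intervals to the right of `s`. -/
lemma tendsto_pVar_right (hp : 0 < p) (hst : s < t) (hfin : pVar p g s t ≠ ∞)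
    (hg : ∀ v, s < v → Tendsto (fun u => g u v) (𝓝[>] s) (𝓝 (g s v))) :
    Tendsto (fun v => pVar p g s v) (𝓝[>] s) (𝓝 0) := by
  refine tendsto_zero_of_rpow_tendsto hp (tendsto_zero_of_add_le (M := pVar p g s t ^ p)
    (a := fun v => pVar p g v t ^ p) (ENNReal.rpow_ne_top_of_nonneg hp.le hfin) ?_ ?_)
  · filter_upwards [eventually_gt_of_lt hst] with v hv
    rw [add_comm]
    exact pVar_rpow_add_le hp hv.1.le hv.2.le
  · intro c hc
    rw [pVar_rpow hp, lt_iSup_iff] at hc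
    obtain ⟨π, hπ⟩ := hc
    rw [π.sum_eq_seqSum] at hπ
    have hseq := π.isTimeSeq_seq
    obtain ⟨m, hm⟩ : ∃ m, π.n = m + 1 := by
      refine Nat.exists_eq_succ_of_ne_zero fun h0 => ?_
      have := hseq.last 0 h0.le
      rw [hseq.zero] at this
      exact hst.ne this
    have h01 : s < π.seq 1 := by
      have := π.seq_lt (k := 0) (by omega)
      rwa [hseq.zero] at this
    have hcont : Tendsto (fun v => ∑ k ∈ Finset.range m, g (π.seq (k + 1)) (π.seq (k + 1 + 1)) ^ p
        + g v (π.seq 1) ^ p) (𝓝[>] s)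
        (𝓝 (∑ k ∈ Finset.range m, g (π.seq (k + 1)) (π.seq (k + 1 + 1)) ^ p
        + g s (π.seq 1) ^ p)) := ((hg _ h01).ennrpow_const p).const_add _
    rw [seqSum, hm, Finset.sum_range_succ', zero_add, hseq.zero] at hπ
    filter_upwards [hcont.eventually (lt_mem_nhds hπ), eventually_gt_of_lt h01] with v hv1 hv2
    refine hv1.le.trans ?_
    have h := seqSum_le_pVar_rpow (p := p) (g := g) (s := v) (t := t) hp
      (x := fun k => if k = 0 then v else π.seq k) (n := m + 1) (by simp)
      (by simp [hseq.last (m + 1) hm.le]) (fun k hk => by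
        rcases k with _ | k
        · simpa using hv2.2
        · simpa using π.seq_lt (k := k + 1) (by omega))
    rw [seqSum, Finset.sum_range_succ'] at h
    simpa using h

lemma tendsto_pVarLeft (hp : 0 < p) (hst : s < t) (hfin : pVarLeft p g s t ≠ ∞) :
    Tendsto (fun u => pVarLeft p g u t) (𝓝[<] t) (𝓝 0) := by
  refine tendsto_zero_of_rpow_tendsto hp (tendsto_zero_of_add_le (M := pVarLeft p g s t ^ p)
    (a := fun u => pVar p g s u ^ p) (ENNReal.rpow_ne_top_of_nonneg hp.le hfin) ?_ ?_)
  · filter_upwards [eventually_lt_of_lt hst] with u hu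
    exact pVar_rpow_add_pVarLeft_le hp hu.1.le hu.2
  · intro c hc
    rw [← ENNReal.rpow_inv_lt_iff hp, pVarLeft, lt_iSup_iff] at hc
    obtain ⟨y, hc⟩ := hc
    rw [lt_iSup_iff] at hc
    obtain ⟨hy, hc⟩ := hc
    rw [ENNReal.rpow_inv_lt_iff hp] at hc
    filter_upwards [eventually_lt_of_lt hy.2] with u hu
    refine hc.le.trans (ENNReal.rpow_le_rpow ?_ hp.le)
    exact pVar_mono hp le_rfl hy.1 hu.1.le

/-- A product of powers of two controls, with exponents that add up to `1`, is a control. -/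
lemma mul_rpow_add_mul_rpow_le {a b : ℝ} (ha : 0 < a) (hb : 0 < b) (hab : a + b = 1)
    {x₁ x₂ x y₁ y₂ y : ℝ≥0∞} (hx : x₁ + x₂ ≤ x) (hy : y₁ + y₂ ≤ y) :
    x₁ ^ a * y₁ ^ b + x₂ ^ a * y₂ ^ b ≤ x ^ a * y ^ b := by
  have h := ENNReal.inner_le_Lp_mul_Lq (Finset.univ : Finset (Fin 2)) ![x₁ ^ a, x₂ ^ a]
    ![y₁ ^ b, y₂ ^ b] (p := a⁻¹) (q := b⁻¹)
    (Real.holderConjugate_iff.2 ⟨(one_lt_inv₀ ha).2 (by linarith), by simpa using hab⟩)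
  simp only [Fin.sum_univ_two, Matrix.cons_val_zero, Matrix.cons_val_one, one_div, inv_inv,
    ← ENNReal.rpow_mul, mul_inv_cancel₀ ha.ne', mul_inv_cancel₀ hb.ne', ENNReal.rpow_one] at h
  refine h.trans ?_
  gcongr

end Variation

/-! ### Stochastic sewing on a time interval -/

section Splitting

variable {T : ℝ} {Ω E : Type*} [AddCommGroup E] {A : TimeInterval T → TimeInterval T → Ω → E}
  {s t : TimeInterval T}

lemma defect_self_right (hA : ∀ a, A a a = 0) (a c : TimeInterval T) : defect A a c c = 0 := by
  simp [defect, hA]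

lemma seqSum_min_max (hA : ∀ a, A a a = 0) {x : ℕ → TimeInterval T} (hx : Monotone x)
    (m : ℕ) (τ : TimeInterval T) :
    (∃ k < m, x k < τ ∧ τ < x (k + 1) ∧
      seqSum A x m - seqSum A (fun k => min (x k) τ) m - seqSum A (fun k => max (x k) τ) m =
        defect A (x k) τ (x (k + 1))) ∨
      seqSum A x m - seqSum A (fun k => min (x k) τ) m - seqSum A (fun k => max (x k) τ) m = 0 := by
  have e : seqSum A x m - seqSum A (fun k => min (x k) τ) m - seqSum A (fun k => max (x k) τ) m =
      ∑ k ∈ Finset.range m, (A (x k) (x (k + 1)) - A (min (x k) τ) (min (x (k + 1)) τ)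
        - A (max (x k) τ) (max (x (k + 1)) τ)) := by
    simp [seqSum, Finset.sum_sub_distrib]
  have hleft : ∀ k, x (k + 1) ≤ τ → A (x k) (x (k + 1)) - A (min (x k) τ) (min (x (k + 1)) τ)
        - A (max (x k) τ) (max (x (k + 1)) τ) = 0 := fun k hk => by
    have := (hx k.le_succ).trans hk
    simp [hk, this, hA]
  have hright : ∀ k, τ ≤ x k → A (x k) (x (k + 1)) - A (min (x k) τ) (min (x (k + 1)) τ)
        - A (max (x k) τ) (max (x (k + 1)) τ) = 0 := fun k hk => by
    have := hk.trans (hx k.le_succ)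
    simp [hk, this, hA]
  rw [e]
  by_cases h : ∃ k < m, x k < τ ∧ τ < x (k + 1)
  · obtain ⟨k, hkm, h1, h2⟩ := h
    refine Or.inl ⟨k, hkm, h1, h2, ?_⟩
    rw [Finset.sum_eq_single k]
    · simp [defect, h1.le, h2.le]
    · intro j _ hjk
      rcases lt_or_gt_of_ne hjk with hj | hj
      · exact hleft j ((hx (Nat.succ_le_of_lt hj)).trans h1.le)
      · exact hright j (h2.le.trans (hx (Nat.succ_le_of_lt hj)))
    · exact fun hk => absurd (Finset.mem_range.2 hkm) hk
  · refine Or.inr (Finset.sum_eq_zero fun k hk => ?_)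
    rcases le_or_gt (x (k + 1)) τ with h1 | h1
    · exact hleft k h1
    · exact hright k (not_lt.1 fun h2 => h ⟨k, Finset.mem_range.1 hk, h2, h1⟩)

end Splitting

section Structures

variable {T : ℝ} {Ω : Type*} {mΩ : MeasurableSpace Ω}
  {E : Type*} [NormedAddCommGroup E] [NormedSpace ℝ E] [CompleteSpace E]

/-- A two-parameter family on `[s, t]`, the defect of which has a conditional mean in `L^{qr}` that
is controlled by a superadditive `w`. -/
structure HasSmallDriftOn (F : Filtration (TimeInterval T) mΩ) (P : Measure Ω) (q : ℝ) (r : ℝ≥0∞)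
    (α : ℝ) (B : ℝ≥0∞) (w : TimeInterval T → TimeInterval T → ℝ≥0∞)
    (A : TimeInterval T → TimeInterval T → Ω → E) (s t : TimeInterval T) : Prop where
  meas : ∀ a b, StronglyMeasurable[F a] (A a b)
  memLp : ∀ a b, MemLp (A a b) (ENNReal.ofReal q) P
  diag : ∀ a, A a a = 0
  superadd : ∀ a c b, s ≤ a → a ≤ c → c ≤ b → b ≤ t → w a c + w c b ≤ w a b
  le_one : w s t ≤ 1
  drift : ∀ a c b, s ≤ a → a ≤ c → c ≤ b → b ≤ t →
    eLpNorm (P[defect A a c b | F a]) (ENNReal.ofReal q * r) P ≤ B * w a b ^ α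

/-- The assumptions of the stochastic sewing lemma in the norms `‖·‖_{q,r,s}`, for a control that
vanishes on short intervals on either side of a point. The control need not vanish on short
intervals around a point: the last condition compensates for this. -/
structure IsSewableOn (F : Filtration (TimeInterval T) mΩ) (P : Measure Ω) (q : ℝ) (r : ℝ≥0∞)
    (α β : ℝ) (B : ℝ≥0∞) (w : TimeInterval T → TimeInterval T → ℝ≥0∞)
    (A : TimeInterval T → TimeInterval T → Ω → E) (s t : TimeInterval T) : Prop
    extends HasSmallDriftOn F P q r α B w A s t where
  size : ∀ a c b, s ≤ a → a ≤ c → c ≤ b → b ≤ t → ∃ g : Ω → ℝ≥0∞, AEMeasurable g P ∧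
    (∀ m, c ≤ m → m ≤ b → ∀ ω, ‖defect A a c m ω‖ₑ ≤ g ω) ∧
    condNorm F P q r a g ≤ B * w a b ^ β
  small_right : ∀ τ, s ≤ τ → τ < t → Tendsto (fun v => w τ v) (𝓝[>] τ) (𝓝 0)
  small_left : ∀ τ, s < τ → τ ≤ t → Tendsto (fun u => w u τ) (𝓝[<] τ) (𝓝 0)
  defect_small : ∀ τ, s ≤ τ → τ < t → ∀ ε > 0, ∀ᶠ v in 𝓝[>] τ, ∀ a, s ≤ a → a ≤ τ →
    condNorm F P q r a (fun ω => ‖defect A a τ v ω‖ₑ) ≤ ε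

end Structures

section Blocks

variable {T : ℝ} {Ω : Type*} {mΩ : MeasurableSpace Ω} {P : Measure Ω} [IsProbabilityMeasure P]
  {F : Filtration (TimeInterval T) mΩ} {q : ℝ} {r : ℝ≥0∞} {s t : TimeInterval T}
  {E : Type*} [NormedAddCommGroup E] [NormedSpace ℝ E] [CompleteSpace E]
  {H : Type*} [NormedAddCommGroup H] [InnerProductSpace ℝ H] [CompleteSpace H]

/-- The maximal inequality for processes made of blocks, in the norms `‖·‖_{q,r,s}`. -/
lemma condNorm_iSup_blocks_le (hq : 2 ≤ q) (hr : 1 ≤ r) {K : ℝ≥0} (e : E ≃L[ℝ] H)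
    (he : ∀ x, ‖x‖ ≤ ‖e x‖ ∧ ‖e x‖ ≤ K * ‖x‖) {u : ℕ → TimeInterval T} (hu : Monotone u)
    (hs : s ≤ u 0) {Z : ℕ → Ω → E} (hZ : ∀ j, StronglyMeasurable[F (u (j + 1))] (Z j))
    (hZq : ∀ j, MemLp (Z j) (ENNReal.ofReal q) P) {Zs : ℕ → Ω → ℝ≥0∞}
    (hZs : ∀ j, AEMeasurable (Zs j) P) (hle : ∀ j ω, ‖Z j ω‖ₑ ≤ Zs j ω) (n : ℕ) :
    condNorm F P q r s
        (fun ω => ⨆ l ∈ Finset.range n, (‖(∑ j ∈ Finset.range l, Z j) ω‖ₑ + Zs l ω)) ≤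
      (aggConst q K + 1) *
        (∑ j ∈ Finset.range n, condNorm F P q r (u j) (Zs j) ^ 2) ^ (1 / 2 : ℝ)
      + ∑ j ∈ Finset.range n, eLpNorm (P[Z j | F (u j)]) (ENNReal.ofReal q * r) P := by
  have hsu : ∀ j, s ≤ u j := fun j => hs.trans (hu (Nat.zero_le j))
  refine condNorm_le_of_forall_weight hq hr ?_ fun h hh => ?_
  · exact AEMeasurable.biSup _ (Finset.range n).countable_toSet fun l _ =>
      (memLp_finsetSum' (Finset.range l) fun j _ => hZq j).1.enorm.add (hZs l)
  have := hh.isFiniteMeasure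
  refine (eLpNorm_iSup_blocks_le (μ := weighted P h) (G := reindexFiltration F u hu) hq e he hZ
    (fun j => hh.memLp (hZq j)) (fun j => (hZs j).mono_ac weighted_ac) hle n).trans ?_
  gcongr with j hj j hj
  · exact (hh.mono (F.mono (hsu j))).eLpNorm_le_condNorm hq (hZs j)
  · exact hh.eLpNorm_condExp_le hq (hsu j) (hZq j)

lemma sum_rpow_le_of_le {n : ℕ} {x : ℕ → ℝ≥0∞} {ε : ℝ≥0∞} {γ : ℝ} (hγ : 1 < γ)
    (hx : ∀ j < n, x j ≤ ε) (hsum : ∑ j ∈ Finset.range n, x j ≤ 1) :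
    ∑ j ∈ Finset.range n, x j ^ γ ≤ ε ^ (γ - 1) := by
  have h1 : ∀ y : ℝ≥0∞, y ^ γ = y ^ (γ - 1) * y := fun y => by
    rw [show γ = (γ - 1) + 1 by ring, ENNReal.rpow_add_of_nonneg _ _ (by linarith) zero_le_one,
      ENNReal.rpow_one]
    simp
  calc ∑ j ∈ Finset.range n, x j ^ γ ≤ ∑ j ∈ Finset.range n, ε ^ (γ - 1) * x j := by
        refine Finset.sum_le_sum fun j hj => ?_
        rw [h1]
        gcongr
        · exact hx j (Finset.mem_range.1 hj)
    _ ≤ ε ^ (γ - 1) * 1 := by rw [← Finset.mul_sum]; gcongr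
    _ = _ := mul_one _

/-- Blocks whose sizes are controlled with exponent `β > 1/2`, and whose conditional means are
controlled with exponent `α > 1`, are negligible if the control is small on each block. -/
lemma condNorm_iSup_blocks_le_of_small (hq : 2 ≤ q) (hr : 1 ≤ r) {K : ℝ≥0} (e : E ≃L[ℝ] H)
    (he : ∀ x, ‖x‖ ≤ ‖e x‖ ∧ ‖e x‖ ≤ K * ‖x‖) {u : ℕ → TimeInterval T} (hu : Monotone u)
    (hs : s ≤ u 0) {Z : ℕ → Ω → E} (hZ : ∀ j, StronglyMeasurable[F (u (j + 1))] (Z j))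
    (hZq : ∀ j, MemLp (Z j) (ENNReal.ofReal q) P) {Zs : ℕ → Ω → ℝ≥0∞}
    (hZs : ∀ j, AEMeasurable (Zs j) P) (hle : ∀ j ω, ‖Z j ω‖ₑ ≤ Zs j ω) {n : ℕ}
    {α β : ℝ} (hα : 1 < α) (hβ : 1 / 2 < β) {c ε : ℝ≥0∞} {x : ℕ → ℝ≥0∞}
    (hx : ∀ j < n, x j ≤ ε) (hsum : ∑ j ∈ Finset.range n, x j ≤ 1)
    (hsize : ∀ j < n, condNorm F P q r (u j) (Zs j) ≤ c * x j ^ β)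
    (hdrift : ∀ j < n, eLpNorm (P[Z j | F (u j)]) (ENNReal.ofReal q * r) P ≤ c * x j ^ α) :
    condNorm F P q r s
        (fun ω => ⨆ l ∈ Finset.range n, (‖(∑ j ∈ Finset.range l, Z j) ω‖ₑ + Zs l ω)) ≤
      c * ((aggConst q K + 1) * ε ^ (β - 1 / 2) + ε ^ (α - 1)) := by
  refine (condNorm_iSup_blocks_le hq hr e he hu hs hZ hZq hZs hle n).trans ?_
  have h1 : (∑ j ∈ Finset.range n, condNorm F P q r (u j) (Zs j) ^ 2) ^ (1 / 2 : ℝ) ≤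
      c * ε ^ (β - 1 / 2) := by
    have : ∑ j ∈ Finset.range n, condNorm F P q r (u j) (Zs j) ^ 2 ≤
        c ^ 2 * ε ^ (2 * β - 1) := by
      calc _ ≤ ∑ j ∈ Finset.range n, c ^ 2 * x j ^ (2 * β) := by
            refine Finset.sum_le_sum fun j hj => ?_
            calc _ ≤ (c * x j ^ β) ^ 2 := by gcongr; exact hsize j (Finset.mem_range.1 hj)
              _ = _ := by
                rw [mul_pow, ← ENNReal.rpow_natCast (x j ^ β), ← ENNReal.rpow_mul]
                congr 2; push_cast; ring
        _ ≤ _ := by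
            rw [← Finset.mul_sum]
            gcongr
            exact sum_rpow_le_of_le (by linarith) hx hsum
    calc _ ≤ (c ^ 2 * ε ^ (2 * β - 1)) ^ (1 / 2 : ℝ) := by gcongr
      _ = _ := by
        rw [ENNReal.mul_rpow_of_nonneg _ _ (by norm_num), ← ENNReal.rpow_natCast c,
          ← ENNReal.rpow_mul, ← ENNReal.rpow_mul]
        congr 2
        · norm_num
        · ring
  have h2 : ∑ j ∈ Finset.range n, eLpNorm (P[Z j | F (u j)]) (ENNReal.ofReal q * r) P ≤
      c * ε ^ (α - 1) := by
    calc _ ≤ ∑ j ∈ Finset.range n, c * x j ^ α :=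
          Finset.sum_le_sum fun j hj => hdrift j (Finset.mem_range.1 hj)
      _ ≤ _ := by
          rw [← Finset.mul_sum]
          gcongr
          exact sum_rpow_le_of_le hα hx hsum
  calc _ ≤ (aggConst q K + 1) * (c * ε ^ (β - 1 / 2)) + c * ε ^ (α - 1) := by gcongr
    _ = _ := by ring

end Blocks

lemma exists_control_threshold {α β : ℝ} (κ : ℝ≥0) (hα : 1 < α) (hβ : 1 / 2 < β) {c ε : ℝ≥0∞} (hct : c ≠ ∞)
    (hε : 0 < ε) : ∃ η : ℝ≥0∞, 0 < η ∧
      c * ((κ + 1) * η ^ (β - 1 / 2) + η ^ (α - 1)) ≤ ε := by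
  have hcont : Tendsto (fun η : ℝ≥0∞ =>
      c * ((κ + 1) * η ^ (β - 1 / 2) + η ^ (α - 1))) (𝓝 0) (𝓝 0) := by
    have h1 : Tendsto (fun η : ℝ≥0∞ => η ^ (β - 1 / 2)) (𝓝 0) (𝓝 0) := by
      have := (ENNReal.continuous_rpow_const (y := β - 1 / 2)).tendsto 0
      rwa [ENNReal.zero_rpow_of_pos (by linarith)] at this
    have h2 : Tendsto (fun η : ℝ≥0∞ => η ^ (α - 1)) (𝓝 0) (𝓝 0) := by
      have := (ENNReal.continuous_rpow_const (y := α - 1)).tendsto 0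
      rwa [ENNReal.zero_rpow_of_pos (by linarith)] at this
    have h3 := ENNReal.Tendsto.const_mul (a := c) ((ENNReal.Tendsto.const_mul
      (a := (κ + 1 : ℝ≥0∞)) h1 (Or.inr (by simp))).add h2) (Or.inr hct)
    simpa using h3
  have : ∀ᶠ η in 𝓝[>] (0 : ℝ≥0∞),
      c * ((κ + 1) * η ^ (β - 1 / 2) + η ^ (α - 1)) ≤ ε :=
    nhdsWithin_le_nhds (hcont.eventually (ge_mem_nhds hε))
  obtain ⟨η, hη1, hη2⟩ := (this.and self_mem_nhdsWithin).exists
  exact ⟨η, hη2, hη1⟩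

section Sewing

variable {T : ℝ} {Ω : Type*} {mΩ : MeasurableSpace Ω} {P : Measure Ω} [IsProbabilityMeasure P]
  {F : Filtration (TimeInterval T) mΩ} {q : ℝ} {r : ℝ≥0∞} {α β : ℝ} {B : ℝ≥0∞}
  {w : TimeInterval T → TimeInterval T → ℝ≥0∞} {s t a b : TimeInterval T}
  {E : Type*} [NormedAddCommGroup E] [NormedSpace ℝ E] [CompleteSpace E]
  {A : TimeInterval T → TimeInterval T → Ω → E}
  {H : Type*} [NormedAddCommGroup H] [InnerProductSpace ℝ H] [CompleteSpace H]
  {u : ℕ → TimeInterval T} {n : ℕ}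

omit [NormedSpace ℝ E] [CompleteSpace E] in
lemma IsTimeSeq.sewErr_zero (hu : IsTimeSeq a b u n) :
    sewErr (fun i j => A (u i) (u j)) 0 n = seqSum A u n - A a b := by
  rw [sewErr, hu.zero, hu.last n le_rfl, seqSum, Finset.range_eq_Ico]

namespace HasSmallDriftOn

omit [IsProbabilityMeasure P] [CompleteSpace E] in
lemma mono (h : HasSmallDriftOn F P q r α B w A s t) {a b c d : TimeInterval T} (hsa : s ≤ a)
    (hab : a ≤ b) (hbc : b ≤ c) (hcd : c ≤ d) (hdt : d ≤ t) : w b c ≤ w a d :=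
  calc w b c ≤ w a b + w b c := le_add_self
    _ ≤ w a c := h.superadd _ _ _ hsa hab hbc (hcd.trans hdt)
    _ ≤ w a c + w c d := le_self_add
    _ ≤ w a d := h.superadd _ _ _ hsa (hab.trans hbc) hcd hdt

omit [IsProbabilityMeasure P] [CompleteSpace E] in
lemma le_one' (h : HasSmallDriftOn F P q r α B w A s t) (hsa : s ≤ a) (hab : a ≤ b) (hbt : b ≤ t) :
    w a b ≤ 1 := (h.mono le_rfl hsa hab hbt le_rfl).trans h.le_one

omit [IsProbabilityMeasure P] [CompleteSpace E] in
lemma memLp_defect (h : HasSmallDriftOn F P q r α B w A s t) (a c m : TimeInterval T) :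
    MemLp (defect A a c m) (ENNReal.ofReal q) P :=
  ((h.memLp a m).sub (h.memLp a c)).sub (h.memLp c m)

omit [IsProbabilityMeasure P] [CompleteSpace E] in
lemma memLp_seqSum (h : HasSmallDriftOn F P q r α B w A s t) (u : ℕ → TimeInterval T) (n : ℕ) :
    MemLp (seqSum A u n) (ENNReal.ofReal q) P :=
  memLp_finsetSum' _ fun _ _ => h.memLp _ _

omit [IsProbabilityMeasure P] [CompleteSpace E] in
lemma meas_seqSum (h : HasSmallDriftOn F P q r α B w A s t) (hu : ∀ k, u k ≤ b) (n : ℕ) :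
    StronglyMeasurable[F b] (seqSum A u n) :=
  Finset.stronglyMeasurable_sum _ fun _ _ => (h.meas _ _).mono (F.mono (hu _))

omit [IsProbabilityMeasure P] [CompleteSpace E] in
/-- The control along a sequence of times sums up to at most `1`. -/
lemma sum_le_one (h : HasSmallDriftOn F P q r α B w A s t) (hu : IsTimeSeq s t u n) :
    ∑ k ∈ Finset.range n, w (u k) (u (k + 1)) ≤ 1 := by
  have : ∀ m, ∑ k ∈ Finset.range m, w (u k) (u (k + 1)) ≤ w s (u m) := by
    intro m
    induction m with
    | zero => simp
    | succ m ih =>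
      rw [Finset.sum_range_succ]
      refine le_trans (by gcongr) (h.superadd _ _ _ le_rfl (hu.mem m).1 (hu.mono m.le_succ)
        (hu.mem _).2)
  exact (this n).trans (h.le_one' le_rfl (hu.mem n).1 (hu.mem n).2)

lemma hasSmallDrift (h : HasSmallDriftOn F P q r α B w A s t) (hq : 2 ≤ q) (hsa : s ≤ a)
    (hu : Monotone u) (hau : ∀ k, a ≤ u k) (hut : ∀ k, u k ≤ t) {ρ : Ω → ℝ≥0}
    (hρ : IsWeight (F a) P r ρ) :
    HasSmallDrift (weighted P ρ) (reindexFiltration F u hu) q α B (fun i j => w (u i) (u j))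
      (fun i j => A (u i) (u j)) where
  meas _ _ := h.meas _ _
  memLp _ _ := hρ.memLp (h.memLp _ _)
  diag _ := h.diag _
  superadd i _ k hij hjk := h.superadd _ _ _ (hsa.trans (hau i)) (hu hij) (hu hjk) (hut k)
  le_one i j hij := h.le_one' (hsa.trans (hau i)) (hu hij) (hut j)
  drift i _ k hij hjk :=
    (hρ.eLpNorm_condExp_le hq (hau i) (h.memLp_defect _ _ _)).trans
      (h.drift _ _ _ (hsa.trans (hau i)) (hu hij) (hu hjk) (hut k))

/-- The conditional mean of the difference between a Riemann sum and `A a b`. -/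
theorem eLpNorm_condExp_le (h : HasSmallDriftOn F P q r α B w A s t) (hq : 2 ≤ q) (hr : 1 ≤ r)
    (hα : 1 < α) (hsa : s ≤ a) (hbt : b ≤ t) (hu : IsTimeSeq a b u n) :
    eLpNorm (P[seqSum A u n - A a b | F a]) (ENNReal.ofReal q * r) P ≤
      driftConst α * B * w a b ^ α := by
  have hq1 := one_le_ofReal hq
  have hmem : MemLp (seqSum A u n - A a b) (ENNReal.ofReal q) P :=
    (h.memLp_seqSum u n).sub (h.memLp a b)
  rw [eLpNorm_eq_condNorm hq stronglyMeasurable_condExp]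
  refine condNorm_le_of_forall_weight hq hr (hmem.condExp hq1).1.enorm fun ρ hρ => ?_
  have := hρ.isFiniteMeasure
  rw [eLpNorm_enorm, eLpNorm_congr_ae (hρ.condExp_ae_eq (F.le a) (hmem.integrable hq1))]
  have h1 := (h.hasSmallDrift hq hsa hu.mono (fun k => (hu.mem k).1)
    (fun k => (hu.mem k).2.trans hbt) hρ).eLpNorm_condExp_sewErr_le hq hα (Nat.zero_le n)
  rw [hu.sewErr_zero] at h1
  have e1 : (reindexFiltration F u hu.mono) 0 = F a := by
    show F (u 0) = F a
    rw [hu.zero]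
  rw [e1, hu.zero, hu.last n le_rfl] at h1
  exact h1

end HasSmallDriftOn

namespace IsSewableOn

lemma isSewable (h : IsSewableOn F P q r α β B w A s t) (hq : 2 ≤ q) (hsa : s ≤ a)
    (hu : Monotone u) (hau : ∀ k, a ≤ u k) (hut : ∀ k, u k ≤ t) {ρ : Ω → ℝ≥0}
    (hρ : IsWeight (F a) P r ρ) :
    IsSewable (weighted P ρ) (reindexFiltration F u hu) q α β B (fun i j => w (u i) (u j))
      (fun i j => A (u i) (u j)) where
  toHasSmallDrift := h.hasSmallDrift hq hsa hu hau hut hρ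
  size i j k hij hjk := by
    obtain ⟨g, hg, hle, hnorm⟩ := h.size _ _ _ (hsa.trans (hau i)) (hu hij) (hu hjk) (hut k)
    refine le_trans (eLpNorm_mono_enorm fun ω => ?_)
      (((hρ.mono (F.mono (hau i))).eLpNorm_le_condNorm hq hg).trans hnorm)
    simp only [enorm_eq_self]
    refine iSup₂_le fun m hm => ?_
    rw [Finset.mem_Icc] at hm
    exact hle _ (hu hm.1) (hu hm.2) ω

/-- The stochastic sewing lemma along a sequence of times, in maximal form. -/
theorem condNorm_iSup_le (h : IsSewableOn F P q r α β B w A s t) (hq : 2 ≤ q) (hr : 1 ≤ r)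
    (hα : 1 < α) (hβ : 1 / 2 < β) (hβα : β ≤ α) {K : ℝ≥0} (e : E ≃L[ℝ] H)
    (he : ∀ x, ‖x‖ ≤ ‖e x‖ ∧ ‖e x‖ ≤ K * ‖x‖) (hsa : s ≤ a) (hbt : b ≤ t)
    (hu : IsTimeSeq a b u n) :
    condNorm F P q r a (fun ω => ⨆ m ∈ Finset.Icc 0 n, ‖(seqSum A u m - A a (u m)) ω‖ₑ) ≤
      sewConst q K α β * B * w a b ^ β := by
  refine condNorm_le_of_forall_weight hq hr ?_ fun ρ hρ => ?_
  · exact AEMeasurable.biSup _ (Finset.Icc 0 n).countable_toSet fun m _ =>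
      ((h.memLp_seqSum u m).sub (h.memLp a (u m))).1.enorm
  have := hρ.isFiniteMeasure
  have h1 := (h.isSewable hq hsa hu.mono (fun k => (hu.mem k).1)
    (fun k => (hu.mem k).2.trans hbt) hρ).eLpNorm_iSup_sewErr_le hq hα hβ hβα e he (Nat.zero_le n)
  have e1 : ∀ m, sewErr (fun i j => A (u i) (u j)) 0 m = seqSum A u m - A a (u m) := fun m => by
    rw [sewErr, hu.zero, seqSum, Finset.range_eq_Ico]
  simp only [e1] at h1
  rwa [hu.zero, hu.last n le_rfl] at h1

lemma condNorm_le (h : IsSewableOn F P q r α β B w A s t) (hq : 2 ≤ q) (hr : 1 ≤ r)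
    (hα : 1 < α) (hβ : 1 / 2 < β) (hβα : β ≤ α) {K : ℝ≥0} (e : E ≃L[ℝ] H)
    (he : ∀ x, ‖x‖ ≤ ‖e x‖ ∧ ‖e x‖ ≤ K * ‖x‖) (hsa : s ≤ a) (hbt : b ≤ t)
    (hu : IsTimeSeq a b u n) :
    condNorm F P q r a (fun ω => ‖(seqSum A u n - A a b) ω‖ₑ) ≤
      sewConst q K α β * B * w a b ^ β := by
  refine (condNorm_mono hq fun ω => ?_).trans
    (h.condNorm_iSup_le hq hr hα hβ hβα e he hsa hbt hu)
  have := le_iSup₂ (f := fun m (_ : m ∈ Finset.Icc 0 n) => ‖(seqSum A u m - A a (u m)) ω‖ₑ) n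
    (by simp)
  rwa [hu.last n le_rfl] at this

omit [CompleteSpace E] in
/-- Refining a sequence of times by one time changes the sum by at most one small defect. -/
lemma condNorm_split_le (h : IsSewableOn F P q r α β B w A s t) (hq : 2 ≤ q) (hr : 1 ≤ r)
    {τ v : TimeInterval T} {x : ℕ → TimeInterval T} {m : ℕ}
    (hx : IsTimeSeq s v x m) (hvt : v ≤ t) {δ : ℝ} (hδ : ∀ k, (x (k + 1) : ℝ) - x k < δ) {ε : ℝ≥0∞}
    (hε : ∀ y, τ < y → (y : ℝ) - τ < δ → y ≤ t → ∀ a, s ≤ a → a ≤ τ →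
      condNorm F P q r a (fun ω => ‖defect A a τ y ω‖ₑ) ≤ ε) :
    condNorm F P q r s (fun ω => ‖(seqSum A x m - seqSum A (fun k => min (x k) τ) m
      - seqSum A (fun k => max (x k) τ) m) ω‖ₑ) ≤ ε := by
  rcases seqSum_min_max h.diag hx.mono m τ with ⟨k, _, h1, h2, h3⟩ | h0
  · rw [h3]
    refine (condNorm_mono_time hq hr (hx.mem k).1 (h.memLp_defect _ _ _).1.enorm).trans ?_
    refine hε _ h2 ?_ ((hx.mem _).2.trans hvt) _ (hx.mem k).1 h1.le
    have h4 := hδ k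
    have h5 : (x k : ℝ) < τ := h1
    linarith
  · rw [h0]
    simp [condNorm_zero hq]

/-- The Riemann sums along fine sequences of times are close to the sum along a fixed one. -/
theorem exists_condNorm_seqSum_sub_le (h : IsSewableOn F P q r α β B w A s t) (hst : s ≤ t)
    (hB : B ≠ ∞) (hq : 2 ≤ q) (hr : 1 ≤ r)
    (hα : 1 < α) (hβ : 1 / 2 < β) (hβα : β ≤ α) {K : ℝ≥0} (e : E ≃L[ℝ] H)
    (he : ∀ x, ‖x‖ ≤ ‖e x‖ ∧ ‖e x‖ ≤ K * ‖x‖) {ε : ℝ≥0∞} (hε : 0 < ε) :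
    ∃ S₀ : Ω → E, MemLp S₀ (ENNReal.ofReal q) P ∧ ∃ δ > 0, ∀ (x : ℕ → TimeInterval T) (m : ℕ),
      IsTimeSeq s t x m → (∀ k, (x (k + 1) : ℝ) - x k < δ) →
      condNorm F P q r s (fun ω => ‖(seqSum A x m - S₀) ω‖ₑ) ≤ ε := by
  have hε2 : 0 < ε / 2 := ENNReal.half_pos hε.ne'
  set c : ℝ≥0∞ := (sewConst q K α β + driftConst α) * B with hc
  have hct : c ≠ ∞ := ENNReal.mul_ne_top
    (ENNReal.add_ne_top.2 ⟨sewConst_ne_top hα, driftConst_ne_top hα⟩) hB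
  obtain ⟨η, hη, hηle⟩ := exists_control_threshold (aggConst q K) hα hβ hct hε2
  obtain ⟨u, n, hu, hQ⟩ := exists_timeSeq (Q := fun a b => w a b ≤ η) hst
    (fun τ h1 h2 => (h.small_left τ h1 h2).eventually (ge_mem_nhds hη))
    (fun τ h1 h2 => (h.small_right τ h1 h2).eventually (ge_mem_nhds hη))
  -- inserting a point of the fixed sequence `u` into a fine sequence changes the sum by at most `ε'`
  set ε' : ℝ≥0∞ := ε / 2 / (n + 1) with hε'
  have hε'0 : 0 < ε' := ENNReal.div_pos hε2.ne' (by finiteness)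
  have hδl : ∀ l < n, ∃ δ > 0, ∀ y, u l < y → (y : ℝ) - u l < δ → ∀ a, s ≤ a → a ≤ u l →
      condNorm F P q r a (fun ω => ‖defect A a (u l) y ω‖ₑ) ≤ ε' := fun l hl =>
    exists_dist_of_eventually_gt
      (h.defect_small (u l) (hu.mem l).1 ((hQ l hl).1.trans_le (hu.mem _).2) ε' hε'0)
  obtain ⟨δ, hδ, hδle⟩ : ∃ δ > 0, ∀ l < n, ∀ y, u l < y → (y : ℝ) - u l < δ → ∀ a, s ≤ a →
      a ≤ u l → condNorm F P q r a (fun ω => ‖defect A a (u l) y ω‖ₑ) ≤ ε' := by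
    choose! D hD1 hD2 using hδl
    rcases Nat.eq_zero_or_pos n with rfl | hn
    · exact ⟨1, one_pos, fun l hl => absurd hl (Nat.not_lt_zero l)⟩
    · have hne : (Finset.range n).Nonempty := ⟨0, Finset.mem_range.2 hn⟩
      refine ⟨(Finset.range n).inf' hne D, ?_, fun l hl y h1 h2 => hD2 l hl y h1 ?_⟩
      · exact (Finset.lt_inf'_iff hne).2 fun l hl => hD1 l (Finset.mem_range.1 hl)
      · exact h2.trans_le (Finset.inf'_le _ (Finset.mem_range.2 hl))
  refine ⟨seqSum A u n, h.memLp_seqSum u n, δ, hδ, fun x m hx hgap => ?_⟩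
  set z : ℕ → ℕ → TimeInterval T := fun l k => min (x k) (u l) with hz
  set y : ℕ → ℕ → TimeInterval T := fun l k => max (min (x k) (u (l + 1))) (u l) with hy
  have hzseq : ∀ l, IsTimeSeq s (u l) (z l) m := fun l => hx.min_right (hu.mem l).1 (hu.mem l).2
  have hyseq : ∀ l, IsTimeSeq (u l) (u (l + 1)) (y l) m := fun l =>
    (hzseq (l + 1)).max_left (hu.mem l).1 (hu.mono l.le_succ)
  have hmem : ∀ L, MemLp (seqSum A (z L) m - ∑ l ∈ Finset.range L, seqSum A (y l) m)
      (ENNReal.ofReal q) P := fun L =>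
    (h.memLp_seqSum _ _).sub (memLp_finsetSum' _ fun _ _ => h.memLp_seqSum _ _)
  -- cutting the fine sequence at `u 1, …, u L`
  have hsplit : ∀ L ≤ n, condNorm F P q r s
      (fun ω => ‖(seqSum A (z L) m - ∑ l ∈ Finset.range L, seqSum A (y l) m) ω‖ₑ) ≤ L * ε' := by
    intro L
    induction L with
    | zero =>
      intro _
      have e0 : seqSum A (z 0) m = 0 := by
        refine Finset.sum_eq_zero fun k _ => ?_
        have : ∀ k, z 0 k = s := fun k => by simp [hz, hu.zero, (hx.mem k).1]
        rw [this, this, h.diag]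
      simp [e0, condNorm_zero hq]
    | succ L ih =>
      intro hL
      have h1 := h.condNorm_split_le hq hr (hzseq (L + 1)) (hu.mem _).2
        (IsTimeSeq.gap_min hδ hgap (u (L + 1)))
        (fun y' h1 h2 _ a h3 h4 => hδle L (by omega) y' h1 h2 a h3 h4)
      have e1 : (fun k => min (z (L + 1) k) (u L)) = z L := by
        funext k
        simp [hz, min_assoc, hu.mono L.le_succ]
      rw [e1] at h1
      have hm1 := ((((h.memLp_seqSum (z (L + 1)) m).sub (h.memLp_seqSum (z L) m)).sub
        (h.memLp_seqSum (y L) m))).1.enorm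
      calc _ ≤ condNorm F P q r s (fun ω =>
            ‖(seqSum A (z (L + 1)) m - seqSum A (z L) m - seqSum A (y L) m) ω‖ₑ
              + ‖(seqSum A (z L) m - ∑ l ∈ Finset.range L, seqSum A (y l) m) ω‖ₑ) := by
            refine condNorm_mono hq fun ω => ?_
            rw [Finset.sum_range_succ]
            refine le_trans (le_of_eq ?_) (enorm_add_le _ _)
            congr 1
            simp only [Pi.sub_apply, Pi.add_apply]
            abel
        _ ≤ ε' + L * ε' := (condNorm_add_le hq hr hm1 (hmem L).1.enorm).trans
            (add_le_add h1 (ih (by omega)))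
        _ = _ := by push_cast; ring
  -- the blocks between consecutive members of `u`
  set Z : ℕ → Ω → E := fun l => seqSum A (y l) m - A (u l) (u (l + 1)) with hZ
  have hZm : ∀ l, MemLp (Z l) (ENNReal.ofReal q) P := fun l =>
    (h.memLp_seqSum _ _).sub (h.memLp _ _)
  have hblocks := condNorm_iSup_blocks_le_of_small (F := F) (P := P) (r := r) (s := s) hq hr e he
    hu.mono hu.zero.ge (Z := Z) (Zs := fun l ω => ‖Z l ω‖ₑ)
    (fun l => (h.meas_seqSum (fun k => ((hyseq l).mem k).2) m).sub
      ((h.meas _ _).mono (F.mono (hu.mono l.le_succ))))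
    hZm (fun l => (hZm l).1.enorm) (fun _ _ => le_rfl) hα hβ (c := c) (ε := η)
    (x := fun l => w (u l) (u (l + 1))) (fun l hl => (hQ l hl).2) (h.sum_le_one hu)
    (fun l _ => (h.condNorm_le hq hr hα hβ hβα e he (hu.mem l).1 (hu.mem _).2 (hyseq l)).trans
      (by rw [hc]; gcongr; exact le_self_add))
    (fun l _ => (h.eLpNorm_condExp_le hq hr hα (hu.mem l).1 (hu.mem _).2 (hyseq l)).trans
      (by rw [hc]; gcongr; exact le_add_self))
  have hsumZ : condNorm F P q r s (fun ω => ‖(∑ l ∈ Finset.range n, Z l) ω‖ₑ) ≤ ε / 2 := by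
    refine (condNorm_mono hq fun ω => ?_).trans (hblocks.trans hηle)
    rcases n with _ | n
    · simp
    · refine le_trans ?_ (le_iSup₂ (f := fun l (_ : l ∈ Finset.range (n + 1)) =>
        ‖(∑ j ∈ Finset.range l, Z j) ω‖ₑ + ‖Z l ω‖ₑ) n (by simp))
      rw [Finset.sum_range_succ, Pi.add_apply]
      exact enorm_add_le _ _
  have hzn : z n = x := by
    funext k
    simp [hz, hu.last n le_rfl, (hx.mem k).2]
  have hfin := hsplit n le_rfl
  rw [hzn] at hfin
  have hmn := hmem n
  rw [hzn] at hmn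
  calc condNorm F P q r s (fun ω => ‖(seqSum A x m - seqSum A u n) ω‖ₑ)
      ≤ condNorm F P q r s (fun ω =>
          ‖(seqSum A x m - ∑ l ∈ Finset.range n, seqSum A (y l) m) ω‖ₑ
            + ‖(∑ l ∈ Finset.range n, Z l) ω‖ₑ) := by
        refine condNorm_mono hq fun ω => ?_
        refine le_trans (le_of_eq ?_) (enorm_add_le _ _)
        have : ∑ l ∈ Finset.range n, Z l =
            ∑ l ∈ Finset.range n, seqSum A (y l) m - seqSum A u n := by
          rw [hZ, Finset.sum_sub_distrib]; rfl
        rw [this]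
        congr 1
        simp only [Pi.sub_apply]
        abel
    _ ≤ n * ε' + ε / 2 := (condNorm_add_le hq hr hmn.1.enorm
          (memLp_finsetSum' _ fun l _ => hZm l).1.enorm).trans (add_le_add hfin hsumZ)
    _ ≤ ε / 2 + ε / 2 := by
        gcongr
        calc (n : ℝ≥0∞) * ε' ≤ (n + 1) * ε' := by gcongr; exact le_self_add
          _ = ε / 2 := ENNReal.mul_div_cancel (by simp) (by finiteness)
    _ = ε := ENNReal.add_halves ε

end IsSewableOn

end Sewing

/-! ### Limits of Riemann sums -/

section SewingLimit

variable {T : ℝ} {Ω : Type*} {mΩ : MeasurableSpace Ω}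
  {E : Type*} [NormedAddCommGroup E]

/-- `D` is the limit in `‖·‖_{q,r,s}` of the sums of `A` along fine sequences of times. -/
def IsSewingLimit (F : Filtration (TimeInterval T) mΩ) (P : Measure Ω) (q : ℝ) (r : ℝ≥0∞)
    (A : TimeInterval T → TimeInterval T → Ω → E) (s t : TimeInterval T) (D : Ω → E) : Prop :=
  ∀ ε > 0, ∃ δ > 0, ∀ (x : ℕ → TimeInterval T) (m : ℕ), IsTimeSeq s t x m →
    (∀ k, (x (k + 1) : ℝ) - x k < δ) →
    condNorm F P q r s (fun ω => ‖(D - seqSum A x m) ω‖ₑ) ≤ ε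

variable {P : Measure Ω} [IsProbabilityMeasure P]
  {F : Filtration (TimeInterval T) mΩ} {q : ℝ} {r : ℝ≥0∞} {α β : ℝ} {B : ℝ≥0∞}
  {w : TimeInterval T → TimeInterval T → ℝ≥0∞} {s t a b : TimeInterval T}
  {A : TimeInterval T → TimeInterval T → Ω → E}

lemma exists_timeSeq_gap_lt (hst : s ≤ t) {δ : ℝ} (hδ : 0 < δ) :
    ∃ (x : ℕ → TimeInterval T) (m : ℕ), IsTimeSeq s t x m ∧ ∀ k, (x (k + 1) : ℝ) - x k < δ := by
  obtain ⟨π, hπ⟩ := exists_timePartition_mesh_lt hst hδ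
  exact ⟨π.seq, π.n, π.isTimeSeq_seq, fun k => (π.seq_gap_le k).trans_lt (max_lt hπ hδ)⟩

/-- Fine sequences of times can be chosen to pass through a given finite set. -/
lemma exists_timeSeq_gap_lt_mem (hst : s ≤ t) {δ : ℝ} (hδ : 0 < δ) (V : Finset (TimeInterval T)) :
    ∃ (x : ℕ → TimeInterval T) (m : ℕ), IsTimeSeq s t x m ∧ (∀ k, (x (k + 1) : ℝ) - x k < δ) ∧
      ∀ v ∈ V, s ≤ v → v ≤ t → ∃ k ≤ m, x k = v := by
  have hleft : ∀ τ : TimeInterval T, s < τ → ∀ᶠ u in 𝓝[<] τ, ∀ v ∈ V, ¬ (u < v ∧ v < τ) := by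
    intro τ hτ
    rw [Filter.eventually_all_finset]
    intro v _
    rcases lt_or_ge v τ with h | h
    · filter_upwards [eventually_lt_of_lt h] with u hu hcon
      exact lt_asymm hu.1 hcon.1
    · exact Eventually.of_forall fun u hcon => absurd hcon.2 (not_lt.2 h)
  have hright : ∀ τ : TimeInterval T, τ < t → ∀ᶠ u in 𝓝[>] τ, ∀ v ∈ V, ¬ (τ < v ∧ v < u) := by
    intro τ hτ
    rw [Filter.eventually_all_finset]
    intro v _
    rcases lt_or_ge τ v with h | h
    · filter_upwards [eventually_gt_of_lt h] with u hu hcon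
      exact lt_asymm hu.2 hcon.2
    · exact Eventually.of_forall fun u hcon => absurd hcon.1 (not_lt.2 h)
  obtain ⟨x, m, hx, hQ⟩ := exists_timeSeq
    (Q := fun a b => (b : ℝ) - a < δ ∧ ∀ v ∈ V, ¬ (a < v ∧ v < b)) hst
    (fun τ h1 _ => (eventually_lt_dist τ hδ).and (hleft τ h1))
    (fun τ _ h2 => (eventually_gt_dist τ hδ).and (hright τ h2))
  refine ⟨x, m, hx, fun k => ?_, fun v hv hsv hvt => ?_⟩
  · rcases Nat.lt_or_ge k m with hk | hk
    · exact (hQ k hk).2.1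
    · rw [hx.last k hk, hx.last (k + 1) (by omega), sub_self]; exact hδ
  · classical
    have hex : ∃ k, v ≤ x k := ⟨m, by rw [hx.last m le_rfl]; exact hvt⟩
    have hkm : Nat.find hex ≤ m := Nat.find_min' hex (by rw [hx.last m le_rfl]; exact hvt)
    refine ⟨Nat.find hex, hkm, le_antisymm ?_ (Nat.find_spec hex)⟩
    rcases Nat.eq_zero_or_pos (Nat.find hex) with h0 | hpos
    · rw [h0, hx.zero]; exact hsv
    · obtain ⟨k, hk⟩ := Nat.exists_eq_succ_of_ne_zero hpos.ne'
      have h1 : x k < v := not_le.1 (Nat.find_min hex (by omega))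
      by_contra hcon
      rw [not_le, hk] at hcon
      exact (hQ k (by omega)).2.2 v hv ⟨h1, hcon⟩

namespace IsSewingLimit

omit [IsProbabilityMeasure P] in
lemma congr {D D' : Ω → E} (h : IsSewingLimit F P q r A s t D) (hq : 2 ≤ q) (hD : D =ᵐ[P] D') :
    IsSewingLimit F P q r A s t D' := by
  intro ε hε
  obtain ⟨δ, hδ, hle⟩ := h ε hε
  refine ⟨δ, hδ, fun x m hx hgap => (condNorm_mono_ae hq ?_).trans (hle x m hx hgap)⟩
  filter_upwards [hD] with ω hω
  simp [hω]

variable [NormedSpace ℝ E]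

omit [IsProbabilityMeasure P] [NormedSpace ℝ E] in
lemma tendsto {D : Ω → E} (h : IsSewingLimit F P q r A s t D) :
    Tendsto (fun π : TimePartition s t => condNorm F P q r s fun ω => ‖(D - π.sum A) ω‖ₑ)
      (meshToZero s t) (𝓝 0) := by
  rw [ENNReal.tendsto_nhds_zero]
  intro ε hε
  obtain ⟨δ, hδ, hle⟩ := h ε hε
  refine eventually_meshToZero_iff.2 ⟨δ, hδ, fun π hπ => ?_⟩
  rw [π.sum_eq_seqSum]
  exact hle _ _ π.isTimeSeq_seq fun k => (π.seq_gap_le k).trans_lt (max_lt hπ hδ)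

end IsSewingLimit

variable [NormedSpace ℝ E] [CompleteSpace E]
  {H : Type*} [NormedAddCommGroup H] [InnerProductSpace ℝ H] [CompleteSpace H]

namespace HasSmallDriftOn

/-- The conditional mean of the sewing limit. -/
theorem eLpNorm_condExp_limit_le (h : HasSmallDriftOn F P q r α B w A s t) (hq : 2 ≤ q)
    (hr : 1 ≤ r) (hα : 1 < α) (hsa : s ≤ a) (hab : a ≤ b) (hbt : b ≤ t) {D : Ω → E}
    (hDq : MemLp D (ENNReal.ofReal q) P) (hD : IsSewingLimit F P q r A a b D) :
    eLpNorm (P[D - A a b | F a]) (ENNReal.ofReal q * r) P ≤ driftConst α * B * w a b ^ α := by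
  have hq1 := one_le_ofReal hq
  refine ENNReal.le_of_forall_pos_le_add fun ε hε _ => ?_
  obtain ⟨δ, hδ, hle⟩ := hD ε (by exact_mod_cast hε)
  obtain ⟨x, m, hx, hgap⟩ := exists_timeSeq_gap_lt hab hδ
  have hS := h.memLp_seqSum x m
  have hqr : 1 ≤ ENNReal.ofReal q * r := one_le_mul hq1 hr
  have e : P[D - A a b | F a] =ᵐ[P]
      P[seqSum A x m - A a b | F a] + P[D - seqSum A x m | F a] := by
    rw [show D - A a b = (seqSum A x m - A a b) + (D - seqSum A x m) by abel]
    exact condExp_add ((hS.sub (h.memLp a b)).integrable hq1) ((hDq.sub hS).integrable hq1) _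
  rw [eLpNorm_congr_ae e]
  refine (eLpNorm_add_le (stronglyMeasurable_condExp.mono (F.le a)).aestronglyMeasurable
    (stronglyMeasurable_condExp.mono (F.le a)).aestronglyMeasurable hqr).trans (add_le_add ?_ ?_)
  · exact h.eLpNorm_condExp_le hq hr hα hsa hbt hx
  · exact (eLpNorm_condExp_le_condNorm hq hr (hDq.sub hS)).trans (hle x m hx hgap)

end HasSmallDriftOn

namespace IsSewableOn

/-- The Riemann sums converge. -/
theorem exists_isSewingLimit (h : IsSewableOn F P q r α β B w A s t) (hst : s ≤ t)
    (hB : B ≠ ∞) (hq : 2 ≤ q) (hr : 1 ≤ r)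
    (hα : 1 < α) (hβ : 1 / 2 < β) (hβα : β ≤ α) {K : ℝ≥0} (e : E ≃L[ℝ] H)
    (he : ∀ x, ‖x‖ ≤ ‖e x‖ ∧ ‖e x‖ ≤ K * ‖x‖) :
    ∃ D : Ω → E, StronglyMeasurable[F t] D ∧ MemLp D (ENNReal.ofReal q) P ∧
      IsSewingLimit F P q r A s t D := by
  have hq1 := one_le_ofReal hq
  have hR := fun (k : ℕ) => h.exists_condNorm_seqSum_sub_le hst hB hq hr hα hβ hβα e he
    (ε := (2⁻¹ : ℝ≥0∞) ^ k / 4) (ENNReal.div_pos (by simp) (by norm_num))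
  choose S₀ hS₀ δ hδ hle using hR
  -- a Cauchy sequence of Riemann sums
  have hx : ∀ k : ℕ, ∃ (x : ℕ → TimeInterval T) (m : ℕ), IsTimeSeq s t x m ∧
      (∀ j ≤ k, ∀ i, (x (i + 1) : ℝ) - x i < δ j) ∧
      ∀ i, (x (i + 1) : ℝ) - x i < 1 / ((k : ℝ) + 1) := by
    intro k
    have hne : (Finset.range (k + 1)).Nonempty := ⟨0, by simp⟩
    obtain ⟨x, m, hx, hgap⟩ := exists_timeSeq_gap_lt hst
      (δ := min ((Finset.range (k + 1)).inf' hne δ) (1 / ((k : ℝ) + 1)))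
      (lt_min ((Finset.lt_inf'_iff hne).2 fun l _ => hδ l) Nat.one_div_pos_of_nat)
    exact ⟨x, m, hx, fun j hj i => ((hgap i).trans_le (min_le_left _ _)).trans_le
      (Finset.inf'_le _ (Finset.mem_range.2 (by omega))),
      fun i => (hgap i).trans_le (min_le_right _ _)⟩
  choose x m hx hgap hgap' using hx
  set S : ℕ → Ω → E := fun k => seqSum A (x k) (m k) with hS
  have hSm : ∀ k, MemLp (S k) (ENNReal.ofReal q) P := fun k => h.memLp_seqSum _ _
  have hS1 : ∀ N n, N ≤ n → condNorm F P q r s (fun ω => ‖(S n - S₀ N) ω‖ₑ) ≤ 2⁻¹ ^ N / 4 :=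
    fun N n hn => hle N _ _ (hx n) (hgap n N hn)
  have hcau : ∀ N n m, N ≤ n → N ≤ m →
      eLpNorm (S n - S m) (ENNReal.ofReal q) P < (2⁻¹ : ℝ≥0∞) ^ N := by
    intro N n m hn hm
    have e1 : S n - S m = (S n - S₀ N) - (S m - S₀ N) := by abel
    have hpos : (2⁻¹ : ℝ≥0∞) ^ N ≠ 0 := by simp
    have hfin : (2⁻¹ : ℝ≥0∞) ^ N ≠ ∞ := by finiteness
    calc eLpNorm (S n - S m) (ENNReal.ofReal q) P
        ≤ eLpNorm (S n - S₀ N) (ENNReal.ofReal q) P + eLpNorm (S m - S₀ N) (ENNReal.ofReal q) P := by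
          rw [e1]
          exact eLpNorm_sub_le ((hSm n).sub (hS₀ N)).1 ((hSm m).sub (hS₀ N)).1 hq1
      _ ≤ 2⁻¹ ^ N / 4 + 2⁻¹ ^ N / 4 := by
          refine add_le_add ?_ ?_
          · exact (eLpNorm_le_condNorm hq hr ((hSm n).sub (hS₀ N)).1).trans (hS1 N n hn)
          · exact (eLpNorm_le_condNorm hq hr ((hSm m).sub (hS₀ N)).1).trans (hS1 N m hm)
      _ = 2⁻¹ ^ N / 2 := by
          rw [ENNReal.div_add_div_same, ← two_mul, show (4 : ℝ≥0∞) = 2 * 2 by norm_num,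
            ENNReal.mul_div_mul_left _ _ (by norm_num) (by norm_num)]
      _ < 2⁻¹ ^ N := ENNReal.half_lt_self hpos hfin
  obtain ⟨L, hL, hLlim⟩ := Lp.cauchy_complete_eLpNorm hq1 hSm
    (B := fun N => (2⁻¹ : ℝ≥0∞) ^ N) (by rw [ENNReal.tsum_geometric]; norm_num) hcau
  -- replace the limit by a version that is measurable at time `t`
  set D : Ω → E := P[L | F t] with hD
  have hDm : MemLp D (ENNReal.ofReal q) P := hL.condExp hq1
  have hDlim : Tendsto (fun n => eLpNorm (D - S n) (ENNReal.ofReal q) P) atTop (𝓝 0) := by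
    refine tendsto_of_tendsto_of_tendsto_of_le_of_le tendsto_const_nhds hLlim
      (fun _ => zero_le) fun n => ?_
    have e1 : P[S n - L | F t] =ᵐ[P] S n - D := by
      refine (condExp_sub ((hSm n).integrable hq1) (hL.integrable hq1) _).trans ?_
      rw [condExp_of_stronglyMeasurable (F.le t) (h.meas_seqSum (fun k => ((hx n).mem k).2) _)
        ((hSm n).integrable hq1)]
    show eLpNorm (D - S n) _ P ≤ _
    rw [eLpNorm_sub_comm, ← eLpNorm_congr_ae e1]
    exact eLpNorm_condExp_le_eLpNorm _ hq1
  refine ⟨D, stronglyMeasurable_condExp, hDm, fun ε hε => ?_⟩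
  obtain ⟨S₁, hS₁, δ₁, hδ₁, hle₁⟩ := h.exists_condNorm_seqSum_sub_le hst hB hq hr hα hβ hβα e he
    (ε := ε / 2) (ENNReal.half_pos hε.ne')
  refine ⟨δ₁, hδ₁, fun y k hy hgy => ?_⟩
  have hyq := h.memLp_seqSum y k
  refine condNorm_le_of_forall_weight hq hr (hDm.sub hyq).1.enorm fun ρ hρ => ?_
  rw [eLpNorm_enorm]
  -- `L^q` convergence suffices, since weights are bounded
  have hlim : Tendsto (fun n => eLpNorm (D - S n) (ENNReal.ofReal q) (weighted P ρ)) atTop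
      (𝓝 0) := by
    obtain ⟨C, hC⟩ := hρ.bounded
    have hc := ENNReal.Tendsto.const_mul (a := (C : ℝ≥0∞) ^ (1 / (ENNReal.ofReal q)).toReal)
      hDlim (Or.inr (ENNReal.rpow_ne_top_of_nonneg (by positivity) ENNReal.coe_ne_top))
    rw [mul_zero] at hc
    refine tendsto_of_tendsto_of_tendsto_of_le_of_le tendsto_const_nhds hc
      (fun _ => zero_le) fun n => ?_
    refine (eLpNorm_mono_measure _ (weighted_le_smul hC)).trans ?_
    rw [eLpNorm_smul_measure_of_ne_top (by simp), smul_eq_mul]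
  have hev : ∀ᶠ n in atTop, eLpNorm (D - seqSum A y k) (ENNReal.ofReal q) (weighted P ρ) ≤
      eLpNorm (D - S n) (ENNReal.ofReal q) (weighted P ρ) + ε := by
    have hsmall : ∀ᶠ n : ℕ in atTop, 1 / ((n : ℝ) + 1) < δ₁ :=
      tendsto_one_div_add_atTop_nhds_zero_nat.eventually (gt_mem_nhds hδ₁)
    filter_upwards [hsmall] with n hn
    have h1 := hρ.eLpNorm_le_condNorm hq ((hSm n).sub hS₁).1.enorm
    have h2 := hρ.eLpNorm_le_condNorm hq (hyq.sub hS₁).1.enorm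
    rw [eLpNorm_enorm] at h1 h2
    have h3 := h1.trans (hle₁ (x n) (m n) (hx n) fun i => (hgap' n i).trans hn)
    have h4 := h2.trans (hle₁ y k hy hgy)
    have e1 : D - seqSum A y k = (D - S n) + ((S n - S₁) - (seqSum A y k - S₁)) := by abel
    have m1 := hρ.memLp (hDm.sub (hSm n))
    have m2 := hρ.memLp ((hSm n).sub hS₁)
    have m3 := hρ.memLp (hyq.sub hS₁)
    rw [e1]
    refine (eLpNorm_add_le m1.1 (m2.sub m3).1 hq1).trans (add_le_add le_rfl ?_)
    refine (eLpNorm_sub_le m2.1 m3.1 hq1).trans ?_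
    calc _ ≤ ε / 2 + ε / 2 := add_le_add h3 h4
      _ = ε := ENNReal.add_halves ε
  have hlim' := hlim.add_const ε
  rw [zero_add] at hlim'
  exact ge_of_tendsto hlim' hev

/-- The sewing limit is determined by the convergence of the sums along partitions. -/
theorem isSewingLimit_of_tendsto (h : IsSewableOn F P q r α β B w A s t) (hst : s ≤ t)
    (hB : B ≠ ∞) (hq : 2 ≤ q) (hr : 1 ≤ r)
    (hα : 1 < α) (hβ : 1 / 2 < β) (hβα : β ≤ α) {K : ℝ≥0} (e : E ≃L[ℝ] H)
    (he : ∀ x, ‖x‖ ≤ ‖e x‖ ∧ ‖e x‖ ≤ K * ‖x‖) {D : Ω → E} (hDq : MemLp D (ENNReal.ofReal q) P)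
    (hD : Tendsto (fun π : TimePartition s t => condNorm F P q r s fun ω => ‖(D - π.sum A) ω‖ₑ)
      (meshToZero s t) (𝓝 0)) : IsSewingLimit F P q r A s t D := by
  intro ε hε
  have hε3 : 0 < ε / 3 := ENNReal.div_pos hε.ne' (by norm_num)
  obtain ⟨S, hS, δ, hδ, hle⟩ := h.exists_condNorm_seqSum_sub_le hst hB hq hr hα hβ hβα e he hε3
  refine ⟨δ, hδ, fun x m hx hgap => ?_⟩
  have hne := meshToZero_neBot hst
  obtain ⟨π, hπ1, hπ2⟩ := ((hD.eventually (ge_mem_nhds hε3)).and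
    (eventually_meshToZero_iff.2 ⟨δ, hδ, fun π hπ => hπ⟩)).exists
  rw [π.sum_eq_seqSum] at hπ1
  have h1 := hle x m hx hgap
  have h2 := hle π.seq π.n π.isTimeSeq_seq fun k => (π.seq_gap_le k).trans_lt (max_lt hπ2 hδ)
  have m1 := (hDq.sub (h.memLp_seqSum π.seq π.n)).1.enorm
  have m2 := ((h.memLp_seqSum π.seq π.n).sub hS).1.enorm
  have m3 := ((h.memLp_seqSum x m).sub hS).1.enorm
  calc condNorm F P q r s (fun ω => ‖(D - seqSum A x m) ω‖ₑ)
      ≤ condNorm F P q r s (fun ω => ‖(D - seqSum A π.seq π.n) ω‖ₑ +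
          (‖(seqSum A π.seq π.n - S) ω‖ₑ + ‖(seqSum A x m - S) ω‖ₑ)) := by
        refine condNorm_mono hq fun ω => ?_
        have e1 : (D - seqSum A x m) ω = (D - seqSum A π.seq π.n) ω +
            ((seqSum A π.seq π.n - S) ω - (seqSum A x m - S) ω) := by
          simp only [Pi.sub_apply]; abel
        rw [e1]
        exact (enorm_add_le _ _).trans (add_le_add le_rfl enorm_sub_le)
    _ ≤ ε / 3 + (ε / 3 + ε / 3) := (condNorm_add_le hq hr m1 (m2.add m3)).trans
        (add_le_add hπ1 ((condNorm_add_le hq hr m2 m3).trans (add_le_add h2 h1)))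
    _ = ε := by rw [← add_assoc, ENNReal.add_thirds]

omit [CompleteSpace E] in
/-- Sewing limits are additive: splitting a fine sequence of times at `τ` changes the sum by one
defect only, over an interval that ends shortly after `τ`. -/
theorem ae_eq_add (h : IsSewableOn F P q r α β B w A s t)
    (hq : 2 ≤ q) (hr : 1 ≤ r) {τ : TimeInterval T} (hsτ : s ≤ τ) (hτt : τ ≤ t) {D D₁ D₂ : Ω → E}
    (hDq : MemLp D (ENNReal.ofReal q) P) (hD₁q : MemLp D₁ (ENNReal.ofReal q) P)
    (hD₂q : MemLp D₂ (ENNReal.ofReal q) P) (hD : IsSewingLimit F P q r A s t D)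
    (hD₁ : IsSewingLimit F P q r A s τ D₁) (hD₂ : IsSewingLimit F P q r A τ t D₂) :
    D =ᵐ[P] D₁ + D₂ := by
  have hq1 := one_le_ofReal hq
  have hst := hsτ.trans hτt
  have hm := (hDq.sub hD₁q).sub hD₂q
  suffices h0 : eLpNorm (D - D₁ - D₂) (ENNReal.ofReal q) P = 0 by
    rw [eLpNorm_eq_zero_iff hm.1 (by simp; linarith)] at h0
    filter_upwards [h0] with ω hω
    simp only [Pi.sub_apply, Pi.zero_apply, sub_sub] at hω
    exact sub_eq_zero.1 hω
  refine nonpos_iff_eq_zero.1 (ENNReal.le_of_forall_pos_le_add fun ε hε _ => ?_)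
  rw [zero_add]
  have hε4 : 0 < (ε : ℝ≥0∞) / 4 := ENNReal.div_pos (by simpa using hε.ne') (by norm_num)
  obtain ⟨δ₀, hδ₀, h₀⟩ : ∃ δ > 0, ∀ y, τ < y → (y : ℝ) - τ < δ → y ≤ t → ∀ a, s ≤ a → a ≤ τ →
      condNorm F P q r a (fun ω => ‖defect A a τ y ω‖ₑ) ≤ (ε : ℝ≥0∞) / 4 := by
    rcases hτt.eq_or_lt with rfl | hlt
    · exact ⟨1, one_pos, fun y h1 _ h2 => absurd h1 (not_lt.2 h2)⟩
    · obtain ⟨δ, hδ, hle⟩ := exists_dist_of_eventually_gt (h.defect_small τ hsτ hlt _ hε4)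
      exact ⟨δ, hδ, fun y h1 h2 _ => hle y h1 h2⟩
  obtain ⟨δ₁, hδ₁, h₁⟩ := hD _ hε4
  obtain ⟨δ₂, hδ₂, h₂⟩ := hD₁ _ hε4
  obtain ⟨δ₃, hδ₃, h₃⟩ := hD₂ _ hε4
  obtain ⟨x, m, hx, hgap⟩ := exists_timeSeq_gap_lt hst
    (lt_min (lt_min hδ₀ hδ₁) (lt_min hδ₂ hδ₃))
  simp only [lt_min_iff] at hgap
  have g₀ := h.condNorm_split_le hq hr hx le_rfl (fun k => (hgap k).1.1) h₀
  have g₁ := h₁ x m hx fun k => (hgap k).1.2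
  have g₂ := h₂ _ m (hx.min_right hsτ hτt) (IsTimeSeq.gap_min hδ₂ (fun k => (hgap k).2.1) τ)
  have g₃ := h₃ _ m (hx.max_left hsτ hτt) (IsTimeSeq.gap_max hδ₃ (fun k => (hgap k).2.2) τ)
  set S := seqSum A x m
  set S₁ := seqSum A (fun k => min (x k) τ) m
  set S₂ := seqSum A (fun k => max (x k) τ) m
  have mS : MemLp S (ENNReal.ofReal q) P := h.memLp_seqSum _ _
  have mS₁ : MemLp S₁ (ENNReal.ofReal q) P := h.memLp_seqSum _ _
  have mS₂ : MemLp S₂ (ENNReal.ofReal q) P := h.memLp_seqSum _ _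
  have e1 : D - D₁ - D₂ = ((D - S) - (D₁ - S₁)) - ((D₂ - S₂) - (S - S₁ - S₂)) := by abel
  rw [e1]
  calc _ ≤ ((ε : ℝ≥0∞) / 4 + ε / 4) + (ε / 4 + ε / 4) := by
        refine (eLpNorm_sub_le ((hDq.sub mS).sub (hD₁q.sub mS₁)).1
          ((hD₂q.sub mS₂).sub ((mS.sub mS₁).sub mS₂)).1 hq1).trans (add_le_add ?_ ?_)
        · refine (eLpNorm_sub_le (hDq.sub mS).1 (hD₁q.sub mS₁).1 hq1).trans (add_le_add ?_ ?_)
          · exact (eLpNorm_le_condNorm hq hr (hDq.sub mS).1).trans g₁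
          · exact (eLpNorm_le_condNorm hq hr (hD₁q.sub mS₁).1).trans g₂
        · refine (eLpNorm_sub_le (hD₂q.sub mS₂).1 ((mS.sub mS₁).sub mS₂).1 hq1).trans
            (add_le_add ?_ ?_)
          · exact (eLpNorm_le_condNorm hq hr (hD₂q.sub mS₂).1).trans g₃
          · exact (eLpNorm_le_condNorm hq hr ((mS.sub mS₁).sub mS₂).1).trans g₀
    _ = ε := by
        rw [ENNReal.div_add_div_same, ENNReal.div_add_div_same, ← mul_two, ← mul_two, mul_assoc,
          show (2 : ℝ≥0∞) * 2 = 4 by norm_num]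
        exact ENNReal.mul_div_cancel_right (by norm_num) (by norm_num)

/-- The stochastic sewing lemma for the increments of a sewing limit, in maximal form over a finite
set of times. -/
theorem condNorm_iSup_limit_le (h : IsSewableOn F P q r α β B w A s t) (hq : 2 ≤ q) (hr : 1 ≤ r)
    (hα : 1 < α) (hβ : 1 / 2 < β) (hβα : β ≤ α) {K : ℝ≥0} (e : E ≃L[ℝ] H)
    (he : ∀ x, ‖x‖ ≤ ‖e x‖ ∧ ‖e x‖ ≤ K * ‖x‖) (hsa : s ≤ a) (hab : a ≤ b) (hbt : b ≤ t)
    {I : TimeInterval T → Ω → E} (hIq : ∀ v, MemLp (I v) (ENNReal.ofReal q) P)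
    (hI : ∀ v, a ≤ v → v ≤ b → IsSewingLimit F P q r A a v (I v - I a))
    (V : Finset (TimeInterval T)) (hV : ∀ v ∈ V, a ≤ v ∧ v ≤ b) :
    condNorm F P q r a (fun ω => ⨆ v ∈ V, ‖(I v - I a - A a v) ω‖ₑ) ≤
      sewConst q K α β * B * w a b ^ β := by
  refine ENNReal.le_of_forall_pos_le_add fun ε hε _ => ?_
  set ε' : ℝ≥0∞ := ε / (V.card + 1) with hε'
  have hε0 : 0 < ε' := ENNReal.div_pos (by simpa using hε.ne') (by finiteness)
  have hI' : ∀ v ∈ V, ∃ δ > 0, ∀ (x : ℕ → TimeInterval T) (m : ℕ), IsTimeSeq a v x m →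
      (∀ k, (x (k + 1) : ℝ) - x k < δ) →
      condNorm F P q r a (fun ω => ‖(I v - I a - seqSum A x m) ω‖ₑ) ≤ ε' := fun v hv =>
    hI v (hV v hv).1 (hV v hv).2 ε' hε0
  obtain ⟨δ, hδ, hle⟩ : ∃ δ > 0, ∀ v ∈ V, ∀ (x : ℕ → TimeInterval T) (m : ℕ), IsTimeSeq a v x m →
      (∀ k, (x (k + 1) : ℝ) - x k < δ) →
      condNorm F P q r a (fun ω => ‖(I v - I a - seqSum A x m) ω‖ₑ) ≤ ε' := by
    choose! D hD1 hD2 using hI'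
    rcases V.eq_empty_or_nonempty with rfl | hne
    · exact ⟨1, one_pos, fun v hv => absurd hv (Finset.notMem_empty v)⟩
    · refine ⟨V.inf' hne D, (Finset.lt_inf'_iff hne).2 hD1, fun v hv x m hx hgap => ?_⟩
      exact hD2 v hv x m hx fun k => (hgap k).trans_le (Finset.inf'_le _ hv)
  obtain ⟨x, n, hx, hgap, hxV⟩ := exists_timeSeq_gap_lt_mem hab hδ V
  have hmax := h.condNorm_iSup_le hq hr hα hβ hβα e he hsa hbt hx
  have hmem : ∀ v, MemLp (I v - I a - seqSum A (fun k => min (x k) v) n) (ENNReal.ofReal q) P :=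
    fun v => ((hIq v).sub (hIq a)).sub (h.memLp_seqSum _ _)
  have hmeas1 : AEMeasurable (fun ω => ⨆ m ∈ Finset.Icc 0 n,
      ‖(seqSum A x m - A a (x m)) ω‖ₑ) P :=
    AEMeasurable.biSup _ (Finset.Icc 0 n).countable_toSet fun m _ =>
      ((h.memLp_seqSum x m).sub (h.memLp a (x m))).1.enorm
  have hmeas2 : AEMeasurable (fun ω => ∑ v ∈ V,
      ‖(I v - I a - seqSum A (fun k => min (x k) v) n) ω‖ₑ) P :=
    Finset.aemeasurable_fun_sum _ fun v _ => (hmem v).1.enorm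
  calc condNorm F P q r a (fun ω => ⨆ v ∈ V, ‖(I v - I a - A a v) ω‖ₑ)
      ≤ condNorm F P q r a (fun ω => (⨆ m ∈ Finset.Icc 0 n, ‖(seqSum A x m - A a (x m)) ω‖ₑ) +
          ∑ v ∈ V, ‖(I v - I a - seqSum A (fun k => min (x k) v) n) ω‖ₑ) := by
        refine condNorm_mono hq fun ω => iSup₂_le fun v hv => ?_
        obtain ⟨k, hkn, hk⟩ := hxV v hv (hV v hv).1 (hV v hv).2
        -- the sequence frozen at `v` has the same sum as the first part of `x`
        have hmin : seqSum A (fun k => min (x k) v) n = seqSum A x k := by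
          obtain ⟨j, rfl⟩ := Nat.exists_eq_add_of_le hkn
          have e1 : ∀ i, min (x (k + i)) v = v := fun i =>
            min_eq_right (hk ▸ hx.mono (Nat.le_add_right k i))
          have e2 : ∀ i ≤ k, min (x i) v = x i := fun i hi => min_eq_left (hk ▸ hx.mono hi)
          rw [seqSum, Finset.sum_range_add, seqSum]
          rw [Finset.sum_eq_zero (s := Finset.range j) fun i _ => by
            rw [e1, add_assoc, e1, h.diag], add_zero]
          refine Finset.sum_congr rfl fun i hi => ?_
          rw [Finset.mem_range] at hi
          rw [e2 i hi.le, e2 (i + 1) hi]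
        have e1 : (I v - I a - A a v) ω = (seqSum A x k - A a (x k)) ω
            + (I v - I a - seqSum A (fun k => min (x k) v) n) ω := by
          rw [hmin, hk]
          simp only [Pi.sub_apply]
          abel
        rw [e1]
        refine (enorm_add_le _ _).trans (add_le_add ?_ ?_)
        · exact le_iSup₂ (f := fun m (_ : m ∈ Finset.Icc 0 n) => ‖(seqSum A x m - A a (x m)) ω‖ₑ)
            k (by simpa using hkn)
        · exact Finset.single_le_sum
            (f := fun v => ‖(I v - I a - seqSum A (fun k => min (x k) v) n) ω‖ₑ)
            (fun _ _ => zero_le) hv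
    _ ≤ sewConst q K α β * B * w a b ^ β + ∑ v ∈ V, ε' := by
        refine (condNorm_add_le hq hr hmeas1 hmeas2).trans (add_le_add hmax ?_)
        refine (condNorm_sum_le hq hr V fun v _ => (hmem v).1.enorm).trans ?_
        refine Finset.sum_le_sum fun v hv => ?_
        exact hle v hv _ n (hx.min_right (hV v hv).1 (hV v hv).2) (IsTimeSeq.gap_min hδ hgap v)
    _ ≤ _ := by
        gcongr
        rw [Finset.sum_const, nsmul_eq_mul]
        calc (V.card : ℝ≥0∞) * ε' ≤ (V.card + 1) * ε' := by gcongr; exact le_self_add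
          _ = ε := ENNReal.mul_div_cancel (by simp) (by finiteness)

end IsSewableOn

end SewingLimit

/-! ### Càdlàg versions -/

section Cadlag

variable {T : ℝ} {E : Type*} [NormedAddCommGroup E]

lemma cauchySeq_of_edist_le_add {x : ℕ → E} {M : ℕ → ℝ≥0∞} (hM : Tendsto M atTop (𝓝 0))
    (h : ∀ k l, edist (x k) (x l) ≤ M k + M l) : CauchySeq x := by
  rw [EMetric.cauchySeq_iff]
  intro ε hε
  obtain ⟨N, hN⟩ := eventually_atTop.1 (hM.eventually (gt_mem_nhds (ENNReal.half_pos hε.ne')))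
  refine ⟨N, fun m hm n hn => (h m n).trans_lt ?_⟩
  rw [← ENNReal.add_halves ε]
  exact ENNReal.add_lt_add (hN m hm) (hN n hn)

/-- A uniform limit of càdlàg functions is càdlàg. -/
lemma isCadlag_of_uniform_limit [CompleteSpace E] {f : TimeInterval T → E}
    {g : ℕ → TimeInterval T → E} {M : ℕ → ℝ≥0∞} (hM : Tendsto M atTop (𝓝 0))
    (hle : ∀ k v, edist (f v) (g k v) ≤ M k) (hg : ∀ k, IsCadlag (g k)) : IsCadlag f := by
  have hunif : TendstoUniformly g f atTop := by
    rw [EMetric.tendstoUniformly_iff]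
    intro ε hε
    filter_upwards [hM.eventually (gt_mem_nhds hε)] with k hk v
    exact (hle k v).trans_lt hk
  intro τ
  refine ⟨hunif.tendsto_of_eventually_tendsto (Eventually.of_forall fun k => (hg k τ).1)
    (hunif.tendsto_at τ), ?_⟩
  rcases eq_or_neBot (𝓝[<] τ) with h0 | hne
  · rw [h0]; exact ⟨0, tendsto_bot⟩
  choose l hl using fun k => (hg k τ).2
  have hcau : CauchySeq l := by
    refine cauchySeq_of_edist_le_add hM fun k m => ?_
    refine le_of_tendsto ((hl k).edist (hl m)) (Eventually.of_forall fun v => ?_)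
    calc edist (g k v) (g m v) ≤ edist (f v) (g k v) + edist (f v) (g m v) :=
          edist_triangle_left _ _ _
      _ ≤ M k + M m := add_le_add (hle k v) (hle m v)
  obtain ⟨L, hL⟩ := cauchySeq_tendsto_of_complete hcau
  exact ⟨L, hunif.tendsto_of_eventually_tendsto (Eventually.of_forall hl) hL⟩

/-- The process of Riemann sums that is stopped at the running time is càdlàg. -/
lemma isCadlag_seqSum_min {a : TimeInterval T → TimeInterval T → E} (ha : ∀ v, a v v = 0)
    (har : ∀ u v, u ≤ v → Tendsto (fun x => a u x) (𝓝[>] v) (𝓝 (a u v)))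
    (hal : ∀ u v, u < v → ∃ l, Tendsto (fun x => a u x) (𝓝[<] v) (𝓝 l))
    {u : ℕ → TimeInterval T} (hu : Monotone u) (n : ℕ) :
    IsCadlag fun v => seqSum a (fun k => min (u k) v) n := by
  -- the values of a single summand
  have h1 : ∀ k v, v ≤ u k → a (min (u k) v) (min (u (k + 1)) v) = 0 := fun k v hv => by
    rw [min_eq_right hv, min_eq_right (hv.trans (hu k.le_succ)), ha]
  have h2 : ∀ k v, u k ≤ v → v ≤ u (k + 1) →
      a (min (u k) v) (min (u (k + 1)) v) = a (u k) v := fun k v hv hv' => by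
    rw [min_eq_left hv, min_eq_right hv']
  have h3 : ∀ k v, u (k + 1) ≤ v →
      a (min (u k) v) (min (u (k + 1)) v) = a (u k) (u (k + 1)) := fun k v hv => by
    rw [min_eq_left ((hu k.le_succ).trans hv), min_eq_left hv]
  intro τ
  constructor
  · refine tendsto_finsetSum _ fun k _ => ?_
    rcases lt_or_ge τ (u k) with hk | hk
    · rw [h1 k τ hk.le]
      refine tendsto_const_nhds.congr' ?_
      filter_upwards [eventually_gt_of_lt hk] with v hv
      exact (h1 k v hv.2.le).symm
    rcases lt_or_ge τ (u (k + 1)) with hk' | hk'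
    · rw [h2 k τ hk hk'.le]
      refine (har (u k) τ hk).congr' ?_
      filter_upwards [eventually_gt_of_lt hk'] with v hv
      exact (h2 k v (hk.trans hv.1.le) hv.2.le).symm
    · rw [h3 k τ hk']
      refine tendsto_const_nhds.congr' ?_
      filter_upwards [self_mem_nhdsWithin] with v hv
      exact (h3 k v (hk'.trans (le_of_lt hv))).symm
  · have : ∀ k, ∃ l, Tendsto (fun v => a (min (u k) v) (min (u (k + 1)) v)) (𝓝[<] τ) (𝓝 l) := by
      intro k
      rcases le_or_gt τ (u k) with hk | hk
      · refine ⟨0, tendsto_const_nhds.congr' ?_⟩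
        filter_upwards [self_mem_nhdsWithin] with v hv
        exact (h1 k v ((le_of_lt hv).trans hk)).symm
      rcases le_or_gt τ (u (k + 1)) with hk' | hk'
      · obtain ⟨l, hl⟩ := hal (u k) τ hk
        refine ⟨l, hl.congr' ?_⟩
        filter_upwards [eventually_lt_of_lt hk] with v hv
        exact (h2 k v hv.1.le (hv.2.le.trans hk')).symm
      · refine ⟨a (u k) (u (k + 1)), tendsto_const_nhds.congr' ?_⟩
        filter_upwards [eventually_lt_of_lt hk'] with v hv
        exact (h3 k v hv.1.le).symm
    choose l hl using this
    exact ⟨∑ k ∈ Finset.range n, l k, tendsto_finsetSum _ fun k _ => hl k⟩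

lemma seqSum_min_eq {M : Type*} [AddCommMonoid M] {a : TimeInterval T → TimeInterval T → M}
    (ha : ∀ v, a v v = 0) {u : ℕ → TimeInterval T} (hu : Monotone u) {n l : ℕ} (hl : l < n)
    {v : TimeInterval T} (h1 : u l ≤ v) (h2 : v ≤ u (l + 1)) :
    seqSum a (fun k => min (u k) v) n = seqSum a u l + a (u l) v := by
  obtain ⟨j, rfl⟩ := Nat.exists_eq_add_of_le (Nat.succ_le_of_lt hl)
  rw [seqSum, Finset.sum_range_add, Finset.sum_range_succ, min_eq_left h1, min_eq_right h2]
  have e : ∀ i, min (u (l + 1 + i)) v = v := fun i =>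
    min_eq_right (h2.trans (hu (Nat.le_add_right _ i)))
  rw [Finset.sum_eq_zero (s := Finset.range j) fun i _ => by rw [e, add_assoc, e, ha], add_zero]
  congr 1
  refine Finset.sum_congr rfl fun i hi => ?_
  rw [Finset.mem_range] at hi
  rw [min_eq_left ((hu hi.le).trans h1), min_eq_left ((hu (Nat.succ_le_of_lt hi)).trans h1)]

lemma frequently_mem_of_denseRange {d : ℕ → TimeInterval T} (hd : DenseRange d)
    {v b : TimeInterval T} (hvb : v < b) : ∃ᶠ x in 𝓝[>] v, x < b ∧ x ∈ Set.range d := by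
  rw [Filter.frequently_iff]
  intro U hU
  obtain ⟨c, hc, hcU⟩ := (mem_nhdsGT_iff_exists_Ioo_subset' hvb).1 hU
  obtain ⟨x, hx, hvx, hxc⟩ := hd.exists_between (lt_min hc hvb)
  exact ⟨x, hcU ⟨hvx, hxc.trans_le (min_le_left _ _)⟩, hxc.trans_le (min_le_right _ _), hx⟩

end Cadlag

section Versions

variable {T : ℝ} {Ω : Type*} {mΩ : MeasurableSpace Ω} {P : Measure Ω} [IsProbabilityMeasure P]
  {F : Filtration (TimeInterval T) mΩ} {q : ℝ} {r : ℝ≥0∞} {α β : ℝ} {B : ℝ≥0∞}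
  {w : TimeInterval T → TimeInterval T → ℝ≥0∞} {s t a b : TimeInterval T}
  {E : Type*} [NormedAddCommGroup E]
  {A : TimeInterval T → TimeInterval T → Ω → E}
  {H : Type*} [NormedAddCommGroup H] [InnerProductSpace ℝ H] [CompleteSpace H]

lemma condNorm_iSup_le_of_monotone (hq : 2 ≤ q) (hr : 1 ≤ r) {f : ℕ → Ω → ℝ≥0∞}
    (hf : ∀ n, AEMeasurable (f n) P) (hmono : Monotone f) {R : ℝ≥0∞}
    (h : ∀ n, condNorm F P q r s (f n) ≤ R) :
    condNorm F P q r s (fun ω => ⨆ n, f n ω) ≤ R := by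
  have hq0 : 0 < q := by linarith
  refine condNorm_le_of_forall_weight hq hr (AEMeasurable.iSup hf) fun ρ hρ => ?_
  rw [eLpNorm_eq_lintegral_ennreal hq0, one_div, ENNReal.rpow_inv_le_iff hq0]
  have e : ∀ ω, (⨆ n, f n ω) ^ q = ⨆ n, f n ω ^ q := fun ω =>
    (ENNReal.orderIsoRpow q hq0).map_iSup _
  rw [lintegral_congr e, lintegral_iSup' (fun n => ((hf n).mono_ac weighted_ac).pow_const q)
    (Eventually.of_forall fun ω i j hij => ENNReal.rpow_le_rpow (hmono hij ω) hq0.le)]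
  refine iSup_le fun n => ?_
  rw [← eLpNorm_rpow_ennreal hq0]
  exact ENNReal.rpow_le_rpow ((hρ.eLpNorm_le_condNorm hq (hf n)).trans (h n)) hq0.le

lemma ae_tsum_ne_top (hq : 2 ≤ q) {f : ℕ → Ω → ℝ≥0∞} (hf : ∀ n, AEMeasurable (f n) P)
    (h : ∀ n, eLpNorm (f n) (ENNReal.ofReal q) P ≤ 2⁻¹ ^ n) :
    ∀ᵐ ω ∂P, ∑' n, f n ω ≠ ∞ := by
  have h1 : ∫⁻ ω, ∑' n, f n ω ∂P ≠ ∞ := by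
    rw [lintegral_tsum hf]
    refine (lt_of_le_of_lt (ENNReal.tsum_le_tsum (g := fun n => (2⁻¹ : ℝ≥0∞) ^ n) fun n => ?_)
      ?_).ne
    · calc ∫⁻ ω, f n ω ∂P = eLpNorm (f n) 1 P := by
            rw [eLpNorm_one_eq_lintegral_enorm]; simp
        _ ≤ _ := (eLpNorm_le_eLpNorm_of_exponent_le (one_le_ofReal hq)
            (hf n).aestronglyMeasurable).trans (h n)
    · rw [ENNReal.tsum_geometric]; norm_num
  filter_upwards [ae_lt_top' (AEMeasurable.tsum hf) h1] with ω hω using hω.ne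

/-- A maximal bound over finite sets of times carries over to the supremum over an interval, for a
version with right-continuous paths. -/
theorem condNorm_iSup_Icc_le (hq : 2 ≤ q) (hr : 1 ≤ r) {f g : TimeInterval T → Ω → E}
    (hst : s ≤ t) (hf : ∀ v, AEStronglyMeasurable (f v) P) (hfg : ∀ v, g v =ᵐ[P] f v)
    (hg : ∀ ω v, s ≤ v → Tendsto (fun x => g x ω) (𝓝[>] v) (𝓝 (g v ω))) {R : ℝ≥0∞}
    (h : ∀ V : Finset (TimeInterval T), (∀ v ∈ V, s ≤ v ∧ v ≤ t) →
      condNorm F P q r s (fun ω => ⨆ v ∈ V, ‖f v ω‖ₑ) ≤ R) :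
    condNorm F P q r s (fun ω => ⨆ v : Set.Icc s t, ‖g v ω‖ₑ) ≤ R := by
  classical
  have : Nonempty (TimeInterval T) := ⟨s⟩
  set d := TopologicalSpace.denseSeq (TimeInterval T)
  have hd : DenseRange d := TopologicalSpace.denseRange_denseSeq _
  set V : ℕ → Finset (TimeInterval T) := fun N =>
    insert t (((Finset.range N).image d).filter fun v => s ≤ v ∧ v ≤ t) with hV
  have hVmem : ∀ N, ∀ v ∈ V N, s ≤ v ∧ v ≤ t := by
    intro N v hv
    rcases Finset.mem_insert.1 hv with rfl | hv
    · exact ⟨hst, le_rfl⟩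
    · exact (Finset.mem_filter.1 hv).2
  have hVmono : Monotone V := by
    intro N M hNM
    exact Finset.insert_subset_insert _ (Finset.filter_subset_filter _
      (Finset.image_subset_image (Finset.range_subset_range.2 hNM)))
  have hlim := condNorm_iSup_le_of_monotone (F := F) (P := P) (s := s) (r := r)
    (f := fun N ω => ⨆ v ∈ V N, ‖f v ω‖ₑ) hq hr
    (fun N => AEMeasurable.biSup _ (V N).countable_toSet fun v _ => (hf v).enorm)
    (fun N M hNM ω => biSup_mono fun v hv => hVmono hNM hv) (fun N => h (V N) (hVmem N))
  refine (condNorm_mono_ae hq ?_).trans hlim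
  have hae : ∀ᵐ ω ∂P, ∀ N, ∀ v ∈ V N, g v ω = f v ω := by
    rw [ae_all_iff]
    intro N
    exact (ae_ball_iff (V N).countable_toSet).2 fun v _ => hfg v
  filter_upwards [hae] with ω hω
  have hbound : ∀ N, ∀ v ∈ V N, ‖g v ω‖ₑ ≤ ⨆ N, ⨆ v ∈ V N, ‖f v ω‖ₑ := by
    intro N v hv
    rw [hω N v hv]
    exact le_iSup_of_le N (le_iSup₂ (f := fun v _ => ‖f v ω‖ₑ) v hv)
  refine iSup_le fun v => ?_
  obtain ⟨v, hsv, hvt⟩ := v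
  rcases hvt.eq_or_lt with rfl | hlt
  · exact hbound 0 v (Finset.mem_insert_self _ _)
  · refine le_of_tendsto_of_frequently (hg ω v hsv).enorm ?_
    refine ((frequently_mem_of_denseRange hd hlt).and_eventually self_mem_nhdsWithin).mono ?_
    rintro x ⟨⟨hxt, i, rfl⟩, hvx⟩
    refine hbound (i + 1) _ (Finset.mem_insert_of_mem (Finset.mem_filter.2 ⟨?_, ?_, hxt.le⟩))
    · exact Finset.mem_image_of_mem _ (by simp)
    · exact hsv.trans (le_of_lt hvx)

variable [NormedSpace ℝ E] [CompleteSpace E]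

/-- Existence of the integral process, from the convergence of the sums over every interval. -/
theorem exists_adapted_isSewingLimit [Fact (0 < T)]
    (h : ∀ s t, s ≤ t → ∃ B w, B ≠ ∞ ∧ IsSewableOn F P q r α β B w A s t) (hq : 2 ≤ q)
    (hr : 1 ≤ r) (hα : 1 < α) (hβ : 1 / 2 < β) (hβα : β ≤ α) {K : ℝ≥0} (e : E ≃L[ℝ] H)
    (he : ∀ x, ‖x‖ ≤ ‖e x‖ ∧ ‖e x‖ ≤ K * ‖x‖) :
    ∃ I : TimeInterval T → Ω → E, StronglyAdapted F I ∧ (∀ t, MemLp (I t) (ENNReal.ofReal q) P) ∧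
      I (initialTime T) =ᵐ[P] 0 ∧ ∀ s t, s ≤ t → IsSewingLimit F P q r A s t (I t - I s) := by
  have hinit : ∀ t : TimeInterval T, initialTime T ≤ t := fun t => t.2.1
  have hex : ∀ s t, s ≤ t → ∃ D : Ω → E, StronglyMeasurable[F t] D ∧
      MemLp D (ENNReal.ofReal q) P ∧ IsSewingLimit F P q r A s t D := fun s t hst => by
    obtain ⟨B, w, hB, hS⟩ := h s t hst
    exact hS.exists_isSewingLimit hst hB hq hr hα hβ hβα e he
  choose I hIm hIq hI using fun t => hex (initialTime T) t (hinit t)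
  refine ⟨I, hIm, hIq, ?_, fun s t hst => ?_⟩
  · obtain ⟨B, w, _, hS⟩ := h (initialTime T) (initialTime T) le_rfl
    have h0 := hS.ae_eq_add hq hr le_rfl le_rfl (hIq _) (hIq _) (hIq _) (hI _) (hI _) (hI _)
    filter_upwards [h0] with ω hω
    simpa using hω
  · obtain ⟨D, _, hDq, hD⟩ := hex s t hst
    obtain ⟨B, w, _, hS⟩ := h (initialTime T) t (hinit t)
    refine hD.congr hq ?_
    filter_upwards [hS.ae_eq_add hq hr (hinit s) hst (hIq t) (hIq s) hDq (hI t) (hI s) hD]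
      with ω hω
    simp [hω]

/-- The sewing limit is uniformly close to a suitable stopped Riemann sum. -/
theorem IsSewableOn.exists_condNorm_iSup_sub_le (h : IsSewableOn F P q r α β B w A s t)
    (hst : s ≤ t) (hB : B ≠ ∞) (hq : 2 ≤ q) (hr : 1 ≤ r)
    (hα : 1 < α) (hβ : 1 / 2 < β) (hβα : β ≤ α) {K : ℝ≥0} (e : E ≃L[ℝ] H)
    (he : ∀ x, ‖x‖ ≤ ‖e x‖ ∧ ‖e x‖ ≤ K * ‖x‖) {I : TimeInterval T → Ω → E}
    (hIm : StronglyAdapted F I) (hIq : ∀ v, MemLp (I v) (ENNReal.ofReal q) P)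
    (hI : ∀ a b, s ≤ a → a ≤ b → b ≤ t → IsSewingLimit F P q r A a b (I b - I a))
    {ε : ℝ≥0∞} (hε : 0 < ε) :
    ∃ u n, IsTimeSeq s t u n ∧ ∀ V : Finset (TimeInterval T), (∀ v ∈ V, s ≤ v ∧ v ≤ t) →
      condNorm F P q r s
        (fun ω => ⨆ v ∈ V, ‖(I v - I s - seqSum A (fun k => min (u k) v) n) ω‖ₑ) ≤ ε := by
  classical
  set c : ℝ≥0∞ := (sewConst q K α β + driftConst α) * B with hc
  have hct : c ≠ ∞ := ENNReal.mul_ne_top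
    (ENNReal.add_ne_top.2 ⟨sewConst_ne_top hα, driftConst_ne_top hα⟩) hB
  obtain ⟨η, hη, hηle⟩ := exists_control_threshold (aggConst q K) hα hβ hct hε
  obtain ⟨u, n, hu, hQ⟩ := exists_timeSeq (Q := fun a b => w a b ≤ η) hst
    (fun τ h1 h2 => (h.small_left τ h1 h2).eventually (ge_mem_nhds hη))
    (fun τ h1 h2 => (h.small_right τ h1 h2).eventually (ge_mem_nhds hη))
  refine ⟨u, n, hu, fun V hV => ?_⟩
  set Z : ℕ → Ω → E := fun l => I (u (l + 1)) - I (u l) - A (u l) (u (l + 1)) with hZ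
  set W : ℕ → Finset (TimeInterval T) := fun l =>
    insert (u (l + 1)) (V.filter fun v => u l ≤ v ∧ v ≤ u (l + 1)) with hW
  have hWmem : ∀ l, ∀ v ∈ W l, u l ≤ v ∧ v ≤ u (l + 1) := by
    intro l v hv
    rcases Finset.mem_insert.1 hv with rfl | hv
    · exact ⟨hu.mono l.le_succ, le_rfl⟩
    · exact (Finset.mem_filter.1 hv).2
  set Zs : ℕ → Ω → ℝ≥0∞ := fun l ω => ⨆ v ∈ W l, ‖(I v - I (u l) - A (u l) v) ω‖ₑ with hZs
  have hZq : ∀ a b, MemLp (I b - I a - A a b) (ENNReal.ofReal q) P := fun a b =>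
    ((hIq b).sub (hIq a)).sub (h.memLp a b)
  have hblocks := condNorm_iSup_blocks_le_of_small (F := F) (P := P) (r := r) (s := s) hq hr e he
    hu.mono hu.zero.ge (Z := Z) (Zs := Zs)
    (fun l => ((hIm _).sub ((hIm _).mono (F.mono (hu.mono l.le_succ)))).sub
      ((h.meas _ _).mono (F.mono (hu.mono l.le_succ))))
    (fun l => hZq _ _)
    (fun l => AEMeasurable.biSup _ (W l).countable_toSet fun v _ => (hZq _ _).1.enorm)
    (fun l ω => le_iSup₂ (f := fun v _ => ‖(I v - I (u l) - A (u l) v) ω‖ₑ) (u (l + 1))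
      (Finset.mem_insert_self _ _))
    hα hβ (c := c) (ε := η)
    (x := fun l => w (u l) (u (l + 1))) (fun l hl => (hQ l hl).2) (h.sum_le_one hu)
    (fun l _ => (h.condNorm_iSup_limit_le hq hr hα hβ hβα e he (hu.mem l).1 (hu.mono l.le_succ)
      (hu.mem _).2 hIq (fun v h1 h2 => hI _ _ (hu.mem l).1 h1 (h2.trans (hu.mem _).2)) (W l)
      (hWmem l)).trans (by rw [hc]; gcongr; exact le_self_add))
    (fun l _ => (h.eLpNorm_condExp_limit_le hq hr hα (hu.mem l).1 (hu.mono l.le_succ) (hu.mem _).2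
      ((hIq _).sub (hIq _)) (hI _ _ (hu.mem l).1 (hu.mono l.le_succ) (hu.mem _).2)).trans
      (by rw [hc]; gcongr; exact le_add_self))
  -- before `v` there are complete blocks, the last one is incomplete
  refine (condNorm_mono hq fun ω => iSup₂_le fun v hv => ?_).trans (hblocks.trans hηle)
  rcases Nat.eq_zero_or_pos n with rfl | hn
  · have e1 : s = t := by rw [← hu.zero, hu.last 0 le_rfl]
    have e2 : v = s := le_antisymm (e1 ▸ (hV v hv).2) (hV v hv).1
    simp [seqSum, e2]
  obtain ⟨l, hl, h1, h2⟩ := exists_block (c := u) (hu.zero ▸ (hV v hv).1)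
    (hu.last n le_rfl ▸ (hV v hv).2) hn
  refine le_trans ?_ (le_iSup₂ (f := fun l (_ : l ∈ Finset.range n) =>
    ‖(∑ j ∈ Finset.range l, Z j) ω‖ₑ + Zs l ω) l (Finset.mem_range.2 hl))
  have e1 : ∑ j ∈ Finset.range l, Z j = I (u l) - I s - seqSum A u l := by
    rw [hZ, Finset.sum_sub_distrib, Finset.sum_range_sub (fun j => I (u j)), hu.zero]
    rfl
  have e2 : (I v - I s - seqSum A (fun k => min (u k) v) n) ω =
      (∑ j ∈ Finset.range l, Z j) ω + (I v - I (u l) - A (u l) v) ω := by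
    rw [seqSum_min_eq h.diag hu.mono hl h1 h2, e1]
    simp only [Pi.sub_apply, Pi.add_apply]
    abel
  rw [e2]
  refine (enorm_add_le _ _).trans (add_le_add le_rfl ?_)
  exact le_iSup₂ (f := fun v (_ : v ∈ W l) => ‖(I v - I (u l) - A (u l) v) ω‖ₑ) v
    (Finset.mem_insert_of_mem (Finset.mem_filter.2 ⟨hv, h1, h2⟩))

/-- The sewing limit has a càdlàg version if the filtration is complete. -/
theorem IsSewableOn.exists_cadlag_version [Fact (0 < T)]
    (h : IsSewableOn F P q r α β B w A (initialTime T) (finalTime T))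
    (hB : B ≠ ∞) (hq : 2 ≤ q) (hr : 1 ≤ r)
    (hα : 1 < α) (hβ : 1 / 2 < β) (hβα : β ≤ α) {K : ℝ≥0} (e : E ≃L[ℝ] H)
    (he : ∀ x, ‖x‖ ≤ ‖e x‖ ∧ ‖e x‖ ≤ K * ‖x‖) {I : TimeInterval T → Ω → E}
    (hIm : StronglyAdapted F I) (hIq : ∀ v, MemLp (I v) (ENNReal.ofReal q) P)
    (hI0 : I (initialTime T) =ᵐ[P] 0)
    (hI : ∀ a b, a ≤ b → IsSewingLimit F P q r A a b (I b - I a))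
    (hAr : ∀ ω u v, u ≤ v → Tendsto (fun x => A u x ω) (𝓝[>] v) (𝓝 (A u v ω)))
    (hAl : ∀ ω u v, u < v → ∃ l, Tendsto (fun x => A u x ω) (𝓝[<] v) (𝓝 l))
    (hF : IsCompleteFiltration F P) :
    ∃ J : TimeInterval T → Ω → E, StronglyAdapted F J ∧ (∀ t, J t =ᵐ[P] I t) ∧
      ∀ ω, IsCadlag fun t => J t ω := by
  classical
  set s₀ := initialTime T with hs₀
  set t₀ := finalTime T with ht₀
  have hmemT : ∀ v : TimeInterval T, s₀ ≤ v ∧ v ≤ t₀ := fun v => ⟨v.2.1, v.2.2⟩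
  have : Nonempty (TimeInterval T) := ⟨s₀⟩
  choose u n hu hVle using fun k : ℕ => h.exists_condNorm_iSup_sub_le (hmemT t₀).1 hB hq hr hα hβ
    hβα e he hIm hIq (fun a b _ hab _ => hI a b hab) (ε := (2⁻¹ : ℝ≥0∞) ^ k)
    (ENNReal.pow_pos (by norm_num) k)
  set S : ℕ → TimeInterval T → Ω → E := fun k v => seqSum A (fun i => min (u k i) v) (n k) with hS
  have hSm : ∀ k v, StronglyMeasurable[F v] (S k v) := fun k v =>
    h.meas_seqSum (fun i => min_le_right _ _) _
  -- a dense sequence of times that contains the final time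
  set d : ℕ → TimeInterval T := fun i =>
    Nat.casesOn i t₀ (TopologicalSpace.denseSeq (TimeInterval T)) with hd
  have hd0 : d 0 = t₀ := rfl
  have hdense : DenseRange d := by
    refine (TopologicalSpace.denseRange_denseSeq (TimeInterval T)).mono ?_
    rintro _ ⟨i, rfl⟩
    exact ⟨i + 1, rfl⟩
  set Δ : ℕ → TimeInterval T → Ω → E := fun k v => I v - I s₀ - S k v with hΔ
  have hΔm : ∀ k v, StronglyMeasurable (Δ k v) := fun k v =>
    (((hIm v).mono (F.le v)).sub ((hIm s₀).mono (F.le s₀))).sub ((hSm k v).mono (F.le v))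
  set M : ℕ → Ω → ℝ≥0∞ := fun k ω => ⨆ i, ‖Δ k (d i) ω‖ₑ with hM
  have hMm : ∀ k, Measurable (M k) := fun k =>
    Measurable.iSup fun i => (hΔm k (d i)).enorm
  have hMle : ∀ k, eLpNorm (M k) (ENNReal.ofReal q) P ≤ 2⁻¹ ^ k := by
    intro k
    have h1 := condNorm_iSup_le_of_monotone (F := F) (P := P) (s := s₀) (r := r) hq hr
      (f := fun N ω => ⨆ v ∈ (Finset.range N).image d, ‖Δ k v ω‖ₑ)
      (fun N => AEMeasurable.biSup _ (Finset.countable_toSet _) fun v _ =>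
        (hΔm k v).enorm.aemeasurable)
      (fun N N' hN ω => biSup_mono fun v hv =>
        Finset.image_subset_image (Finset.range_subset_range.2 hN) hv)
      (fun N => hVle k _ fun v _ => hmemT v)
    have h2 := (isWeight_one (m := F s₀) (P := P) hr).eLpNorm_le_condNorm hq
      (hMm k).aemeasurable
    rw [weighted_one] at h2
    refine h2.trans ((condNorm_mono hq fun ω => iSup_le fun i => ?_).trans h1)
    exact le_iSup_of_le (i + 1) (le_iSup₂ (f := fun v (_ : v ∈ (Finset.range (i + 1)).image d) =>
      ‖Δ k v ω‖ₑ) (d i) (Finset.mem_image_of_mem _ (by simp)))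
  -- on `G` the stopped Riemann sums converge uniformly; completeness puts `G` into `F_0`
  set G : Set Ω := {ω | ∑' k, M k ω ≠ ∞} with hG
  have hGm : MeasurableSet[F s₀] G := by
    have hm : MeasurableSet Gᶜ := by
      have : Gᶜ = {ω | ∑' k, M k ω = ∞} := by ext ω; simp [hG]
      rw [this]
      exact (Measurable.tsum hMm) (measurableSet_singleton _)
    have h0 : P Gᶜ = 0 := ae_tsum_ne_top hq (fun k => (hMm k).aemeasurable) hMle
    exact MeasurableSet.of_compl (hF _ hm h0)
  have hGae : ∀ᵐ ω ∂P, ω ∈ G := ae_tsum_ne_top hq (fun k => (hMm k).aemeasurable) hMle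
  have hMlim : ∀ ω ∈ G, Tendsto (fun k => M k ω) atTop (𝓝 0) := fun ω hω =>
    ENNReal.tendsto_atTop_zero_of_tsum_ne_top hω
  have hcadlag : ∀ k ω, IsCadlag fun v => S k v ω := by
    intro k ω
    have h1 := isCadlag_seqSum_min (a := fun x y => A x y ω) (fun v => by rw [h.diag]; rfl)
      (hAr ω) (hAl ω) (hu k).mono (n k)
    have e1 : ∀ v, S k v ω = seqSum (fun x y => A x y ω) (fun i => min (u k i) v) (n k) :=
      fun v => by simp [hS, seqSum]
    simpa only [e1] using h1
  -- the bound on the dense set extends by right-continuity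
  have hSS : ∀ ω k l v, edist (S k v ω) (S l v ω) ≤ M k ω + M l ω := by
    intro ω k l
    have hdd : ∀ i, edist (S k (d i) ω) (S l (d i) ω) ≤ M k ω + M l ω := by
      intro i
      have e1 : S k (d i) ω - S l (d i) ω = Δ l (d i) ω - Δ k (d i) ω := by
        simp only [hΔ, Pi.sub_apply]; abel
      rw [edist_eq_enorm_sub, e1]
      refine enorm_sub_le.trans ?_
      rw [add_comm]
      exact add_le_add (le_iSup (fun i => ‖Δ k (d i) ω‖ₑ) i) (le_iSup (fun i => ‖Δ l (d i) ω‖ₑ) i)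
    intro v
    rcases (hmemT v).2.eq_or_lt with rfl | hlt
    · exact hdd 0
    · refine le_of_tendsto_of_frequently ((hcadlag k ω v).1.edist (hcadlag l ω v).1) ?_
      refine (frequently_mem_of_denseRange hdense hlt).mono ?_
      rintro x ⟨_, i, rfl⟩
      exact hdd i
  set J : TimeInterval T → Ω → E := fun v => G.indicator fun ω =>
    limUnder atTop fun k => S k v ω
    with hJ
  have hJlim : ∀ ω ∈ G, ∀ v, Tendsto (fun k => S k v ω) atTop (𝓝 (J v ω)) := by
    intro ω hω v
    rw [hJ]
    simp only [Set.indicator_of_mem hω]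
    exact tendsto_nhds_limUnder (cauchySeq_tendsto_of_complete
      (cauchySeq_of_edist_le_add (hMlim ω hω) fun k l => hSS ω k l v))
  refine ⟨J, fun v => ?_, fun v => ?_, fun ω => ?_⟩
  · refine stronglyMeasurable_of_tendsto (u := atTop) (f := fun k => G.indicator (S k v))
      (fun k => (hSm k v).indicator (F.mono (hmemT v).1 _ hGm)) ?_
    rw [tendsto_pi_nhds]
    intro ω
    by_cases hω : ω ∈ G
    · simpa [hω] using hJlim ω hω v
    · simp [hω, hJ]
  · have h1 : ∀ k, eLpNorm (fun ω => ‖Δ k v ω‖ₑ) (ENNReal.ofReal q) P ≤ 2⁻¹ ^ k := by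
      intro k
      rw [eLpNorm_enorm]
      refine (eLpNorm_le_condNorm (F := F) (s := s₀) hq hr
        (hΔm k v).aestronglyMeasurable).trans ?_
      simpa [hΔ] using hVle k {v} fun x _ => hmemT x
    filter_upwards [hGae, hI0, ae_tsum_ne_top hq (fun k => (hΔm k v).enorm.aemeasurable) h1]
      with ω hω h0 hsum
    refine tendsto_nhds_unique (hJlim ω hω v) ?_
    rw [tendsto_iff_edist_tendsto_0]
    refine (ENNReal.tendsto_atTop_zero_of_tsum_ne_top hsum).congr fun k => ?_
    have h0' : I s₀ ω = 0 := h0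
    rw [edist_comm, edist_eq_enorm_sub]
    simp [hΔ, h0']
  · by_cases hω : ω ∈ G
    · refine isCadlag_of_uniform_limit (hMlim ω hω) (fun k v => ?_) (fun k => hcadlag k ω)
      have h2 : Tendsto (fun l => M l ω + M k ω) atTop (𝓝 (0 + M k ω)) :=
        (hMlim ω hω).add_const _
      rw [zero_add] at h2
      exact le_of_tendsto_of_tendsto' ((hJlim ω hω v).edist tendsto_const_nhds) h2
        fun l => hSS ω l k v
    · have e1 : ∀ v, J v ω = 0 := fun v => by simp [hJ, hω]
      simp only [e1]
      exact fun v => ⟨tendsto_const_nhds, 0, tendsto_const_nhds⟩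

end Versions

/-! ### Controls built from variation norms -/

section Controls

variable {T : ℝ} {γ : ℝ} {φ φ₁ φ₂ φ₃ φ₄ : TimeInterval T → TimeInterval T → ℝ≥0∞}

/-- `φ ^ γ` is a finite superadditive function that vanishes on short intervals on either side of a
point. -/
structure IsSmallControl (γ : ℝ) (φ : TimeInterval T → TimeInterval T → ℝ≥0∞) : Prop where
  superadd : ∀ a c b, a ≤ c → c ≤ b → φ a c ^ γ + φ c b ^ γ ≤ φ a b ^ γ
  ne_top : ∀ a b, a ≤ b → φ a b ≠ ∞
  right : ∀ τ, Tendsto (fun v => φ τ v) (𝓝[>] τ) (𝓝 0)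
  left : ∀ τ, Tendsto (fun u => φ u τ) (𝓝[<] τ) (𝓝 0)

lemma isSmallControl_zero (hγ : 0 < γ) :
    IsSmallControl γ (fun _ _ : TimeInterval T => (0 : ℝ≥0∞)) where
  superadd _ _ _ _ _ := by simp [ENNReal.zero_rpow_of_pos hγ]
  ne_top _ _ _ := by simp
  right _ := tendsto_const_nhds
  left _ := tendsto_const_nhds

lemma IsSmallControl.const_mul (h : IsSmallControl γ φ) (hγ : 0 < γ) {c : ℝ≥0∞} (hc : c ≠ ∞) :
    IsSmallControl γ (fun a b => c * φ a b) where
  superadd a m b h1 h2 := by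
    simp only [ENNReal.mul_rpow_of_nonneg _ _ hγ.le]
    rw [← mul_add]
    gcongr
    exact h.superadd a m b h1 h2
  ne_top a b hab := ENNReal.mul_ne_top hc (h.ne_top a b hab)
  right τ := by simpa using ENNReal.Tendsto.const_mul (h.right τ) (Or.inr hc)
  left τ := by simpa using ENNReal.Tendsto.const_mul (h.left τ) (Or.inr hc)

/-- The product of a variation over half-open intervals and a variation of a function that is
right-continuous in its first argument. The first factor is small to the left of a point, the second
one to the right. -/
lemma isSmallControl_mul [Fact (0 < T)] {p₁ p₂ : ℝ} {g₁ g₂ : TimeInterval T → TimeInterval T → ℝ≥0∞}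
    (hp₁ : 0 < p₁) (hp₂ : 0 < p₂) (hγ : 0 < γ) (hsum : γ / p₁ + γ / p₂ = 1)
    (h₁ : pVar p₁ g₁ (initialTime T) (finalTime T) ≠ ∞)
    (h₂ : pVar p₂ g₂ (initialTime T) (finalTime T) ≠ ∞)
    (hg : ∀ s v, s < v → Tendsto (fun u => g₂ u v) (𝓝[>] s) (𝓝 (g₂ s v))) :
    IsSmallControl γ fun a b => pVarLeft p₁ g₁ a b * pVar p₂ g₂ a b := by
  have hmem : ∀ v : TimeInterval T, initialTime T ≤ v ∧ v ≤ finalTime T := fun v => v.2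
  have f₁ : ∀ a b, a ≤ b → pVarLeft p₁ g₁ a b ≤ pVar p₁ g₁ (initialTime T) (finalTime T) :=
    fun a b hab => (pVarLeft_le_pVar hp₁).trans (pVar_mono hp₁ (hmem a).1 hab (hmem b).2)
  have f₂ : ∀ a b, a ≤ b → pVar p₂ g₂ a b ≤ pVar p₂ g₂ (initialTime T) (finalTime T) :=
    fun a b hab => pVar_mono hp₂ (hmem a).1 hab (hmem b).2
  have e : ∀ a b, (pVarLeft p₁ g₁ a b * pVar p₂ g₂ a b) ^ γ =
      (pVarLeft p₁ g₁ a b ^ p₁) ^ (γ / p₁) * (pVar p₂ g₂ a b ^ p₂) ^ (γ / p₂) := fun a b => by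
    rw [ENNReal.mul_rpow_of_nonneg _ _ hγ.le, ← ENNReal.rpow_mul, ← ENNReal.rpow_mul,
      mul_div_cancel₀ _ hp₁.ne', mul_div_cancel₀ _ hp₂.ne']
  refine ⟨fun a c b hac hcb => ?_, fun a b hab => ?_, fun τ => ?_, fun τ => ?_⟩
  · simp only [e]
    exact mul_rpow_add_mul_rpow_le (by positivity) (by positivity) hsum
      (pVarLeft_rpow_add_le hp₁ hac hcb) (pVar_rpow_add_le hp₂ hac hcb)
  · exact ENNReal.mul_ne_top ((f₁ a b hab).trans_lt h₁.lt_top).ne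
      ((f₂ a b hab).trans_lt h₂.lt_top).ne
  · rcases (hmem τ).2.eq_or_lt with rfl | hlt
    · have : 𝓝[>] (finalTime T) = ⊥ := by
        have h0 : Set.Ioi (finalTime T) = ∅ := by
          ext v
          simpa using (hmem v).2
        rw [h0, nhdsWithin_empty]
      rw [this]; exact tendsto_bot
    · have h3 := tendsto_pVar_right hp₂ hlt ((f₂ _ _ (hmem τ).2).trans_lt h₂.lt_top).ne
        (fun v hv => hg τ v hv)
      have h4 := ENNReal.Tendsto.const_mul
        (a := pVar p₁ g₁ (initialTime T) (finalTime T)) h3 (Or.inr h₁)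
      rw [mul_zero] at h4
      refine tendsto_of_tendsto_of_tendsto_of_le_of_le' tendsto_const_nhds h4
        (Eventually.of_forall fun _ => zero_le) ?_
      filter_upwards [self_mem_nhdsWithin] with v hv
      gcongr
      exact f₁ τ v (le_of_lt hv)
  · rcases (hmem τ).1.eq_or_lt with rfl | hlt
    · have : 𝓝[<] (initialTime T) = ⊥ := by
        have h0 : Set.Iio (initialTime T) = ∅ := by
          ext v
          simpa using (hmem v).1
        rw [h0, nhdsWithin_empty]
      rw [this]; exact tendsto_bot
    · have h3 := tendsto_pVarLeft hp₁ hlt ((f₁ _ _ (hmem τ).1).trans_lt h₁.lt_top).ne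
      have h4 := ENNReal.Tendsto.mul_const
        (b := pVar p₂ g₂ (initialTime T) (finalTime T)) h3 (Or.inr h₂)
      rw [zero_mul] at h4
      refine tendsto_of_tendsto_of_tendsto_of_le_of_le' tendsto_const_nhds h4
        (Eventually.of_forall fun _ => zero_le) ?_
      filter_upwards [self_mem_nhdsWithin] with v hv
      gcongr
      exact f₂ v τ (le_of_lt hv)

/-- The normalized sum of four controls, the first two with exponent `p / 3` and the last two with
exponent `p / 2`. -/
noncomputable def mixedControl (p : ℝ) (B : ℝ≥0∞)
    (φ₁ φ₂ φ₃ φ₄ : TimeInterval T → TimeInterval T → ℝ≥0∞) (a b : TimeInterval T) : ℝ≥0∞ :=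
  ((φ₁ a b / B) ^ (p / 3) + (φ₂ a b / B) ^ (p / 3)
    + ((φ₃ a b / B) ^ (p / 2) + (φ₄ a b / B) ^ (p / 2))) / 4

section Mixed

variable {p : ℝ} {B : ℝ≥0∞}

lemma mixedControl_superadd (hp : 0 < p) (h₁ : IsSmallControl (p / 3) φ₁)
    (h₂ : IsSmallControl (p / 3) φ₂) (h₃ : IsSmallControl (p / 2) φ₃)
    (h₄ : IsSmallControl (p / 2) φ₄) {a c b : TimeInterval T} (hac : a ≤ c) (hcb : c ≤ b) :
    mixedControl p B φ₁ φ₂ φ₃ φ₄ a c + mixedControl p B φ₁ φ₂ φ₃ φ₄ c b ≤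
      mixedControl p B φ₁ φ₂ φ₃ φ₄ a b := by
  have key : ∀ {γ : ℝ} {φ : TimeInterval T → TimeInterval T → ℝ≥0∞}, 0 < γ → IsSmallControl γ φ →
      (φ a c / B) ^ γ + (φ c b / B) ^ γ ≤ (φ a b / B) ^ γ := by
    intro γ φ hγ h
    simp only [ENNReal.div_rpow_of_nonneg _ _ hγ.le]
    rw [ENNReal.div_add_div_same]
    gcongr
    exact h.superadd a c b hac hcb
  have k₁ := key (by positivity) h₁
  have k₂ := key (by positivity) h₂
  have k₃ := key (by positivity) h₃
  have k₄ := key (by positivity) h₄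
  unfold mixedControl
  rw [ENNReal.div_add_div_same]
  refine ENNReal.div_le_div_right ?_ _
  calc _ = ((φ₁ a c / B) ^ (p / 3) + (φ₁ c b / B) ^ (p / 3))
        + ((φ₂ a c / B) ^ (p / 3) + (φ₂ c b / B) ^ (p / 3))
        + (((φ₃ a c / B) ^ (p / 2) + (φ₃ c b / B) ^ (p / 2))
        + ((φ₄ a c / B) ^ (p / 2) + (φ₄ c b / B) ^ (p / 2))) := by ring
    _ ≤ _ := add_le_add (add_le_add k₁ k₂) (add_le_add k₃ k₄)

lemma mixedControl_le_one (hp : 0 < p) {a b : TimeInterval T} (h₁ : φ₁ a b ≤ B) (h₂ : φ₂ a b ≤ B)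
    (h₃ : φ₃ a b ≤ B) (h₄ : φ₄ a b ≤ B) : mixedControl p B φ₁ φ₂ φ₃ φ₄ a b ≤ 1 := by
  have key : ∀ {x : ℝ≥0∞} {γ : ℝ}, 0 < γ → x ≤ B → (x / B) ^ γ ≤ 1 := fun hγ hx =>
    ENNReal.rpow_le_one ((ENNReal.div_le_div_right hx _).trans ENNReal.div_self_le_one) hγ.le
  have k₁ := key (γ := p / 3) (by positivity) h₁
  have k₂ := key (γ := p / 3) (by positivity) h₂
  have k₃ := key (γ := p / 2) (by positivity) h₃
  have k₄ := key (γ := p / 2) (by positivity) h₄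
  unfold mixedControl
  refine ENNReal.div_le_of_le_mul ?_
  calc _ ≤ (1 : ℝ≥0∞) + 1 + (1 + 1) := add_le_add (add_le_add k₁ k₂) (add_le_add k₃ k₄)
    _ = 1 * 4 := by norm_num

lemma tendsto_mixedControl (hp : 0 < p) (hB : B ≠ 0) {ι : Type*} {l : Filter ι}
    {f g : ι → TimeInterval T}
    (h₁ : Tendsto (fun i => φ₁ (f i) (g i)) l (𝓝 0)) (h₂ : Tendsto (fun i => φ₂ (f i) (g i)) l (𝓝 0))
    (h₃ : Tendsto (fun i => φ₃ (f i) (g i)) l (𝓝 0))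
    (h₄ : Tendsto (fun i => φ₄ (f i) (g i)) l (𝓝 0)) :
    Tendsto (fun i => mixedControl p B φ₁ φ₂ φ₃ φ₄ (f i) (g i)) l (𝓝 0) := by
  have key : ∀ {x : ι → ℝ≥0∞} {γ : ℝ}, 0 < γ → Tendsto x l (𝓝 0) →
      Tendsto (fun i => (x i / B) ^ γ) l (𝓝 0) := by
    intro x γ hγ hx
    have h := (ENNReal.Tendsto.div_const hx (b := B) (Or.inr hB)).ennrpow_const γ
    rwa [ENNReal.zero_div, ENNReal.zero_rpow_of_pos hγ] at h
  have k := ENNReal.Tendsto.div_const (((key (γ := p / 3) (by positivity) h₁).add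
    (key (γ := p / 3) (by positivity) h₂)).add ((key (γ := p / 2) (by positivity) h₃).add
    (key (γ := p / 2) (by positivity) h₄))) (b := 4) (Or.inr (by norm_num))
  simpa [mixedControl] using k

lemma le_of_rpow_le_mixed (hB : B ≠ 0) (hBt : B ≠ ∞) {x m : ℝ≥0∞} {γ : ℝ} (hγ : 2 / 3 ≤ γ)
    (h : (x / B) ^ γ ≤ 4 * m) : x ≤ 8 * B * m ^ γ⁻¹ := by
  have hγ0 : 0 < γ := by linarith
  have h1 : x / B ≤ (4 * m) ^ γ⁻¹ := (ENNReal.le_rpow_inv_iff hγ0).2 h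
  have h2 : (4 : ℝ≥0∞) ^ γ⁻¹ ≤ 8 := by
    calc (4 : ℝ≥0∞) ^ γ⁻¹ ≤ 4 ^ (3 / 2 : ℝ) := by
          -- `γ` is `p / 3` or `p / 2`, and `p ≥ 2`
          refine ENNReal.rpow_le_rpow_of_exponent_le (by norm_num) ?_
          rw [inv_le_comm₀ hγ0 (by norm_num)]
          norm_num
          linarith
      _ = 8 := by
          rw [show (4 : ℝ≥0∞) = 2 ^ (2 : ℝ) by norm_num, ← ENNReal.rpow_mul]
          norm_num
  calc x = x / B * B := (ENNReal.div_mul_cancel hB hBt).symm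
    _ ≤ (4 * m) ^ γ⁻¹ * B := by gcongr
    _ = 4 ^ γ⁻¹ * B * m ^ γ⁻¹ := by
        rw [ENNReal.mul_rpow_of_nonneg _ _ (inv_nonneg.2 hγ0.le)]; ring
    _ ≤ _ := by gcongr

lemma four_mul_mixedControl (a b : TimeInterval T) : 4 * mixedControl p B φ₁ φ₂ φ₃ φ₄ a b =
    (φ₁ a b / B) ^ (p / 3) + (φ₂ a b / B) ^ (p / 3)
    + ((φ₃ a b / B) ^ (p / 2) + (φ₄ a b / B) ^ (p / 2)) :=
  ENNReal.mul_div_cancel (by norm_num) (by norm_num)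

/-- The first two controls have the exponent of the conditional mean. -/
lemma add_le_mixedControl_drift (hp : 2 ≤ p) (hB : B ≠ 0) (hBt : B ≠ ∞) (a b : TimeInterval T) :
    φ₁ a b + φ₂ a b ≤ 32 * B * mixedControl p B φ₁ φ₂ φ₃ φ₄ a b ^ (3 / p) := by
  have e := four_mul_mixedControl (p := p) (B := B) (φ₁ := φ₁) (φ₂ := φ₂) (φ₃ := φ₃) (φ₄ := φ₄) a b
  have k₁ : φ₁ a b ≤ 8 * B * mixedControl p B φ₁ φ₂ φ₃ φ₄ a b ^ (p / 3)⁻¹ :=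
    le_of_rpow_le_mixed hB hBt (by linarith) (by
      rw [e, add_assoc]; exact le_self_add)
  have k₂ : φ₂ a b ≤ 8 * B * mixedControl p B φ₁ φ₂ φ₃ φ₄ a b ^ (p / 3)⁻¹ :=
    le_of_rpow_le_mixed hB hBt (by linarith) (by
      rw [e, add_comm (_ ^ (p / 3)), add_assoc]; exact le_self_add)
  rw [inv_div] at k₁ k₂
  refine (add_le_add k₁ k₂).trans ?_
  rw [← add_mul, ← add_mul]
  gcongr
  norm_num

/-- The last three controls have the exponent of the size. -/
lemma add_le_mixedControl_size (hp : 2 ≤ p) (hB : B ≠ 0) (hBt : B ≠ ∞) {a b : TimeInterval T}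
    (hone : mixedControl p B φ₁ φ₂ φ₃ φ₄ a b ≤ 1) :
    φ₃ a b + φ₄ a b + φ₂ a b ≤ 32 * B * mixedControl p B φ₁ φ₂ φ₃ φ₄ a b ^ (2 / p) := by
  have e := four_mul_mixedControl (p := p) (B := B) (φ₁ := φ₁) (φ₂ := φ₂) (φ₃ := φ₃) (φ₄ := φ₄) a b
  have k₂ : φ₂ a b ≤ 8 * B * mixedControl p B φ₁ φ₂ φ₃ φ₄ a b ^ (p / 3)⁻¹ :=
    le_of_rpow_le_mixed hB hBt (by linarith) (by
      rw [e, add_comm (_ ^ (p / 3)), add_assoc]; exact le_self_add)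
  have k₃ : φ₃ a b ≤ 8 * B * mixedControl p B φ₁ φ₂ φ₃ φ₄ a b ^ (p / 2)⁻¹ :=
    le_of_rpow_le_mixed hB hBt (by linarith) (by
      rw [e]; exact le_self_add.trans le_add_self)
  have k₄ : φ₄ a b ≤ 8 * B * mixedControl p B φ₁ φ₂ φ₃ φ₄ a b ^ (p / 2)⁻¹ :=
    le_of_rpow_le_mixed hB hBt (by linarith) (by
      rw [e]; exact le_add_self.trans le_add_self)
  rw [inv_div] at k₂ k₃ k₄
  have k₂' := k₂.trans (mul_le_mul_right (ENNReal.rpow_le_rpow_of_exponent_ge hone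
    (by gcongr; norm_num : 2 / p ≤ 3 / p)) (8 * B))
  refine (add_le_add (add_le_add k₃ k₄) k₂').trans ?_
  rw [← add_mul, ← add_mul, ← add_mul, ← add_mul]
  gcongr
  norm_num

end Mixed

end Controls

/-! ### The germ of the rough stochastic integral -/

section RoughPath

variable {T : ℝ} [Fact (0 < T)] {d : ℕ} {p : ℝ} {X : TimeInterval T → Vec d}
  {XX : TimeInterval T → TimeInterval T → Mat d}

lemma mem_initial_final (v : TimeInterval T) : initialTime T ≤ v ∧ v ≤ finalTime T := v.2

lemma tensor_zero_left : tensor (0 : Vec d) = 0 := by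
  ext y ij
  simp [tensor]

lemma enorm_tensor_le (x : Vec d) : ‖tensor x‖ₑ ≤ ‖x‖ₑ := by
  suffices h : ‖tensor x‖ ≤ ‖x‖ by
    rw [← ofReal_norm, ← ofReal_norm]
    exact ENNReal.ofReal_le_ofReal h
  refine ContinuousLinearMap.opNorm_le_bound _ (norm_nonneg x) fun y => ?_
  rw [EuclideanSpace.norm_eq, EuclideanSpace.norm_eq, EuclideanSpace.norm_eq,
    ← Real.sqrt_mul (Finset.sum_nonneg fun _ _ => sq_nonneg _)]
  refine Real.sqrt_le_sqrt (le_of_eq ?_)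
  rw [Fintype.sum_prod_type, Finset.sum_mul_sum]
  refine Finset.sum_congr rfl fun i _ => Finset.sum_congr rfl fun j _ => ?_
  simp [tensor, mul_pow]

omit [Fact (0 < T)] in
lemma enorm_incr_le_pVar (hp : 2 ≤ p) {c m b : TimeInterval T} (hcm : c ≤ m) (hmb : m ≤ b) :
    ‖X m - X c‖ₑ ≤ pVar p (incrSize X) c b :=
  (le_pVar (g := incrSize X) (by linarith) (fun s => by simp [incrSize]) hcm).trans
    (pVar_mono (by linarith) le_rfl hcm hmb)

namespace IsCadlagRoughPath

lemma diag (hX : IsCadlagRoughPath p X XX) (s : TimeInterval T) : XX s s = 0 := by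
  have h := hX.chen s s s le_rfl le_rfl
  simpa using h

lemma pVar_ne_top (hX : IsCadlagRoughPath p X XX) :
    pVar p (incrSize X) (initialTime T) (finalTime T) ≠ ∞ :=
  (le_self_add.trans_lt hX.finite_var).ne

lemma pVar_ne_top₂ (hX : IsCadlagRoughPath p X XX) :
    pVar (p / 2) (twoParamSize XX) (initialTime T) (finalTime T) ≠ ∞ :=
  (le_add_self.trans_lt hX.finite_var).ne

lemma tendsto_incrSize (hX : IsCadlagRoughPath p X XX) (s v : TimeInterval T) :
    Tendsto (fun u => incrSize X u v) (𝓝[>] s) (𝓝 (incrSize X s v)) :=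
  (tendsto_const_nhds.sub (hX.cadlag s).1).enorm

lemma tendsto_twoParamSize (hX : IsCadlagRoughPath p X XX) {s v : TimeInterval T} (hsv : s < v) :
    Tendsto (fun u => twoParamSize XX u v) (𝓝[>] s) (𝓝 (twoParamSize XX s v)) :=
  (hX.cadlag₂.right_fst s v hsv).enorm

lemma enorm_twoParam_le (hX : IsCadlagRoughPath p X XX) (hp : 2 ≤ p) {c m b : TimeInterval T}
    (hcm : c ≤ m) (hmb : m ≤ b) : ‖XX c m‖ₑ ≤ pVar (p / 2) (twoParamSize XX) c b :=
  (le_pVar (g := twoParamSize XX) (by linarith) (fun s => by simp [twoParamSize, hX.diag]) hcm).trans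
    (pVar_mono (by linarith) le_rfl hcm hmb)

end IsCadlagRoughPath

end RoughPath

section Germ

variable {T : ℝ} [Fact (0 < T)] {d : ℕ} {Ω : Type*} {mΩ : MeasurableSpace Ω} {P : Measure Ω}
  [IsProbabilityMeasure P] {F : Filtration (TimeInterval T) mΩ}
  {p q : ℝ} {r : ℝ≥0∞} {X : TimeInterval T → Vec d} {XX : TimeInterval T → TimeInterval T → Mat d}
  {E : Type*} [NormedAddCommGroup E] [NormedSpace ℝ E]
  {V : Type*} [NormedAddCommGroup V]
  {Y : TimeInterval T → Ω → Vec d →L[ℝ] E} {Y' : TimeInterval T → Ω → Mat d →L[ℝ] E}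

omit [Fact (0 < T)] [IsProbabilityMeasure P] in
lemma condIncrSize_self (hq : 2 ≤ q) (Y : TimeInterval T → Ω → V) (s : TimeInterval T) :
    condIncrSize F P q r Y s s = 0 := by
  simp [condIncrSize, condNorm_zero hq]

lemma MemVpLqr.memLp {Y : TimeInterval T → Ω → V} (hY : MemVpLqr F P p q r Y) (hp : 0 < p)
    (hq : 2 ≤ q) (hr : 1 ≤ r) (t : TimeInterval T) : MemLp (Y t) (ENNReal.ofReal q) P := by
  have hm : AEStronglyMeasurable (fun ω => Y t ω - Y (initialTime T) ω) P :=
    (hY.aestronglyMeasurable t).sub (hY.aestronglyMeasurable _)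
  have h : MemLp (fun ω => Y t ω - Y (initialTime T) ω) (ENNReal.ofReal q) P := by
    refine ⟨hm, (eLpNorm_le_condNorm (F := F) (s := initialTime T) hq hr hm).trans_lt ?_⟩
    refine lt_of_le_of_lt ?_ hY.finite_var
    exact (le_pVar (g := condIncrSize F P q r Y) hp (condIncrSize_self hq Y)
      (mem_initial_final t).1).trans
      (pVar_mono hp le_rfl (mem_initial_final t).1 (mem_initial_final t).2)
  have e : Y t = (fun ω => Y t ω - Y (initialTime T) ω) + Y (initialTime T) := by
    funext ω; simp
  rw [e]
  exact h.add hY.memLp_initial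

lemma germ_self (hX : IsCadlagRoughPath p X XX) (u : TimeInterval T) :
    germ X XX Y Y' u u = 0 := by
  funext ω
  simp [germ, hX.diag]

/-- By Chen's relation, the defect of the germ consists of a remainder that is multiplied by an
increment of `X`, and of an increment of `Y'` that is multiplied by `𝕏`. -/
lemma defect_germ (hX : IsCadlagRoughPath p X XX) {a c m : TimeInterval T} (hac : a ≤ c)
    (hcm : c ≤ m) (ω : Ω) : defect (germ X XX Y Y') a c m ω =
      -(remainder X Y Y' a c ω (X m - X c)) - (Y' c ω - Y' a ω) (XX c m) := by
  simp only [defect, germ, remainder, Pi.sub_apply, hX.chen a c m hac hcm, map_add, map_sub,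
    _root_.sub_apply, ContinuousLinearMap.comp_apply]
  abel

omit [IsProbabilityMeasure P] in
lemma memLp_apply {W : Type*} [NormedAddCommGroup W] [NormedSpace ℝ W] {f : Ω → W →L[ℝ] E}
    {ρ : ℝ≥0∞} (hf : MemLp f ρ P) (x : W) : MemLp (fun ω => f ω x) ρ P :=
  (ContinuousLinearMap.apply ℝ E x).comp_memLp' hf

omit [IsProbabilityMeasure P] in
lemma eLpNorm_apply_le {W : Type*} [NormedAddCommGroup W] [NormedSpace ℝ W] (f : Ω → W →L[ℝ] E)
    (ρ : ℝ≥0∞) (x : W) : eLpNorm (fun ω => f ω x) ρ P ≤ eLpNorm f ρ P * ‖x‖ₑ := by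
  have h := eLpNorm_le_nnreal_smul_eLpNorm_of_ae_le_mul (μ := P) (f := fun ω => f ω x) (g := f)
    (c := ‖x‖₊) (Eventually.of_forall fun ω => by rw [mul_comm]; exact (f ω).le_opNNNorm x) ρ
  rw [mul_comm]
  exact h

variable [CompleteSpace E]

omit [IsProbabilityMeasure P] in
lemma condExp_apply {W : Type*} [NormedAddCommGroup W] [NormedSpace ℝ W] {f : Ω → W →L[ℝ] E}
    (hf : Integrable f P) (m : MeasurableSpace Ω) (x : W) :
    P[fun ω => f ω x | m] =ᵐ[P] fun ω => (P[f | m] ω) x :=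
  ((ContinuousLinearMap.apply ℝ E x).comp_condExp_comm hf).symm

omit [IsProbabilityMeasure P] in
lemma eLpNorm_condExp_eq_zero {W : Type*} [NormedAddCommGroup W] [NormedSpace ℝ W]
    [CompleteSpace W] {f : Ω → W} (hf : ∀ ω, f ω = 0) (m : MeasurableSpace Ω) (ρ : ℝ≥0∞) :
    eLpNorm (P[f | m]) ρ P = 0 := by
  rw [show f = 0 from funext hf, condExp_zero, eLpNorm_zero]

omit [Fact (0 < T)] [IsProbabilityMeasure P] in
lemma condRemSize_self (s : TimeInterval T) : condRemSize F P q r X Y Y' s s = 0 :=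
  eLpNorm_condExp_eq_zero (fun ω => by simp [remainder, tensor_zero_left]) _ _

omit [Fact (0 < T)] in
lemma condNorm_mul_const (hq : 2 ≤ q) (hr : 1 ≤ r) {s : TimeInterval T} {f : Ω → ℝ≥0∞}
    (hf : AEMeasurable f P) (c : ℝ≥0∞) :
    condNorm F P q r s (fun ω => f ω * c) ≤ condNorm F P q r s f * c := by
  have hq0 : 0 < q := by linarith
  refine condNorm_le_of_forall_weight hq hr (hf.mul_const c) fun h hh => ?_
  refine le_trans (le_of_eq ?_) (mul_le_mul_left (hh.eLpNorm_le_condNorm hq hf) c)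
  rw [eLpNorm_eq_lintegral_ennreal hq0, eLpNorm_eq_lintegral_ennreal hq0]
  simp only [ENNReal.mul_rpow_of_nonneg _ _ hq0.le]
  rw [lintegral_mul_const'' _ ((hf.mono_ac weighted_ac).pow_const q),
    ENNReal.mul_rpow_of_nonneg _ _ (by positivity), ← ENNReal.rpow_mul, mul_one_div_cancel hq0.ne',
    ENNReal.rpow_one]

namespace IsStochControlledPath

variable (hX : IsCadlagRoughPath p X XX) (hY : IsStochControlledPath F P p q r X Y Y')
include hY

lemma memLp (hp : 2 ≤ p) (hq : 2 ≤ q) (hr : 1 ≤ r) (t : TimeInterval T) :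
    MemLp (Y t) (ENNReal.ofReal q) P := hY.memVpLqr.memLp (by linarith) hq hr t

lemma memLp_deriv (hp : 2 ≤ p) (hq : 2 ≤ q) (hr : 1 ≤ r) (t : TimeInterval T) :
    MemLp (Y' t) (ENNReal.ofReal q) P := hY.memVpLqr_deriv.memLp (by linarith) hq hr t

lemma memLp_germ (hp : 2 ≤ p) (hq : 2 ≤ q) (hr : 1 ≤ r) (u v : TimeInterval T) :
    MemLp (germ X XX Y Y' u v) (ENNReal.ofReal q) P :=
  (memLp_apply (hY.memLp hp hq hr u) _).add (memLp_apply (hY.memLp_deriv hp hq hr u) _)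

omit [IsProbabilityMeasure P] in
lemma stronglyMeasurable_germ (u v : TimeInterval T) :
    StronglyMeasurable[F u] (germ X XX Y Y' u v) :=
  ((ContinuousLinearMap.apply ℝ E (X v - X u)).continuous.comp_stronglyMeasurable
    (hY.adapted u)).add
  ((ContinuousLinearMap.apply ℝ E (XX u v)).continuous.comp_stronglyMeasurable
    (hY.adapted_deriv u))

lemma memLp_remainder (hp : 2 ≤ p) (hq : 2 ≤ q) (hr : 1 ≤ r) (u v : TimeInterval T) :
    MemLp (remainder X Y Y' u v) (ENNReal.ofReal q) P := by
  have h : MemLp (fun ω => (Y' u ω).comp (tensor (X v - X u))) (ENNReal.ofReal q) P :=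
    ((ContinuousLinearMap.compL ℝ (Vec d) (Mat d) E).flip (tensor (X v - X u))).comp_memLp'
      (hY.memLp_deriv hp hq hr u)
  exact ((hY.memLp hp hq hr v).sub (hY.memLp hp hq hr u)).sub h

include hX

/-- The conditional mean of the defect of the germ. -/
lemma eLpNorm_condExp_defect_le (hp : 2 ≤ p) (hq : 2 ≤ q) (hr : 1 ≤ r) {a c m : TimeInterval T}
    (hac : a ≤ c) (hcm : c ≤ m) :
    eLpNorm (P[defect (germ X XX Y Y') a c m | F a]) (ENNReal.ofReal q * r) P ≤
      condRemSize F P q r X Y Y' a c * ‖X m - X c‖ₑ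
      + condIncrSize F P q r Y' a c * ‖XX c m‖ₑ := by
  have hq1 := one_le_ofReal hq
  have hqr : 1 ≤ ENNReal.ofReal q * r := one_le_mul hq1 hr
  have hR := hY.memLp_remainder hp hq hr a c
  have hY' : MemLp (fun ω => Y' c ω - Y' a ω) (ENNReal.ofReal q) P :=
    (hY.memLp_deriv hp hq hr c).sub (hY.memLp_deriv hp hq hr a)
  have e1 : defect (germ X XX Y Y') a c m =
      -(fun ω => remainder X Y Y' a c ω (X m - X c)) - fun ω => (Y' c ω - Y' a ω) (XX c m) := by
    funext ω
    exact defect_germ hX hac hcm ω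
  have e2 : P[defect (germ X XX Y Y') a c m | F a] =ᵐ[P]
      -(fun ω => (P[remainder X Y Y' a c | F a] ω) (X m - X c))
        - fun ω => (P[fun ω => Y' c ω - Y' a ω | F a] ω) (XX c m) := by
    rw [e1]
    refine (condExp_sub (((memLp_apply hR _).integrable hq1).neg)
      ((memLp_apply hY' _).integrable hq1) _).trans ?_
    refine EventuallyEq.sub ((condExp_neg _ _).trans ?_)
      (condExp_apply (hY'.integrable hq1) _ _)
    exact (condExp_apply (hR.integrable hq1) _ _).neg
  have m1 : AEStronglyMeasurable (fun ω => (P[remainder X Y Y' a c | F a] ω) (X m - X c)) P :=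
    (ContinuousLinearMap.apply ℝ E (X m - X c)).continuous.comp_aestronglyMeasurable
      (stronglyMeasurable_condExp.mono (F.le a)).aestronglyMeasurable
  have m2 : AEStronglyMeasurable
      (fun ω => (P[fun ω => Y' c ω - Y' a ω | F a] ω) (XX c m)) P :=
    (ContinuousLinearMap.apply ℝ E (XX c m)).continuous.comp_aestronglyMeasurable
      (stronglyMeasurable_condExp.mono (F.le a)).aestronglyMeasurable
  rw [eLpNorm_congr_ae e2]
  refine (eLpNorm_sub_le m1.neg m2 hqr).trans (add_le_add ?_ ?_)
  · rw [eLpNorm_neg]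
    exact eLpNorm_apply_le _ _ _
  · refine (eLpNorm_apply_le _ _ _).trans ?_
    gcongr
    exact eLpNorm_condExp_le_condNorm hq hr hY'

/-- A bound for the defect of the germ that is uniform in the last time, if `x` and `y` bound the
increments of the rough path. -/
lemma exists_bound_defect (hp : 2 ≤ p) (hq : 2 ≤ q) (hr : 1 ≤ r) {a c b : TimeInterval T}
    (hac : a ≤ c) {x y : ℝ≥0∞} (hx : ∀ m, c ≤ m → m ≤ b → ‖X m - X c‖ₑ ≤ x)
    (hy : ∀ m, c ≤ m → m ≤ b → ‖XX c m‖ₑ ≤ y) :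
    ∃ g : Ω → ℝ≥0∞, AEMeasurable g P ∧
    (∀ m, c ≤ m → m ≤ b → ∀ ω, ‖defect (germ X XX Y Y') a c m ω‖ₑ ≤ g ω) ∧
    condNorm F P q r a g ≤ (condIncrSize F P q r Y a c
      + eLpNorm (Y' a) (ENNReal.ofReal q * r) P * ‖X c - X a‖ₑ) * x
      + condIncrSize F P q r Y' a c * y := by
  have m1 : AEMeasurable (fun ω => ‖Y c ω - Y a ω‖ₑ) P :=
    ((hY.memLp hp hq hr c).sub (hY.memLp hp hq hr a)).1.enorm
  have m2 : AEMeasurable (fun ω => ‖Y' a ω‖ₑ) P := (hY.memLp_deriv hp hq hr a).1.enorm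
  have m3 : AEMeasurable (fun ω => ‖Y' c ω - Y' a ω‖ₑ) P :=
    ((hY.memLp_deriv hp hq hr c).sub (hY.memLp_deriv hp hq hr a)).1.enorm
  refine ⟨fun ω => (‖Y c ω - Y a ω‖ₑ + ‖Y' a ω‖ₑ * ‖X c - X a‖ₑ) * x + ‖Y' c ω - Y' a ω‖ₑ * y,
    ((m1.add (m2.mul_const _)).mul_const _).add (m3.mul_const _), fun m hcm hmb ω => ?_, ?_⟩
  · rw [defect_germ hX hac hcm]
    refine enorm_sub_le.trans (add_le_add ?_ ?_)
    · rw [enorm_neg]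
      refine ((remainder X Y Y' a c ω).le_opENorm _).trans ?_
      refine mul_le_mul' ?_ (hx m hcm hmb)
      refine enorm_sub_le.trans (add_le_add le_rfl ?_)
      refine (ContinuousLinearMap.opENorm_comp_le _ _).trans ?_
      gcongr
      exact enorm_tensor_le _
    · refine ((Y' c ω - Y' a ω).le_opENorm _).trans ?_
      gcongr
      exact hy m hcm hmb
  · refine (condNorm_add_le hq hr ((m1.add (m2.mul_const _)).mul_const _)
      (m3.mul_const _)).trans (add_le_add ?_ (condNorm_mul_const hq hr m3 _))
    refine (condNorm_mul_const hq hr (m1.add (m2.mul_const _)) _).trans ?_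
    gcongr
    refine (condNorm_add_le hq hr m1 (m2.mul_const _)).trans (add_le_add le_rfl ?_)
    refine (condNorm_mul_const hq hr m2 _).trans ?_
    rw [eLpNorm_eq_condNorm hq (hY.adapted_deriv a)]

end IsStochControlledPath

/-- `‖E_· R^Y‖_{p/2,qr,[a,b)} ‖X‖_{p,[a,b]}` -/
noncomputable def remTerm (F : Filtration (TimeInterval T) mΩ) (P : Measure Ω) (p q : ℝ)
    (r : ℝ≥0∞) (X : TimeInterval T → Vec d) (Y : TimeInterval T → Ω → Vec d →L[ℝ] E)
    (Y' : TimeInterval T → Ω → Mat d →L[ℝ] E) (a b : TimeInterval T) : ℝ≥0∞ :=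
  pVarLeft (p / 2) (condRemSize F P q r X Y Y') a b * pVar p (incrSize X) a b

/-- `‖Y'‖_{p,q,r,[a,b)} ‖𝕏‖_{p/2,[a,b]}` -/
noncomputable def derivTerm (F : Filtration (TimeInterval T) mΩ) (P : Measure Ω) (p q : ℝ)
    (r : ℝ≥0∞) (XX : TimeInterval T → TimeInterval T → Mat d)
    (Y' : TimeInterval T → Ω → Mat d →L[ℝ] E) (a b : TimeInterval T) : ℝ≥0∞ :=
  pVarLeft p (condIncrSize F P q r Y') a b * pVar (p / 2) (twoParamSize XX) a b

/-- `‖Y‖_{p,q,r,[a,b)} ‖X‖_{p,[a,b]}` -/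
noncomputable def incrTerm (F : Filtration (TimeInterval T) mΩ) (P : Measure Ω) (p q : ℝ)
    (r : ℝ≥0∞) (X : TimeInterval T → Vec d) (Y : TimeInterval T → Ω → Vec d →L[ℝ] E)
    (a b : TimeInterval T) : ℝ≥0∞ :=
  pVarLeft p (condIncrSize F P q r Y) a b * pVar p (incrSize X) a b

/-- `sup_{u ∈ [0,T)} ‖Y'_u‖_{L^{qr}} ‖X‖_{p,[a,b)} ‖X‖_{p,[a,b]}` -/
noncomputable def supTerm (P : Measure Ω) (p q : ℝ)
    (r : ℝ≥0∞) (X : TimeInterval T → Vec d) (Y' : TimeInterval T → Ω → Mat d →L[ℝ] E)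
    (a b : TimeInterval T) : ℝ≥0∞ :=
  (⨆ (u : TimeInterval T) (_ : (u : ℝ) < T), eLpNorm (Y' u) (ENNReal.ofReal q * r) P) *
    (pVarLeft p (incrSize X) a b * pVar p (incrSize X) a b)

namespace IsStochControlledPath

variable (hX : IsCadlagRoughPath p X XX) (hY : IsStochControlledPath F P p q r X Y Y')
include hX hY

omit [IsProbabilityMeasure P] in
lemma isSmallControl_remTerm (hp : 2 ≤ p) : IsSmallControl (p / 3) (remTerm F P p q r X Y Y') :=
  isSmallControl_mul (by linarith) (by linarith) (by linarith)
    (by field_simp; norm_num) hY.finite_var_rem.ne hX.pVar_ne_top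
    fun s v _ => hX.tendsto_incrSize s v

omit [IsProbabilityMeasure P] in
lemma isSmallControl_derivTerm (hp : 2 ≤ p) :
    IsSmallControl (p / 3) (derivTerm F P p q r XX Y') :=
  isSmallControl_mul (by linarith) (by linarith) (by linarith)
    (by field_simp; norm_num) hY.memVpLqr_deriv.finite_var.ne hX.pVar_ne_top₂
    fun _ _ h => hX.tendsto_twoParamSize h

omit [IsProbabilityMeasure P] in
lemma isSmallControl_incrTerm (hp : 2 ≤ p) : IsSmallControl (p / 2) (incrTerm F P p q r X Y) :=
  isSmallControl_mul (by linarith) (by linarith) (by linarith)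
    (by field_simp; norm_num) hY.memVpLqr.finite_var.ne hX.pVar_ne_top
    fun s v _ => hX.tendsto_incrSize s v

omit hX [IsProbabilityMeasure P] in
lemma iSup_deriv_ne_top :
    (⨆ (u : TimeInterval T) (_ : (u : ℝ) < T), eLpNorm (Y' u) (ENNReal.ofReal q * r) P) ≠ ∞ :=
  (lt_of_le_of_lt (iSup_mono fun s => iSup_le fun _ => le_refl
    (eLpNorm (Y' s) (ENNReal.ofReal q * r) P)) hY.bounded_deriv).ne

omit [IsProbabilityMeasure P] in
lemma isSmallControl_supTerm (hp : 2 ≤ p) : IsSmallControl (p / 2) (supTerm P p q r X Y') :=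
  (isSmallControl_mul (by linarith) (by linarith) (by linarith)
    (by field_simp; norm_num) hX.pVar_ne_top hX.pVar_ne_top
    fun s v _ => hX.tendsto_incrSize s v).const_mul (by linarith) hY.iSup_deriv_ne_top

/-- The conditional mean of the defect of the germ is controlled by two of the four terms. -/
lemma eLpNorm_condExp_defect_le_terms (hp : 2 ≤ p) (hq : 2 ≤ q) (hr : 1 ≤ r)
    {a c b : TimeInterval T} (hac : a ≤ c) (hcb : c ≤ b) :
    eLpNorm (P[defect (germ X XX Y Y') a c b | F a]) (ENNReal.ofReal q * r) P ≤
      remTerm F P p q r X Y Y' a b + derivTerm F P p q r XX Y' a b := by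
  rcases hcb.eq_or_lt with rfl | hlt
  · rw [defect_self_right (germ_self hX), condExp_zero, eLpNorm_zero]
    exact zero_le
  refine (eLpNorm_condExp_defect_le hX hY hp hq hr hac hcb).trans ?_
  have h1 := (enorm_incr_le_pVar hp hcb le_rfl).trans
    (pVar_mono (g := incrSize X) (by linarith : 0 < p) hac hcb le_rfl)
  have h2 := (hX.enorm_twoParam_le hp hcb le_rfl).trans
    (pVar_mono (g := twoParamSize XX) (by linarith : 0 < p / 2) hac hcb le_rfl)
  have h3 := le_pVarLeft (p := p / 2) (g := condRemSize F P q r X Y Y') (by linarith)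
    condRemSize_self hac hlt
  have h4 := le_pVarLeft (p := p) (g := condIncrSize F P q r Y') (by linarith)
    (condIncrSize_self hq Y') hac hlt
  exact add_le_add (mul_le_mul' h3 h1) (mul_le_mul' h4 h2)

/-- The size of the defect of the germ is controlled by three of the four terms. -/
lemma exists_bound_defect_terms (hp : 2 ≤ p) (hq : 2 ≤ q) (hr : 1 ≤ r)
    {a c b : TimeInterval T} (hac : a ≤ c) (hcb : c ≤ b) :
    ∃ g : Ω → ℝ≥0∞, AEMeasurable g P ∧
    (∀ m, c ≤ m → m ≤ b → ∀ ω, ‖defect (germ X XX Y Y') a c m ω‖ₑ ≤ g ω) ∧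
    condNorm F P q r a g ≤ incrTerm F P p q r X Y a b + supTerm P p q r X Y' a b
      + derivTerm F P p q r XX Y' a b := by
  rcases hcb.eq_or_lt with rfl | hlt
  · refine ⟨fun _ => 0, aemeasurable_const, fun m h1 h2 ω => ?_, ?_⟩
    · rw [le_antisymm h2 h1, defect_self_right (germ_self hX)]
      simp
    · rw [condNorm_zero hq]; exact zero_le
  obtain ⟨g, hg, hle, hnorm⟩ := exists_bound_defect hX hY hp hq hr hac
    (b := b) (x := pVar p (incrSize X) a b) (y := pVar (p / 2) (twoParamSize XX) a b)
    (fun m h1 h2 => (enorm_incr_le_pVar hp h1 h2).trans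
      (pVar_mono (g := incrSize X) (by linarith : 0 < p) hac hcb le_rfl))
    (fun m h1 h2 => (hX.enorm_twoParam_le hp h1 h2).trans
      (pVar_mono (g := twoParamSize XX) (by linarith : 0 < p / 2) hac hcb le_rfl))
  refine ⟨g, hg, hle, hnorm.trans ?_⟩
  have haT : (a : ℝ) < T := by
    have h1 : (a : ℝ) < b := hac.trans_lt hlt
    exact h1.trans_le b.2.2
  have h1 := le_pVarLeft (p := p) (g := condIncrSize F P q r Y) (by linarith)
    (condIncrSize_self hq Y) hac hlt
  have h2 : ‖X c - X a‖ₑ ≤ _ := le_pVarLeft (p := p) (g := incrSize X) (by linarith)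
    (fun s => by simp [incrSize]) hac hlt
  have h3 := le_pVarLeft (p := p) (g := condIncrSize F P q r Y') (by linarith)
    (condIncrSize_self hq Y') hac hlt
  have h4 : eLpNorm (Y' a) (ENNReal.ofReal q * r) P ≤
      ⨆ (u : TimeInterval T) (_ : (u : ℝ) < T), eLpNorm (Y' u) (ENNReal.ofReal q * r) P :=
    le_iSup₂ (f := fun (u : TimeInterval T) (_ : (u : ℝ) < T) =>
      eLpNorm (Y' u) (ENNReal.ofReal q * r) P) a haT
  rw [add_mul, mul_assoc]
  exact add_le_add (add_le_add (mul_le_mul' h1 le_rfl) (mul_le_mul' h4 (mul_le_mul' h2 le_rfl)))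
    (mul_le_mul' h3 le_rfl)

/-- The defect over a short interval to the right of `τ`, uniformly in the left endpoint. -/
lemma eventually_condNorm_defect_le (hp : 2 ≤ p) (hq : 2 ≤ q) (hr : 1 ≤ r) (τ : TimeInterval T)
    {ε : ℝ≥0∞} (hε : 0 < ε) : ∀ᶠ v in 𝓝[>] τ, ∀ a, a ≤ τ →
      condNorm F P q r a (fun ω => ‖defect (germ X XX Y Y') a τ v ω‖ₑ) ≤ ε := by
  set S := ⨆ u, eLpNorm (Y' u) (ENNReal.ofReal q * r) P with hS
  set M₁ := pVar p (condIncrSize F P q r Y) (initialTime T) (finalTime T)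
    + S * pVar p (incrSize X) (initialTime T) (finalTime T) with hM₁
  set M₂ := pVar p (condIncrSize F P q r Y') (initialTime T) (finalTime T) with hM₂
  have hM₁t : M₁ ≠ ∞ := ENNReal.add_ne_top.2 ⟨hY.memVpLqr.finite_var.ne,
    ENNReal.mul_ne_top hY.bounded_deriv.ne hX.pVar_ne_top⟩
  have hM₂t : M₂ ≠ ∞ := hY.memVpLqr_deriv.finite_var.ne
  have hp0 : 0 < p := by linarith
  by_cases hτ : τ = finalTime T
  · have : ∀ᶠ v in 𝓝[>] τ, False := by
      filter_upwards [self_mem_nhdsWithin] with v hv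
      exact absurd (mem_initial_final v).2 (not_le.2 (hτ ▸ hv))
    exact this.mono fun _ h => h.elim
  have hlt : τ < finalTime T := lt_of_le_of_ne (mem_initial_final τ).2 hτ
  have t1 : Tendsto (fun v => pVar p (incrSize X) τ v) (𝓝[>] τ) (𝓝 0) :=
    tendsto_pVar_right hp0 hlt
      ((pVar_mono hp0 (mem_initial_final τ).1 hlt.le le_rfl).trans_lt hX.pVar_ne_top.lt_top).ne
      fun v _ => hX.tendsto_incrSize τ v
  have t2 : Tendsto (fun v => pVar (p / 2) (twoParamSize XX) τ v) (𝓝[>] τ) (𝓝 0) :=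
    tendsto_pVar_right (by linarith) hlt
      ((pVar_mono (by linarith) (mem_initial_final τ).1 hlt.le le_rfl).trans_lt
        hX.pVar_ne_top₂.lt_top).ne
      fun v hv => hX.tendsto_twoParamSize hv
  have t3 : Tendsto (fun v => M₁ * pVar p (incrSize X) τ v
      + M₂ * pVar (p / 2) (twoParamSize XX) τ v) (𝓝[>] τ) (𝓝 0) := by
    simpa using (ENNReal.Tendsto.const_mul t1 (Or.inr hM₁t)).add
      (ENNReal.Tendsto.const_mul t2 (Or.inr hM₂t))
  filter_upwards [t3.eventually (ge_mem_nhds hε), self_mem_nhdsWithin] with v hv hτv a ha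
  have hτv' : τ ≤ v := le_of_lt hτv
  obtain ⟨g, hg, hle, hnorm⟩ := exists_bound_defect hX hY hp hq hr ha
    (b := v) (x := pVar p (incrSize X) τ v) (y := pVar (p / 2) (twoParamSize XX) τ v)
    (fun m h1 h2 => enorm_incr_le_pVar hp h1 h2) (fun m h1 h2 => hX.enorm_twoParam_le hp h1 h2)
  refine (condNorm_mono hq fun ω => hle v hτv' le_rfl ω).trans (hnorm.trans (le_trans ?_ hv))
  have h1 := (le_pVar (p := p) (g := condIncrSize F P q r Y) hp0 (condIncrSize_self hq Y) ha).trans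
    (pVar_mono hp0 (mem_initial_final a).1 ha (mem_initial_final τ).2)
  have h2 : ‖X τ - X a‖ₑ ≤ _ := (le_pVar (p := p) (g := incrSize X) hp0
    (fun s => by simp [incrSize]) ha).trans
    (pVar_mono hp0 (mem_initial_final a).1 ha (mem_initial_final τ).2)
  have h3 := (le_pVar (p := p) (g := condIncrSize F P q r Y') hp0 (condIncrSize_self hq Y')
    ha).trans (pVar_mono hp0 (mem_initial_final a).1 ha (mem_initial_final τ).2)
  have h4 : eLpNorm (Y' a) (ENNReal.ofReal q * r) P ≤ S :=
    le_iSup (fun u => eLpNorm (Y' u) (ENNReal.ofReal q * r) P) a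
  exact add_le_add (mul_le_mul' (add_le_add h1 (mul_le_mul' h4 h2)) le_rfl) (mul_le_mul' h3 le_rfl)

/-- The germ satisfies the assumptions of the estimate for the conditional mean. -/
theorem hasSmallDriftOn_germ (hp : 2 ≤ p) (hq : 2 ≤ q) (hr : 1 ≤ r) {s t : TimeInterval T}
    {B : ℝ≥0∞} (hB : B ≠ 0) (hBt : B ≠ ∞) (h₁ : remTerm F P p q r X Y Y' s t ≤ B)
    (h₂ : derivTerm F P p q r XX Y' s t ≤ B)
    {φ₃ φ₄ : TimeInterval T → TimeInterval T → ℝ≥0∞} (hφ₃ : IsSmallControl (p / 2) φ₃)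
    (hφ₄ : IsSmallControl (p / 2) φ₄) (h₃ : φ₃ s t ≤ B) (h₄ : φ₄ s t ≤ B) :
    HasSmallDriftOn F P q r (3 / p) (32 * B)
      (mixedControl p B (remTerm F P p q r X Y Y') (derivTerm F P p q r XX Y') φ₃ φ₄)
      (germ X XX Y Y') s t where
  meas := hY.stronglyMeasurable_germ
  memLp := hY.memLp_germ hp hq hr
  diag := germ_self hX
  superadd a c b _ hac hcb _ := mixedControl_superadd (by linarith)
    (isSmallControl_remTerm hX hY hp) (isSmallControl_derivTerm hX hY hp) hφ₃ hφ₄ hac hcb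
  le_one := mixedControl_le_one (by linarith) h₁ h₂ h₃ h₄
  drift a c b _ hac hcb _ := (eLpNorm_condExp_defect_le_terms hX hY hp hq hr hac hcb).trans
    (add_le_mixedControl_drift hp hB hBt a b)

/-- The germ satisfies the assumptions of the stochastic sewing lemma. -/
theorem isSewableOn_germ (hp : 2 ≤ p) (hq : 2 ≤ q) (hr : 1 ≤ r) {s t : TimeInterval T}
    {B : ℝ≥0∞} (hB : B ≠ 0) (hBt : B ≠ ∞) (h₁ : remTerm F P p q r X Y Y' s t ≤ B)
    (h₂ : derivTerm F P p q r XX Y' s t ≤ B) (h₃ : incrTerm F P p q r X Y s t ≤ B)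
    (h₄ : supTerm P p q r X Y' s t ≤ B) :
    IsSewableOn F P q r (3 / p) (2 / p) (32 * B)
      (mixedControl p B (remTerm F P p q r X Y Y') (derivTerm F P p q r XX Y')
        (incrTerm F P p q r X Y) (supTerm P p q r X Y')) (germ X XX Y Y') s t := by
  have hp0 : 0 < p := by linarith
  have c₁ := isSmallControl_remTerm hX hY hp
  have c₂ := isSmallControl_derivTerm hX hY hp
  have c₃ := isSmallControl_incrTerm hX hY hp
  have c₄ := isSmallControl_supTerm hX hY hp
  have hdrift := hasSmallDriftOn_germ hX hY hp hq hr hB hBt h₁ h₂ c₃ c₄ h₃ h₄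
  exact
  { hdrift with
    size := fun a c b hsa hac hcb hbt => by
      obtain ⟨g, hg, hle, hnorm⟩ := exists_bound_defect_terms hX hY hp hq hr hac hcb
      exact ⟨g, hg, hle, hnorm.trans (add_le_mixedControl_size hp hB hBt
        (hdrift.le_one' hsa (hac.trans hcb) hbt))⟩
    small_right := fun τ _ _ => tendsto_mixedControl hp0 hB (f := fun _ => τ) (g := fun v => v)
      (c₁.right τ) (c₂.right τ) (c₃.right τ) (c₄.right τ)
    small_left := fun τ _ _ => tendsto_mixedControl hp0 hB (f := fun u => u) (g := fun _ => τ)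
      (c₁.left τ) (c₂.left τ) (c₃.left τ) (c₄.left τ)
    defect_small := fun τ _ _ ε hε =>
      (eventually_condNorm_defect_le hX hY hp hq hr τ hε).mono fun v hv a _ ha => hv a ha }

end IsStochControlledPath

end Germ

/-! ### Distortion and limits in `L^q` -/

/-- Nearly optimal Euclidean coordinates. The infimum in `euclideanDistortion` runs over a nonempty
set, so it is approached. -/
lemma exists_equiv_euclideanDistortion (E : Type*) [NormedAddCommGroup E] [NormedSpace ℝ E]
    [FiniteDimensional ℝ E] : ∃ e : E ≃L[ℝ] EuclideanSpace ℝ (Fin (Module.finrank ℝ E)),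
      ∀ x, ‖x‖ ≤ ‖e x‖ ∧ ‖e x‖ ≤ ((euclideanDistortion E + 1 : ℝ≥0) : ℝ) * ‖x‖ := by
  set S : Set ℝ≥0 := {K : ℝ≥0 | ∃ e : E ≃L[ℝ] EuclideanSpace ℝ (Fin (Module.finrank ℝ E)),
    ∀ x, ‖x‖ ≤ ‖e x‖ ∧ ‖e x‖ ≤ K * ‖x‖} with hS
  have hne : S.Nonempty := by
    have e₀ : E ≃L[ℝ] EuclideanSpace ℝ (Fin (Module.finrank ℝ E)) :=
      ContinuousLinearEquiv.ofFinrankEq (by simp)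
    set c : ℝ := ‖(e₀.symm : EuclideanSpace ℝ (Fin (Module.finrank ℝ E)) →L[ℝ] E)‖ + 1 with hc
    have hc0 : 0 < c := by positivity
    refine ⟨Real.toNNReal c * ‖(e₀ : E →L[ℝ] EuclideanSpace ℝ (Fin (Module.finrank ℝ E)))‖₊,
      e₀.trans (LinearEquiv.smulOfNeZero ℝ _ c hc0.ne').toContinuousLinearEquiv, fun x => ?_⟩
    have hx : ‖(e₀.trans (LinearEquiv.smulOfNeZero ℝ _ c hc0.ne').toContinuousLinearEquiv) x‖
        = c * ‖e₀ x‖ := by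
      change ‖c • e₀ x‖ = _
      rw [norm_smul, Real.norm_of_nonneg hc0.le]
    rw [hx]
    constructor
    · have h := (e₀.symm : EuclideanSpace ℝ (Fin (Module.finrank ℝ E)) →L[ℝ] E).le_opNorm (e₀ x)
      simp only [ContinuousLinearEquiv.coe_coe, ContinuousLinearEquiv.symm_apply_apply] at h
      refine h.trans (mul_le_mul_of_nonneg_right (by rw [hc]; linarith) (norm_nonneg _))
    · have h := (e₀ : E →L[ℝ] EuclideanSpace ℝ (Fin (Module.finrank ℝ E))).le_opNorm x
      rw [NNReal.coe_mul, Real.coe_toNNReal c hc0.le, coe_nnnorm, mul_assoc]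
      exact mul_le_mul_of_nonneg_left h hc0.le
  obtain ⟨K, ⟨e, he⟩, hK⟩ := exists_lt_of_csInf_lt hne
    (show sInf S < euclideanDistortion E + 1 from lt_add_one _)
  refine ⟨e, fun x => ⟨(he x).1, (he x).2.trans ?_⟩⟩
  exact mul_le_mul_of_nonneg_right (NNReal.coe_le_coe.2 hK.le) (norm_nonneg _)

lemma le_mul_of_forall_le_mul_add {x κ b : ℝ≥0∞} (hκ : κ ≠ ∞)
    (h : ∀ η : ℝ≥0∞, η ≠ 0 → η ≠ ∞ → x ≤ κ * (b + η)) : x ≤ κ * b := by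
  have hadd : Tendsto (fun η : ℝ≥0∞ => b + η) (𝓝[>] 0) (𝓝 (b + 0)) :=
    (tendsto_const_nhds.add tendsto_id).mono_left nhdsWithin_le_nhds
  rw [add_zero] at hadd
  refine ge_of_tendsto (ENNReal.Tendsto.const_mul hadd (Or.inr hκ)) ?_
  filter_upwards [self_mem_nhdsWithin,
    mem_nhdsWithin_of_mem_nhds (Iio_mem_nhds (zero_lt_one : (0 : ℝ≥0∞) < 1))] with η h0 h1
  exact h η (ne_of_gt h0) (h1.trans ENNReal.one_lt_top).ne

section Limits

variable {T : ℝ} {Ω : Type*} {mΩ : MeasurableSpace Ω} {P : Measure Ω}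
  [IsProbabilityMeasure P] {F : Filtration (TimeInterval T) mΩ} {p q : ℝ} {r : ℝ≥0∞}
  {V : Type*} [NormedAddCommGroup V]

/-- Processes of finite `p`-variation in `L^{q,r}` have left limits in `L^q`. -/
lemma MemVpLqr.exists_isLeftLimLq [Fact (0 < T)] [CompleteSpace V] {Y : TimeInterval T → Ω → V}
    (hY : MemVpLqr F P p q r Y) (hp : 0 < p) (hq : 2 ≤ q) (hr : 1 ≤ r) {t : TimeInterval T}
    (ht : initialTime T < t) : ∃ l, IsLeftLimLq P q Y t l := by
  have hq1 : Fact (1 ≤ ENNReal.ofReal q) := ⟨one_le_ofReal hq⟩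
  have hYq := hY.memLp hp hq hr
  set Z : TimeInterval T → Lp V (ENNReal.ofReal q) P := fun s => (hYq s).toLp
  have hne : (𝓝[<] t).NeBot := nhdsLT_neBot_of_lt ht
  have hfin : pVarLeft p (condIncrSize F P q r Y) (initialTime T) t ≠ ∞ :=
    (((pVarLeft_le_pVar hp).trans
      (pVar_mono hp le_rfl ht.le (mem_initial_final t).2)).trans_lt hY.finite_var).ne
  have hdist : ∀ u v, u ≤ v → v < t →
      edist (Z u) (Z v) ≤ pVarLeft p (condIncrSize F P q r Y) u t := fun u v huv hvt => by
    rw [edist_comm, Lp.edist_toLp_toLp]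
    exact (eLpNorm_le_condNorm (F := F) (s := u) hq hr ((hYq v).sub (hYq u)).1).trans
      (le_pVarLeft (g := condIncrSize F P q r Y) hp (condIncrSize_self hq Y) huv hvt)
  have hcauchy : Cauchy (map Z (𝓝[<] t)) := by
    rw [EMetric.cauchy_iff]
    refine ⟨hne.map Z |>.ne, fun ε hε => ?_⟩
    obtain ⟨u, hu, hut⟩ := (((tendsto_pVarLeft hp ht hfin).eventually
      (gt_mem_nhds (ENNReal.half_pos hε.ne'))).and (eventually_lt_of_lt ht)).exists
    refine ⟨Z '' Set.Ioo u t, image_mem_map (Ioo_mem_nhdsLT hut.2), ?_⟩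
    rintro _ ⟨v, hv, rfl⟩ _ ⟨w, hw, rfl⟩
    calc edist (Z v) (Z w) ≤ edist (Z u) (Z v) + edist (Z u) (Z w) := edist_triangle_left _ _ _
      _ ≤ pVarLeft p (condIncrSize F P q r Y) u t + pVarLeft p (condIncrSize F P q r Y) u t :=
        add_le_add (hdist u v hv.1.le hv.2) (hdist u w hw.1.le hw.2)
      _ < ε / 2 + ε / 2 := ENNReal.add_lt_add hu hu
      _ = ε := ENNReal.add_halves ε
  obtain ⟨z, hz⟩ := CompleteSpace.complete hcauchy
  refine ⟨z, Lp.memLp z, ?_⟩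
  have hz' : Tendsto (fun s => edist (Z s) z) (𝓝[<] t) (𝓝 0) :=
    tendsto_iff_edist_tendsto_0.1 hz
  refine hz'.congr fun s => ?_
  rw [Lp.edist_def]
  exact eLpNorm_congr_ae ((hYq s).coeFn_toLp.sub EventuallyEq.rfl)

omit [IsProbabilityMeasure P] in
lemma eLpNorm_sub_self (g : Ω → V) (ρ : ℝ≥0∞) : eLpNorm (g - g) ρ P = 0 := by
  rw [sub_self, eLpNorm_zero]

omit [IsProbabilityMeasure P] in
/-- Evaluating `L^q`-convergent random operators at convergent vectors. -/
lemma tendsto_eLpNorm_apply_sub {W E : Type*} [NormedAddCommGroup W] [NormedSpace ℝ W]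
    [NormedAddCommGroup E] [NormedSpace ℝ E] {ι : Type*} {l : Filter ι} {ρ : ℝ≥0∞} (hρ : 1 ≤ ρ)
    {G : ι → Ω → W →L[ℝ] E} {g : Ω → W →L[ℝ] E} {x : ι → W} {y : W} (hG : ∀ i, MemLp (G i) ρ P)
    (hg : MemLp g ρ P) (hGg : Tendsto (fun i => eLpNorm (G i - g) ρ P) l (𝓝 0))
    (hx : Tendsto x l (𝓝 y)) :
    Tendsto (fun i => eLpNorm (fun ω => G i ω (x i) - g ω y) ρ P) l (𝓝 0) := by
  have h1 : Tendsto (fun i => eLpNorm (G i - g) ρ P * ‖x i‖ₑ + eLpNorm g ρ P * ‖x i - y‖ₑ) l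
      (𝓝 (0 * ‖y‖ₑ + eLpNorm g ρ P * ‖y - y‖ₑ)) :=
    (ENNReal.Tendsto.mul hGg (Or.inr enorm_ne_top) hx.enorm (Or.inr ENNReal.zero_ne_top)).add
      (ENNReal.Tendsto.const_mul (hx.sub_const y).enorm (Or.inr hg.2.ne))
  rw [zero_mul, sub_self, enorm_zero, mul_zero, add_zero] at h1
  refine tendsto_of_tendsto_of_tendsto_of_le_of_le tendsto_const_nhds h1 (fun _ => zero_le)
    fun i => ?_
  have e : (fun ω => G i ω (x i) - g ω y) =
      (fun ω => (G i - g) ω (x i)) + fun ω => g ω (x i - y) := by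
    funext ω
    simp
  simp only [e]
  exact (eLpNorm_add_le (memLp_apply ((hG i).sub hg) _).1 (memLp_apply hg _).1 hρ).trans
    (add_le_add (eLpNorm_apply_le _ _ _) (eLpNorm_apply_le _ _ _))

omit [IsProbabilityMeasure P] in
lemma tendsto_eLpNorm_apply_sub_apply {W E : Type*} [NormedAddCommGroup W] [NormedSpace ℝ W]
    [NormedAddCommGroup E] [NormedSpace ℝ E] {ι : Type*} {l : Filter ι} {ρ : ℝ≥0∞} (hρ : 1 ≤ ρ)
    {g : Ω → W →L[ℝ] E} {x : ι → W} {y : W} (hg : MemLp g ρ P) (hx : Tendsto x l (𝓝 y)) :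
    Tendsto (fun i => eLpNorm (fun ω => g ω (x i) - g ω y) ρ P) l (𝓝 0) := by
  refine tendsto_eLpNorm_apply_sub hρ (fun _ => hg) hg ?_ hx
  simp only [eLpNorm_sub_self]
  exact tendsto_const_nhds

end Limits

/-! ### The rough stochastic integral -/

/-- The constant in the estimates for the rough stochastic integral, as a function of the distortion
`D`. The infimum that defines the distortion need not be attained, hence `D + 1`. -/
noncomputable def integralConst (p q : ℝ) (D : ℝ≥0) : ℝ≥0 :=
  (32 * (sewConst q (D + 1) (3 / p) (2 / p) + driftConst (3 / p))).toNNReal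

lemma one_lt_three_div {p : ℝ} (hp : 2 ≤ p) (hp3 : p < 3) : 1 < 3 / p := by
  rw [lt_div_iff₀ (by linarith)]; linarith

lemma half_lt_two_div {p : ℝ} (hp : 2 ≤ p) (hp3 : p < 3) : 1 / 2 < 2 / p := by
  rw [lt_div_iff₀ (by linarith)]; linarith

lemma two_div_le_three_div {p : ℝ} (hp : 2 ≤ p) : 2 / p ≤ 3 / p := by
  gcongr; norm_num

lemma coe_integralConst {p q : ℝ} (hp : 2 ≤ p) (hp3 : p < 3) (D : ℝ≥0) :
    (integralConst p q D : ℝ≥0∞) =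
      32 * (sewConst q (D + 1) (3 / p) (2 / p) + driftConst (3 / p)) :=
  ENNReal.coe_toNNReal (ENNReal.mul_ne_top (by norm_num) (ENNReal.add_ne_top.2
    ⟨sewConst_ne_top (one_lt_three_div hp hp3), driftConst_ne_top (one_lt_three_div hp hp3)⟩))

lemma TimePartition.sum_apply {T : ℝ} {s t : TimeInterval T} {Ω E : Type*} [AddCommMonoid E]
    (π : TimePartition s t) (A : TimeInterval T → TimeInterval T → Ω → E) (ω : Ω) :
    π.sum A ω = π.sum fun u v => A u v ω := by
  simp [TimePartition.sum, Finset.sum_apply]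

variable {T : ℝ} [Fact (0 < T)] {d : ℕ} {Ω : Type*} {mΩ : MeasurableSpace Ω} {P : Measure Ω}
  [IsProbabilityMeasure P] {F : Filtration (TimeInterval T) mΩ}
  {p q : ℝ} {r : ℝ≥0∞} {X : TimeInterval T → Vec d} {XX : TimeInterval T → TimeInterval T → Mat d}
  {E : Type*} [NormedAddCommGroup E] [NormedSpace ℝ E] [CompleteSpace E]
  {Y : TimeInterval T → Ω → Vec d →L[ℝ] E} {Y' : TimeInterval T → Ω → Mat d →L[ℝ] E}
  {I : TimeInterval T → Ω → E}

lemma roughNorm_le (hp : 2 ≤ p) {s t : TimeInterval T} (hst : s ≤ t) :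
    roughNorm p X XX s t ≤ roughNorm p X XX (initialTime T) (finalTime T) :=
  add_le_add (pVar_mono (by linarith) (mem_initial_final s).1 hst (mem_initial_final t).2)
    (pVar_mono (by linarith) (mem_initial_final s).1 hst (mem_initial_final t).2)

section Bound

variable (hX : IsCadlagRoughPath p X XX) (hY : IsStochControlledPath F P p q r X Y Y')
include hX hY

omit [IsProbabilityMeasure P] in
lemma exists_integralBound_le (hp : 2 ≤ p) : ∃ M : ℝ≥0∞, M ≠ ∞ ∧
    ∀ s t, s ≤ t → integralBound F P p q r X XX Y Y' s t ≤ M * roughNorm p X XX s t := by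
  have hp0 : 0 < p := by linarith
  have hp2 : 0 < p / 2 := by linarith
  refine ⟨pVar p (condIncrSize F P q r Y) (initialTime T) (finalTime T)
    + pVar p (condIncrSize F P q r Y') (initialTime T) (finalTime T)
    + pVar (p / 2) (condRemSize F P q r X Y Y') (initialTime T) (finalTime T)
    + pVar p (incrSize X) (initialTime T) (finalTime T) *
      ⨆ (u : TimeInterval T) (_ : (u : ℝ) < T), eLpNorm (Y' u) (ENNReal.ofReal q * r) P,
    ?_, fun s t hst => ?_⟩
  · exact ENNReal.add_ne_top.2 ⟨ENNReal.add_ne_top.2 ⟨ENNReal.add_ne_top.2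
      ⟨hY.memVpLqr.finite_var.ne, hY.memVpLqr_deriv.finite_var.ne⟩, hY.finite_var_rem.ne⟩,
      ENNReal.mul_ne_top hX.pVar_ne_top hY.iSup_deriv_ne_top⟩
  · have h : ∀ {γ : ℝ} (_ : 0 < γ) (g : TimeInterval T → TimeInterval T → ℝ≥0∞),
        pVarLeft γ g s t ≤ pVar γ g (initialTime T) (finalTime T) := fun hγ g =>
      (pVarLeft_le_pVar hγ).trans
        (pVar_mono hγ (mem_initial_final s).1 hst (mem_initial_final t).2)
    exact mul_le_mul' (add_le_add (add_le_add (add_le_add (h hp0 _) (h hp0 _)) (h hp2 _))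
      (mul_le_mul' (h hp0 _) le_rfl)) le_rfl

omit [IsProbabilityMeasure P] in
lemma integralBound_ne_top (hp : 2 ≤ p) {s t : TimeInterval T} (hst : s ≤ t) :
    integralBound F P p q r X XX Y Y' s t ≠ ∞ := by
  obtain ⟨M, hM, hle⟩ := exists_integralBound_le hX hY hp
  exact ((hle s t hst).trans_lt (ENNReal.mul_lt_top hM.lt_top
    ((roughNorm_le hp hst).trans_lt hX.finite_var))).ne

omit [IsProbabilityMeasure P] in
lemma tendsto_integralBound_right (hp : 2 ≤ p) (t : TimeInterval T) :
    Tendsto (fun v => integralBound F P p q r X XX Y Y' t v) (𝓝[>] t) (𝓝 0) := by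
  obtain ⟨M, hM, hle⟩ := exists_integralBound_le hX hY hp
  rcases (mem_initial_final t).2.eq_or_lt with h | hlt
  · have : 𝓝[>] t = ⊥ := by
      rw [← not_neBot]
      intro hne
      obtain ⟨v, hv⟩ := hne.nonempty_of_mem self_mem_nhdsWithin
      exact absurd (mem_initial_final v).2 (not_le.2 (h ▸ hv))
    rw [this]
    exact tendsto_bot
  have h1 : Tendsto (fun v => pVar p (incrSize X) t v) (𝓝[>] t) (𝓝 0) :=
    tendsto_pVar_right (by linarith) hlt ((pVar_mono (by linarith) (mem_initial_final t).1 hlt.le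
      le_rfl).trans_lt hX.pVar_ne_top.lt_top).ne fun v _ => hX.tendsto_incrSize t v
  have h2 : Tendsto (fun v => pVar (p / 2) (twoParamSize XX) t v) (𝓝[>] t) (𝓝 0) :=
    tendsto_pVar_right (by linarith) hlt ((pVar_mono (by linarith) (mem_initial_final t).1 hlt.le
      le_rfl).trans_lt hX.pVar_ne_top₂.lt_top).ne fun v hv => hX.tendsto_twoParamSize hv
  have h3 : Tendsto (fun v => M * roughNorm p X XX t v) (𝓝[>] t) (𝓝 0) := by
    simpa [roughNorm] using ENNReal.Tendsto.const_mul (h1.add h2) (Or.inr hM)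
  refine tendsto_of_tendsto_of_tendsto_of_le_of_le' tendsto_const_nhds h3
    (Eventually.of_forall fun _ => zero_le) ?_
  filter_upwards [self_mem_nhdsWithin] with v hv
  exact hle t v (le_of_lt hv)

omit [IsProbabilityMeasure P] in
/-- The variation over the half-open interval `[s,t)` vanishes as `s ↗ t`, which is what makes the
jumps of the integral canonical. -/
lemma tendsto_integralBound_left (hp : 2 ≤ p) {t : TimeInterval T} (ht : initialTime T < t) :
    Tendsto (fun s => integralBound F P p q r X XX Y Y' s t) (𝓝[<] t) (𝓝 0) := by
  have hp0 : 0 < p := by linarith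
  have h : ∀ {γ : ℝ} {g : TimeInterval T → TimeInterval T → ℝ≥0∞} (_ : 0 < γ)
      (_ : pVar γ g (initialTime T) (finalTime T) ≠ ∞),
      Tendsto (fun s => pVarLeft γ g s t) (𝓝[<] t) (𝓝 0) := fun hγ hg =>
    tendsto_pVarLeft hγ ht (((pVarLeft_le_pVar hγ).trans
      (pVar_mono hγ le_rfl ht.le (mem_initial_final t).2)).trans_lt hg.lt_top).ne
  set S := ⨆ (u : TimeInterval T) (_ : (u : ℝ) < T), eLpNorm (Y' u) (ENNReal.ofReal q * r) P
  have hS : S ≠ ∞ := hY.iSup_deriv_ne_top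
  have h1 : Tendsto (fun s => (pVarLeft p (condIncrSize F P q r Y) s t
      + pVarLeft p (condIncrSize F P q r Y') s t
      + pVarLeft (p / 2) (condRemSize F P q r X Y Y') s t
      + pVarLeft p (incrSize X) s t * S) * roughNorm p X XX (initialTime T) (finalTime T))
      (𝓝[<] t) (𝓝 ((0 + 0 + 0 + 0 * S) * roughNorm p X XX (initialTime T) (finalTime T))) :=
    ENNReal.Tendsto.mul_const ((((h hp0 hY.memVpLqr.finite_var.ne).add
      (h hp0 hY.memVpLqr_deriv.finite_var.ne)).add
      (h (by linarith) hY.finite_var_rem.ne)).add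
      (ENNReal.Tendsto.mul_const (h hp0 hX.pVar_ne_top) (Or.inr hS)))
      (Or.inr hX.finite_var.ne)
  simp only [zero_mul, add_zero] at h1
  refine tendsto_of_tendsto_of_tendsto_of_le_of_le' tendsto_const_nhds h1
    (Eventually.of_forall fun _ => zero_le) ?_
  filter_upwards [self_mem_nhdsWithin] with s hs
  exact mul_le_mul' le_rfl (roughNorm_le hp (le_of_lt hs))

/-- The germ is sewable, with a constant that is as close to `integralBound` as desired. -/
lemma exists_isSewableOn_germ (hp : 2 ≤ p) (hq : 2 ≤ q) (hr : 1 ≤ r) {s t : TimeInterval T}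
    (hst : s ≤ t) {η : ℝ≥0∞} (hη : η ≠ 0) (hηt : η ≠ ∞) :
    ∃ w, IsSewableOn F P q r (3 / p) (2 / p) (32 * (integralBound F P p q r X XX Y Y' s t + η)) w
      (germ X XX Y Y') s t := by
  refine ⟨_, IsStochControlledPath.isSewableOn_germ hX hY hp hq hr (by simp [hη])
    (ENNReal.add_ne_top.2 ⟨integralBound_ne_top hX hY hp hst, hηt⟩) ?_ ?_ ?_ ?_⟩
  · exact le_add_right (mul_le_mul' (le_add_right le_add_self) le_self_add)
  · exact le_add_right (mul_le_mul' (le_add_right (le_add_right le_add_self)) le_add_self)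
  · exact le_add_right (mul_le_mul' (le_add_right (le_add_right le_self_add)) le_self_add)
  · refine le_add_right ?_
    rw [supTerm, ← mul_assoc, mul_comm (⨆ u, _)]
    exact mul_le_mul' le_add_self le_self_add

end Bound

namespace IsStochControlledPath

variable {H : Type*} [NormedAddCommGroup H] [InnerProductSpace ℝ H] [CompleteSpace H]
  (hX : IsCadlagRoughPath p X XX) (hY : IsStochControlledPath F P p q r X Y Y')
include hX hY

theorem exists_isRoughStochIntegral (hp : 2 ≤ p) (hp3 : p < 3) (hq : 2 ≤ q) (hr : 1 ≤ r)
    {K : ℝ≥0} (e : E ≃L[ℝ] H) (he : ∀ x, ‖x‖ ≤ ‖e x‖ ∧ ‖e x‖ ≤ K * ‖x‖) :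
    ∃ I, IsRoughStochIntegral F P q r X XX Y Y' I := by
  obtain ⟨I, hIm, hIq, hI0, hI⟩ := exists_adapted_isSewingLimit (A := germ X XX Y Y')
    (fun s t hst => by
      obtain ⟨w, hw⟩ := exists_isSewableOn_germ hX hY hp hq hr hst one_ne_zero ENNReal.one_ne_top
      exact ⟨_, w, ENNReal.mul_ne_top (by norm_num) (ENNReal.add_ne_top.2
        ⟨integralBound_ne_top hX hY hp hst, ENNReal.one_ne_top⟩), hw⟩)
    hq hr (one_lt_three_div hp hp3) (half_lt_two_div hp hp3) (two_div_le_three_div hp) e he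
  refine ⟨I, hIm, hIq, hI0, fun s t hst => (hI s t hst).tendsto.congr fun π => ?_⟩
  simp only [Pi.sub_apply, π.sum_apply]

lemma isSewingLimit (hI : IsRoughStochIntegral F P q r X XX Y Y' I) (hp : 2 ≤ p) (hp3 : p < 3)
    (hq : 2 ≤ q) (hr : 1 ≤ r) {K : ℝ≥0} (e : E ≃L[ℝ] H)
    (he : ∀ x, ‖x‖ ≤ ‖e x‖ ∧ ‖e x‖ ≤ K * ‖x‖) {s t : TimeInterval T} (hst : s ≤ t) :
    IsSewingLimit F P q r (germ X XX Y Y') s t (I t - I s) := by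
  obtain ⟨w, hw⟩ := exists_isSewableOn_germ hX hY hp hq hr hst one_ne_zero ENNReal.one_ne_top
  refine hw.isSewingLimit_of_tendsto hst (ENNReal.mul_ne_top (by norm_num) (ENNReal.add_ne_top.2
    ⟨integralBound_ne_top hX hY hp hst, ENNReal.one_ne_top⟩)) hq hr (one_lt_three_div hp hp3)
    (half_lt_two_div hp hp3) (two_div_le_three_div hp) e he ((hI.memLp t).sub (hI.memLp s)) ?_
  refine (hI.tendsto s t hst).congr fun π => ?_
  simp only [Pi.sub_apply, π.sum_apply]

/-- The estimate for the conditional mean. Only two of the four terms of the germ's control matter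
here. -/
theorem eLpNorm_condExp_integral_le (hI : IsRoughStochIntegral F P q r X XX Y Y' I) (hp : 2 ≤ p)
    (hp3 : p < 3) (hq : 2 ≤ q) (hr : 1 ≤ r) {K : ℝ≥0} (e : E ≃L[ℝ] H)
    (he : ∀ x, ‖x‖ ≤ ‖e x‖ ∧ ‖e x‖ ≤ K * ‖x‖) {s t : TimeInterval T} (hst : s ≤ t) :
    eLpNorm (P[fun ω => I t ω - I s ω - germ X XX Y Y' s t ω | F s]) (ENNReal.ofReal q * r) P ≤
      32 * driftConst (3 / p) *
        (remTerm F P p q r X Y Y' s t + derivTerm F P p q r XX Y' s t) := by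
  have hα := one_lt_three_div hp hp3
  refine le_mul_of_forall_le_mul_add
    (ENNReal.mul_ne_top (by norm_num) (driftConst_ne_top hα)) fun η hη hηt => ?_
  have hz : IsSmallControl (p / 2) fun _ _ : TimeInterval T => (0 : ℝ≥0∞) :=
    isSmallControl_zero (by linarith)
  have h := hasSmallDriftOn_germ hX hY hp hq hr
    (B := remTerm F P p q r X Y Y' s t + derivTerm F P p q r XX Y' s t + η) (by simp [hη])
    (ENNReal.add_ne_top.2 ⟨ENNReal.add_ne_top.2 ⟨(isSmallControl_remTerm hX hY hp).ne_top s t hst,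
      (isSmallControl_derivTerm hX hY hp).ne_top s t hst⟩, hηt⟩)
    (le_add_right le_self_add) (le_add_right le_add_self) hz hz zero_le zero_le
  have h1 := h.eLpNorm_condExp_limit_le hq hr hα le_rfl hst le_rfl
    ((hI.memLp t).sub (hI.memLp s)) (isSewingLimit hX hY hI hp hp3 hq hr e he hst)
  refine h1.trans ?_
  calc _ ≤ driftConst (3 / p) * (32 * (remTerm F P p q r X Y Y' s t
        + derivTerm F P p q r XX Y' s t + η)) * 1 := by
        gcongr
        exact ENNReal.rpow_le_one h.le_one (by positivity)
    _ = _ := by ring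

/-- The size estimate, in maximal form over a finite set of times. -/
theorem condNorm_iSup_integral_le (hI : IsRoughStochIntegral F P q r X XX Y Y' I) (hp : 2 ≤ p)
    (hp3 : p < 3) (hq : 2 ≤ q) (hr : 1 ≤ r) {K : ℝ≥0} (e : E ≃L[ℝ] H)
    (he : ∀ x, ‖x‖ ≤ ‖e x‖ ∧ ‖e x‖ ≤ K * ‖x‖) {s t : TimeInterval T} (hst : s ≤ t)
    (V : Finset (TimeInterval T)) (hV : ∀ v ∈ V, s ≤ v ∧ v ≤ t) :
    condNorm F P q r s (fun ω => ⨆ v ∈ V, ‖(I v - I s - germ X XX Y Y' s v) ω‖ₑ) ≤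
      32 * sewConst q K (3 / p) (2 / p) * integralBound F P p q r X XX Y Y' s t := by
  have hα := one_lt_three_div hp hp3
  refine le_mul_of_forall_le_mul_add
    (ENNReal.mul_ne_top (by norm_num) (sewConst_ne_top hα)) fun η hη hηt => ?_
  obtain ⟨w, hw⟩ := exists_isSewableOn_germ hX hY hp hq hr hst hη hηt
  refine (hw.condNorm_iSup_limit_le hq hr hα (half_lt_two_div hp hp3) (two_div_le_three_div hp)
    e he le_rfl hst le_rfl hI.memLp
    (fun v hv _ => isSewingLimit hX hY hI hp hp3 hq hr e he hv) V hV).trans ?_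
  calc _ ≤ sewConst q K (3 / p) (2 / p)
        * (32 * (integralBound F P p q r X XX Y Y' s t + η)) * 1 := by
        gcongr
        exact ENNReal.rpow_le_one hw.le_one (by positivity)
    _ = _ := by ring

theorem condNorm_integral_le (hI : IsRoughStochIntegral F P q r X XX Y Y' I) (hp : 2 ≤ p)
    (hp3 : p < 3) (hq : 2 ≤ q) (hr : 1 ≤ r) {K : ℝ≥0} (e : E ≃L[ℝ] H)
    (he : ∀ x, ‖x‖ ≤ ‖e x‖ ∧ ‖e x‖ ≤ K * ‖x‖) {s t : TimeInterval T} (hst : s ≤ t) :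
    condNorm F P q r s (fun ω => ‖I t ω - I s ω - germ X XX Y Y' s t ω‖ₑ) ≤
      32 * sewConst q K (3 / p) (2 / p) * integralBound F P p q r X XX Y Y' s t := by
  simpa using condNorm_iSup_integral_le hX hY hI hp hp3 hq hr e he hst {t} (by simp [hst])

theorem exists_cadlag_integral (hI : IsRoughStochIntegral F P q r X XX Y Y' I) (hp : 2 ≤ p)
    (hp3 : p < 3) (hq : 2 ≤ q) (hr : 1 ≤ r) {K : ℝ≥0} (e : E ≃L[ℝ] H)
    (he : ∀ x, ‖x‖ ≤ ‖e x‖ ∧ ‖e x‖ ≤ K * ‖x‖) (hF : IsCompleteFiltration F P) :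
    ∃ J : TimeInterval T → Ω → E, StronglyAdapted F J ∧ (∀ t, J t =ᵐ[P] I t) ∧
      (∀ ω, IsCadlag fun t => J t ω) ∧ ∀ s t, s ≤ t →
        condNorm F P q r s (fun ω => ⨆ v : Set.Icc s t, ‖J v ω - J s ω - germ X XX Y Y' s v ω‖ₑ) ≤
          32 * sewConst q K (3 / p) (2 / p) * integralBound F P p q r X XX Y Y' s t := by
  have hif : initialTime T ≤ finalTime T := (mem_initial_final (initialTime T)).2
  have hright : ∀ ω u v, u ≤ v → Tendsto (fun x => germ X XX Y Y' u x ω) (𝓝[>] v)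
      (𝓝 (germ X XX Y Y' u v ω)) := fun ω u v huv =>
    (((Y u ω).continuous.tendsto _).comp ((hX.cadlag v).1.sub_const (X u))).add
      (((Y' u ω).continuous.tendsto _).comp (hX.cadlag₂.right_snd u v huv))
  obtain ⟨w, hw⟩ := exists_isSewableOn_germ hX hY hp hq hr hif one_ne_zero ENNReal.one_ne_top
  obtain ⟨J, hJm, hJI, hJ⟩ := hw.exists_cadlag_version (ENNReal.mul_ne_top (by norm_num)
    (ENNReal.add_ne_top.2 ⟨integralBound_ne_top hX hY hp hif, ENNReal.one_ne_top⟩)) hq hr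
    (one_lt_three_div hp hp3) (half_lt_two_div hp hp3) (two_div_le_three_div hp) e he
    hI.adapted hI.memLp hI.initial
    (fun a b hab => isSewingLimit hX hY hI hp hp3 hq hr e he hab) hright
    (fun ω u v huv => by
      obtain ⟨x, hx⟩ := (hX.cadlag v).2
      obtain ⟨y, hy⟩ := hX.cadlag₂.left_snd u v huv
      exact ⟨_, (((Y u ω).continuous.tendsto _).comp (hx.sub_const (X u))).add
        (((Y' u ω).continuous.tendsto _).comp hy)⟩) hF
  refine ⟨J, hJm, hJI, hJ, fun s t hst => ?_⟩
  refine condNorm_iSup_Icc_le (f := fun v => I v - I s - germ X XX Y Y' s v)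
    (g := fun v ω => J v ω - J s ω - germ X XX Y Y' s v ω) hq hr hst
    (fun v => (((hI.memLp v).sub (hI.memLp s)).sub (hY.memLp_germ hp hq hr s v)).1)
    (fun v => ?_) (fun ω v hsv => ((hJ ω v).1.sub_const _).sub (hright ω s v hsv))
    fun V hV => condNorm_iSup_integral_le hX hY hI hp hp3 hq hr e he hst V hV
  filter_upwards [hJI v, hJI s] with ω h1 h2
  simp [h1, h2]

lemma eLpNorm_integral_sub_germ_le (hI : IsRoughStochIntegral F P q r X XX Y Y' I) (hp : 2 ≤ p)
    (hp3 : p < 3) (hq : 2 ≤ q) (hr : 1 ≤ r) {K : ℝ≥0} (e : E ≃L[ℝ] H)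
    (he : ∀ x, ‖x‖ ≤ ‖e x‖ ∧ ‖e x‖ ≤ K * ‖x‖) {s t : TimeInterval T} (hst : s ≤ t) :
    eLpNorm (I t - I s - germ X XX Y Y' s t) (ENNReal.ofReal q) P ≤
      32 * sewConst q K (3 / p) (2 / p) * integralBound F P p q r X XX Y Y' s t :=
  (eLpNorm_le_condNorm (F := F) (s := s) hq hr
    (((hI.memLp t).sub (hI.memLp s)).sub (hY.memLp_germ hp hq hr s t)).1).trans
    (condNorm_integral_le hX hY hI hp hp3 hq hr e he hst)

lemma tendsto_integral_right (hI : IsRoughStochIntegral F P q r X XX Y Y' I) (hp : 2 ≤ p)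
    (hp3 : p < 3) (hq : 2 ≤ q) (hr : 1 ≤ r) {K : ℝ≥0} (e : E ≃L[ℝ] H)
    (he : ∀ x, ‖x‖ ≤ ‖e x‖ ∧ ‖e x‖ ≤ K * ‖x‖) (t : TimeInterval T) :
    Tendsto (fun v => eLpNorm (I v - I t) (ENNReal.ofReal q) P) (𝓝[>] t) (𝓝 0) := by
  have hq1 := one_le_ofReal hq
  have hκ : 32 * sewConst q K (3 / p) (2 / p) ≠ ∞ :=
    ENNReal.mul_ne_top (by norm_num) (sewConst_ne_top (one_lt_three_div hp hp3))
  have h1 := ENNReal.Tendsto.const_mul (tendsto_integralBound_right hX hY hp t) (Or.inr hκ)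
  have h2 := tendsto_eLpNorm_apply_sub_apply (l := 𝓝[>] t) hq1 (hY.memLp hp hq hr t)
    ((hX.cadlag t).1.sub_const (X t))
  have h3 := tendsto_eLpNorm_apply_sub_apply (l := 𝓝[>] t) hq1 (hY.memLp_deriv hp hq hr t)
    (hX.cadlag₂.right_snd t t le_rfl)
  have h4 := h1.add (h2.add h3)
  rw [mul_zero, add_zero, add_zero] at h4
  refine tendsto_of_tendsto_of_tendsto_of_le_of_le' tendsto_const_nhds h4
    (Eventually.of_forall fun _ => zero_le) ?_
  filter_upwards [self_mem_nhdsWithin] with v hv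
  have e1 : I v - I t = (I v - I t - germ X XX Y Y' t v)
      + ((fun ω => Y t ω (X v - X t) - Y t ω (X t - X t))
        + fun ω => Y' t ω (XX t v) - Y' t ω (XX t t)) := by
    funext ω
    simp [germ, hX.diag]
  have m1 := memLp_apply (hY.memLp hp hq hr t)
  have m2 := memLp_apply (hY.memLp_deriv hp hq hr t)
  rw [e1]
  refine (eLpNorm_add_le (((hI.memLp v).sub (hI.memLp t)).sub (hY.memLp_germ hp hq hr t v)).1
    (((m1 _).sub (m1 _)).add ((m2 _).sub (m2 _))).1 hq1).trans (add_le_add ?_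
    (eLpNorm_add_le ((m1 _).sub (m1 _)).1 ((m2 _).sub (m2 _)).1 hq1))
  exact eLpNorm_integral_sub_germ_le hX hY hI hp hp3 hq hr e he (le_of_lt hv)

/-- The left limits of the integral, with the canonical jump. -/
theorem isLeftLimLq_integral (hI : IsRoughStochIntegral F P q r X XX Y Y' I) (hp : 2 ≤ p)
    (hp3 : p < 3) (hq : 2 ≤ q) (hr : 1 ≤ r) {K : ℝ≥0} (e : E ≃L[ℝ] H)
    (he : ∀ x, ‖x‖ ≤ ‖e x‖ ∧ ‖e x‖ ≤ K * ‖x‖) {t : TimeInterval T} (ht : initialTime T < t)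
    {Xl : Vec d} {XXl : Mat d} {Yl : Ω → Vec d →L[ℝ] E} {Yl' : Ω → Mat d →L[ℝ] E}
    (hXl : Tendsto X (𝓝[<] t) (𝓝 Xl)) (hXXl : Tendsto (fun s => XX s t) (𝓝[<] t) (𝓝 XXl))
    (hYl : IsLeftLimLq P q Y t Yl) (hYl' : IsLeftLimLq P q Y' t Yl') :
    IsLeftLimLq P q I t fun ω => I t ω - (Yl ω (X t - Xl) + Yl' ω XXl) := by
  have hq1 := one_le_ofReal hq
  have hκ : 32 * sewConst q K (3 / p) (2 / p) ≠ ∞ :=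
    ENNReal.mul_ne_top (by norm_num) (sewConst_ne_top (one_lt_three_div hp hp3))
  have m1 := memLp_apply hYl.1
  have m2 := memLp_apply hYl'.1
  have m3 := fun s => memLp_apply (hY.memLp hp hq hr s)
  have m4 := fun s => memLp_apply (hY.memLp_deriv hp hq hr s)
  refine ⟨(hI.memLp t).sub ((m1 _).add (m2 _)), ?_⟩
  have h1 := ENNReal.Tendsto.const_mul (tendsto_integralBound_left hX hY hp ht) (Or.inr hκ)
  have h2 := tendsto_eLpNorm_apply_sub hq1 (hY.memLp hp hq hr) hYl.1 hYl.2 (hXl.const_sub (X t))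
  have h3 := tendsto_eLpNorm_apply_sub hq1 (hY.memLp_deriv hp hq hr) hYl'.1 hYl'.2 hXXl
  have h4 := h1.add (h2.add h3)
  rw [mul_zero, add_zero, add_zero] at h4
  refine tendsto_of_tendsto_of_tendsto_of_le_of_le' tendsto_const_nhds h4
    (Eventually.of_forall fun _ => zero_le) ?_
  filter_upwards [self_mem_nhdsWithin] with s hs
  have e1 : (I s - fun ω => I t ω - (Yl ω (X t - Xl) + Yl' ω XXl)) =
      -((I t - I s - germ X XX Y Y' s t)
      + ((fun ω => Y s ω (X t - X s) - Yl ω (X t - Xl))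
        + fun ω => Y' s ω (XX s t) - Yl' ω XXl)) := by
    funext ω
    simp only [germ, Pi.sub_apply, Pi.neg_apply, Pi.add_apply]
    abel
  rw [e1, eLpNorm_neg]
  refine (eLpNorm_add_le (((hI.memLp t).sub (hI.memLp s)).sub (hY.memLp_germ hp hq hr s t)).1
    (((m3 s _).sub (m1 _)).add ((m4 s _).sub (m2 _))).1 hq1).trans (add_le_add ?_
    (eLpNorm_add_le ((m3 s _).sub (m1 _)).1 ((m4 s _).sub (m2 _)).1 hq1))
  exact eLpNorm_integral_sub_germ_le hX hY hI hp hp3 hq hr e he (le_of_lt hs)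

end IsStochControlledPath

end RoughStoch

open RoughStoch
theorem lemma3p5 (p q : ℝ) (hp : 2 ≤ p ∧ p < 3) (hq : 2 ≤ q) :
    ∃ C : ℝ≥0 → ℝ≥0,
    ∀ (E : Type*) [NormedAddCommGroup E] [NormedSpace ℝ E] [FiniteDimensional ℝ E]
      [CompleteSpace E] (d : ℕ) (T : ℝ) [Fact (0 < T)] (Ω : Type*) [mΩ : MeasurableSpace Ω]
      (P : Measure Ω) [IsProbabilityMeasure P] (F : Filtration (TimeInterval T) mΩ)
      (r : ℝ≥0∞) (_hr : 1 ≤ r)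
      (X : TimeInterval T → Vec d) (XX : TimeInterval T → TimeInterval T → Mat d)
      (_hX : IsCadlagRoughPath p X XX)
      (Y : TimeInterval T → Ω → Vec d →L[ℝ] E) (Y' : TimeInterval T → Ω → Mat d →L[ℝ] E)
      (_hY : IsStochControlledPath F P p q r X Y Y'),
      -- the rough stochastic integral exists
      (∃ I, IsRoughStochIntegral F P q r X XX Y Y' I) ∧
      -- and it has the following properties
      ∀ I, IsRoughStochIntegral F P q r X XX Y Y' I →
        -- the conditional estimate in `L^{qr}`
        (∀ s t, s ≤ t →
          eLpNorm (P[fun ω => I t ω - I s ω - germ X XX Y Y' s t ω | F s])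
              (ENNReal.ofReal q * r) P
            ≤ C (euclideanDistortion E) *
              (pVarLeft (p / 2) (condRemSize F P q r X Y Y') s t * pVar p (incrSize X) s t
                + pVarLeft p (condIncrSize F P q r Y') s t
                  * pVar (p / 2) (twoParamSize XX) s t)) ∧
        -- the estimate in `L^{q,r}_s`
        (∀ s t, s ≤ t →
          condNorm F P q r s (fun ω => ‖I t ω - I s ω - germ X XX Y Y' s t ω‖ₑ)
            ≤ C (euclideanDistortion E) * integralBound F P p q r X XX Y Y' s t) ∧
        -- if the filtration is complete, there is a càdlàg version, with a uniform estimate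
        (IsCompleteFiltration F P →
          ∃ J : TimeInterval T → Ω → E, StronglyAdapted F J ∧ (∀ t, J t =ᵐ[P] I t) ∧
            (∀ ω, IsCadlag fun t => J t ω) ∧
            ∀ s t, s ≤ t →
              condNorm F P q r s
                  (fun ω => ⨆ v : Set.Icc s t, ‖J v ω - J s ω - germ X XX Y Y' s v ω‖ₑ)
                ≤ C (euclideanDistortion E) * integralBound F P p q r X XX Y Y' s t) ∧
        -- the integral is càdlàg in `L^q`, and its jumps have the canonical form
        IsCadlagInLq P q I ∧
        ∀ t, initialTime T < t →
          ∃ (Xl : Vec d) (XXl : Mat d) (Yl : Ω → Vec d →L[ℝ] E) (Yl' : Ω → Mat d →L[ℝ] E)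
            (Il : Ω → E),
            Tendsto X (𝓝[<] t) (𝓝 Xl) ∧ Tendsto (fun s => XX s t) (𝓝[<] t) (𝓝 XXl) ∧
            IsLeftLimLq P q Y t Yl ∧ IsLeftLimLq P q Y' t Yl' ∧ IsLeftLimLq P q I t Il ∧
            (fun ω => I t ω - Il ω) =ᵐ[P] fun ω => Yl ω (X t - Xl) + Yl' ω XXl := by
  obtain ⟨hp2, hp3⟩ := hp
  refine ⟨integralConst p q, fun E _ _ _ _ d T _ Ω mΩ P _ F r hr X XX hX Y Y' hY => ?_⟩
  obtain ⟨e, he⟩ := exists_equiv_euclideanDistortion E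
  have hC := coe_integralConst (q := q) hp2 hp3 (euclideanDistortion E)
  have hle : 32 * sewConst q (euclideanDistortion E + 1) (3 / p) (2 / p) ≤
      (integralConst p q (euclideanDistortion E) : ℝ≥0∞) := by
    rw [hC]
    exact mul_le_mul' le_rfl le_self_add
  have hle' : 32 * driftConst (3 / p) ≤ (integralConst p q (euclideanDistortion E) : ℝ≥0∞) := by
    rw [hC]
    exact mul_le_mul' le_rfl le_add_self
  refine ⟨hY.exists_isRoughStochIntegral hX hp2 hp3 hq hr e he, fun I hI =>
    ⟨fun s t hst => ?_, fun s t hst => ?_, fun hF => ?_, ⟨hI.memLp, fun t => ?_, fun t => ?_⟩,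
      fun t ht => ?_⟩⟩
  · exact (hY.eLpNorm_condExp_integral_le hX hI hp2 hp3 hq hr e he hst).trans
      (mul_le_mul' hle' le_rfl)
  · exact (hY.condNorm_integral_le hX hI hp2 hp3 hq hr e he hst).trans (mul_le_mul' hle le_rfl)
  · obtain ⟨J, hJm, hJI, hJ, h⟩ := hY.exists_cadlag_integral hX hI hp2 hp3 hq hr e he hF
    exact ⟨J, hJm, hJI, hJ, fun s t hst => (h s t hst).trans (mul_le_mul' hle le_rfl)⟩
  · exact hY.tendsto_integral_right hX hI hp2 hp3 hq hr e he t
  · rcases (mem_initial_final t).1.eq_or_lt with rfl | ht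
    · -- there are no times before the initial time
      have hbot : 𝓝[<] initialTime T = ⊥ := by
        rw [← not_neBot]
        intro hne
        obtain ⟨v, hv⟩ := hne.nonempty_of_mem self_mem_nhdsWithin
        exact absurd (mem_initial_final v).1 (not_le.2 hv)
      exact ⟨0, MemLp.zero, by rw [hbot]; exact tendsto_bot⟩
    · obtain ⟨Xl, hXl⟩ := (hX.cadlag t).2
      obtain ⟨XXl, hXXl⟩ := hX.cadlag₂.left_fst t t le_rfl
      obtain ⟨Yl, hYl⟩ := hY.memVpLqr.exists_isLeftLimLq (by linarith) hq hr ht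
      obtain ⟨Yl', hYl'⟩ := hY.memVpLqr_deriv.exists_isLeftLimLq (by linarith) hq hr ht
      exact ⟨_, hY.isLeftLimLq_integral hX hI hp2 hp3 hq hr e he ht hXl hXXl hYl hYl'⟩
  · obtain ⟨Xl, hXl⟩ := (hX.cadlag t).2
    obtain ⟨XXl, hXXl⟩ := hX.cadlag₂.left_fst t t le_rfl
    obtain ⟨Yl, hYl⟩ := hY.memVpLqr.exists_isLeftLimLq (by linarith) hq hr ht
    obtain ⟨Yl', hYl'⟩ := hY.memVpLqr_deriv.exists_isLeftLimLq (by linarith) hq hr ht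
    exact ⟨Xl, XXl, Yl, Yl', _, hXl, hXXl, hYl, hYl',
      hY.isLeftLimLq_integral hX hI hp2 hp3 hq hr e he ht hXl hXXl hYl hYl',
      Eventually.of_forall fun ω => sub_sub_cancel _ _⟩
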